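/- Setting. For a finite simple graph $G=(V,E)$ with $n=|V|\ge 1$, an integer $q\ge 2$ and a real $\lambda>1$, the Gibbs distribution of the $q$-state Potts model on $G$ at activity $\lambda$ is the probability distribution $\pi$ on $\Omega=\{1,\dots,q\}^V$ with $\pi(\sigma)\propto\lambda^{\mu(\sigma)}$, where $\mu(\sigma)$ is the number of edges of $G$ whose endpoints have the same colour in $\sigma$. The Glauber dynamics is the Markov chain on $\Omega$ which, from the state $X$, chooses a vertex $v\in V$ uniformly at random and recolours $v$ with a colour $c$ chosen with probability proportional to $\lambda^{n(X,v,c)}$, where $n(X,v,c)$ is the number of neighbours of $v$ that have colour $c$ in $X$. With $P$ its transition matrix and $\|\cdot\|_{TV}$ the total variation distance, put $\tau(G,\varepsilon)=\max_{x\in\Omega}\min\{t\ge 0:\|P^t(x,\cdot)-\pi\|_{TV}\le\varepsilon\}$. Theorem. Fix an integer $\Delta\ge 2$ and $\eta\in(0,1)$. There are constants $c_1,c_2>0$, depending only on $\Delta$ and $\eta$, such that for every integer $q\ge 2$ and every real $\lambda>1$ the following hold. (i) If $q>c_1\lambda^{\Delta-1+\eta}$, then the Glauber dynamics of the $q$-state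 Potts model at activity $\lambda$ mixes rapidly for the class of connected graphs of maximum degree at most $\Delta$: there are $C$ and $d$ (which may depend on $\Delta,\eta,q,\lambda$) such that $\tau(G,\varepsilon)\le C\,n^{d}\,(1+\log(1/\varepsilon))$ for every connected graph $G$ on $n$ vertices of maximum degree at most $\Delta$ and every $\varepsilon\in(0,1)$. (ii) If $\Delta\ge 3$ and $q<c_2\lambda^{\Delta-1-\frac{1}{\Delta-1}-\eta}$, then the Glauber dynamics of the $q$-state Potts model at activity $\lambda$ mixes slowly for almost all $\Delta$-regular graphs: there is $\alpha>0$ (which may depend on $\Delta,\eta,q,\lambda$) such that for every $\varepsilon\in(0,\tfrac12)$ the probability that a uniformly random $\Delta$-regular graph $G$ on the vertex set $\{1,\dots,n\}$ satisfies $\tau(G,\varepsilon)\ge e^{\alpha n}$ tends to $1$ as $n\to\infty$ (with $n$ restricted to even values if $\Delta$ is odd). -/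

import Mathlib

open scoped ENNReal Topology

universe u

namespace Potts

noncomputable section

/-- Total variation distance of two probability vectors on a finite set. -/
def tvDist {Ω : Type*} [Fintype Ω] (φ ψ : Ω → ℝ) : ℝ :=
  (1 / 2) * ∑ x, |φ x - ψ x|

/-- `τ_x(M, ε)`: the least `t` with `‖P^t(x, ·) - π‖_TV ≤ ε` (and `⊤` if there is no such `t`). -/
def mixingTimeFrom {Ω : Type*} [Fintype Ω] [DecidableEq Ω]
    (P : Matrix Ω Ω ℝ) (π : Ω → ℝ) (ε : ℝ) (x : Ω) : ℕ∞ :=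
  ⨅ t ∈ {t : ℕ | tvDist ((P ^ t) x) π ≤ ε}, (t : ℕ∞)

/-- `τ(M, ε) = max_x τ_x(M, ε)`. -/
def mixingTime {Ω : Type*} [Fintype Ω] [DecidableEq Ω]
    (P : Matrix Ω Ω ℝ) (π : Ω → ℝ) (ε : ℝ) : ℕ∞ :=
  ⨆ x, mixingTimeFrom P π ε x

section Graph

variable {V : Type u} [Fintype V] [DecidableEq V] (G : SimpleGraph V) [DecidableRel G.Adj]

/-- `μ(σ)`: the number of edges of `G` that are monochromatic in the configuration `σ`. -/
def monoEdges {q : ℕ} (σ : V → Fin q) : ℕ :=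
  (G.edgeFinset.filter fun e => (e.map σ).IsDiag).card

/-- The partition function. -/
def partitionFn (lam : ℝ) (q : ℕ) : ℝ :=
  ∑ σ : V → Fin q, lam ^ monoEdges G σ

/-- The Gibbs distribution on configurations. -/
def gibbs (lam : ℝ) (q : ℕ) (σ : V → Fin q) : ℝ :=
  lam ^ monoEdges G σ / partitionFn G lam q

/-- `n(X, v, c)`: the number of neighbours of `v` that have colour `c` in `X`. -/
def nbrCount {q : ℕ} (X : V → Fin q) (v : V) (c : Fin q) : ℕ :=
  ((G.neighborFinset v).filter fun u => X u = c).card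

/-- The local Gibbs distribution on the colours of `v`, given the configuration `X`. -/
def localDist (lam : ℝ) {q : ℕ} (X : V → Fin q) (v : V) (c : Fin q) : ℝ :=
  lam ^ nbrCount G X v c / ∑ c' : Fin q, lam ^ nbrCount G X v c'

/-- Transition matrix of the Glauber dynamics: choose a vertex `v` uniformly at random,
choose a colour `c` from the local distribution at `v`, and recolour `v` with `c`. -/
def glauber (lam : ℝ) (q : ℕ) : Matrix (V → Fin q) (V → Fin q) ℝ :=
  fun X Y => ∑ v : V, (1 / (Fintype.card V : ℝ)) *
    ∑ c : Fin q, localDist G lam X v c * (if Function.update X v c = Y then 1 else 0)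

/-- Mixing time of the Glauber dynamics of the `q`-state Potts model on `G` at activity `lam`. -/
def glauberMixingTime (lam : ℝ) (q : ℕ) (ε : ℝ) : ℕ∞ :=
  mixingTime (glauber G lam q) (gibbs G lam q) ε

end Graph

open Classical in
/-- The connected graphs of maximum degree at most `Δ`. -/
def ConnectedMaxDegree (Δ : ℕ) (V : Type u) [Fintype V] (G : SimpleGraph V) : Prop :=
  G.Connected ∧ G.maxDegree ≤ Δ

open Classical in
/-- The Glauber dynamics mixes rapidly for the class `𝒞` of finite graphs: the mixing time is at
most a polynomial in the number of vertices (the same one for all graphs of the class), with the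
usual logarithmic dependence on the accuracy `ε`. -/
def MixesRapidlyOn (lam : ℝ) (q : ℕ)
    (𝒞 : (V : Type u) → [Fintype V] → SimpleGraph V → Prop) : Prop :=
  ∃ (C : ℝ) (d : ℕ), ∀ (V : Type u) [Fintype V] (G : SimpleGraph V), 𝒞 V G →
    ∀ ε : ℝ, 0 < ε → ε < 1 →
      (glauberMixingTime G lam q ε : ℝ≥0∞) ≤
        ENNReal.ofReal (C * (Fintype.card V : ℝ) ^ d * (1 + Real.log (1 / ε)))

open Classical in
/-- A property holds for almost all `Δ`-regular graphs: the probability that a uniformly random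
`Δ`-regular graph on `n` labelled vertices has it tends to `1` as `n → ∞` (with `n` restricted to
even values if `Δ` is odd). -/
def AlmostAllRegular (Δ : ℕ) (A : (n : ℕ) → SimpleGraph (Fin n) → Prop) : Prop :=
  Filter.Tendsto
    (fun n : ℕ =>
      ({G : SimpleGraph (Fin n) | G.IsRegularOfDegree Δ ∧ A n G}.ncard : ℝ) /
        ({G : SimpleGraph (Fin n) | G.IsRegularOfDegree Δ}.ncard : ℝ))
    (Filter.atTop ⊓ Filter.principal {n : ℕ | Even (n * Δ)}) (𝓝 1)

open Classical in
/-- The Glauber dynamics mixes slowly for almost all `Δ`-regular graphs: there is an exponential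
rate `α > 0` such that, for every accuracy `ε < 1 / 2`, almost all `Δ`-regular graphs have mixing
time at least `exp (α n)`. -/
def MixesSlowlyAlmostAllRegular (lam : ℝ) (q Δ : ℕ) : Prop :=
  ∃ α : ℝ, 0 < α ∧ ∀ ε : ℝ, 0 < ε → ε < 1 / 2 →
    AlmostAllRegular Δ fun n G =>
      ENNReal.ofReal (Real.exp (α * n)) ≤ (glauberMixingTime G lam q ε : ℝ≥0∞)

end

end Potts

/-! Rapid mixing. Fix a connected block `B` of `m ≥ 1/η` vertices. Whatever the colours outside `B`,
no colour `a` is likely at a given `x ∈ B` (`marginal_le`). Indeed, let `T` be the cluster of colour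
`a` around `x` inside `B`. Being connected, `T` meets at most `(Δ-1)|T| + 1` edges, and if `T ≠ B`
one of them leads to a vertex of `B` of another colour. Recolouring `T` arbitrarily thus gains a
factor `q^|T|` in number and loses at most `lam^((Δ-1)|T|)` in weight. Only `T = B` costs one more
factor `lam`, which the surplus `lam^η` per vertex pays for over `m` vertices.

Consequently, resampling a block erases the oscillation of a function at the vertices of the block
and passes little of it to the outside, so the total oscillation contracts under the block dynamics
(`sum_osc_condAvg_le`, `sum_osc_avgOp_le`). Contraction yields a spectral gap
(`wip_avgOp_le_of_contraction`), a comparison of local variances carries it over to single-site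
updates (`wip_sub_condAvg_block_le`, `glauber_gap`), and the `L²` bound `tvDist_pow_le` turns it
into a polynomial mixing time.

Slow mixing. Let `A` consist of the configurations with at most `k = ⌈δn⌉` vertices not coloured
`c`. By colour symmetry `A` has mass at most `1/2`, and the chain can leave it only through the
level `D` where this number equals `k`; so the mixing time is at least of order `π(A)/π(D)`
(`bottleneck_le`). The set `A` contains the constant configuration, of weight `lam^|E|`. To bound
the weight of `D`, use that in almost every regular graph every set `S` of at most `k` vertices
spans at most `|S| + r` edges, with `r` small compared to `k`; this is a first moment estimate based
on edge switchings (`card_regularContaining_le`, `card_hasDenseSet_le`). Then the `k` exceptional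
vertices destroy about `(Δ-1)k` monochromatic edges. Some return inside the set of vertices sharing
their colour with a neighbour, at most about one per such vertex, but these vertices have only about
`√q` colour choices each. Hence `D` weighs at most `lam^(|E|+2r)` times `(C (lam √q + q) /
lam^(Δ-1))^k` (`boundary_weight_le`), which is exponentially small relative to `lam^|E|` for `q` in
the stated range. -/

namespace Potts

/-! ### Conditional averages as projections, and spectral gap from contraction -/

section CondAvg

open Finset Classical

variable {Ω : Type*} [Fintype Ω]

/-- The conditional average of `f` over the class of `σ`, with respect to the weight `w`. -/
noncomputable def condAvg (w : Ω → ℝ) (r : Setoid Ω) (f : Ω → ℝ) (σ : Ω) : ℝ :=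
  (∑ τ ∈ univ.filter (fun τ => r σ τ), w τ * f τ) / ∑ τ ∈ univ.filter (fun τ => r σ τ), w τ

/-- The weighted inner product. -/
noncomputable def wip (w : Ω → ℝ) (f g : Ω → ℝ) : ℝ := ∑ σ, w σ * f σ * g σ

variable {w : Ω → ℝ} (r : Setoid Ω)

lemma class_mass_pos (hw : ∀ σ, 0 < w σ) (σ : Ω) :
    0 < ∑ τ ∈ univ.filter (fun τ => r σ τ), w τ :=
  sum_pos (fun τ _ => hw τ) ⟨σ, by simp⟩

lemma filter_rel_congr {σ τ : Ω} (h : r σ τ) :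
    univ.filter (fun x => r σ x) = univ.filter (fun x => r τ x) := by
  ext x
  simp only [mem_filter, mem_univ, true_and]
  exact ⟨fun hx => r.trans (r.symm h) hx, fun hx => r.trans h hx⟩

lemma condAvg_congr {σ τ : Ω} (h : r σ τ) (f : Ω → ℝ) : condAvg w r f σ = condAvg w r f τ := by
  unfold condAvg
  rw [filter_rel_congr r h]

lemma condAvg_of_invariant (hw : ∀ σ, 0 < w σ) (g : Ω → ℝ) (hg : ∀ σ τ, r σ τ → g σ = g τ) :
    condAvg w r g = g := by
  funext σ
  unfold condAvg
  rw [div_eq_iff (class_mass_pos r hw σ).ne', mul_sum]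
  refine sum_congr rfl fun τ hτ => ?_
  rw [hg σ τ (by simpa using hτ), mul_comm]

lemma condAvg_idem (hw : ∀ σ, 0 < w σ) (f : Ω → ℝ) :
    condAvg w r (condAvg w r f) = condAvg w r f :=
  condAvg_of_invariant r hw _ fun _ _ h => condAvg_congr r h f

lemma wip_comm (f g : Ω → ℝ) : wip w f g = wip w g f :=
  sum_congr rfl fun _ _ => by ring

lemma wip_sub_left (f g h : Ω → ℝ) : wip w (f - g) h = wip w f h - wip w g h := by
  simp only [wip, Pi.sub_apply, mul_sub, sub_mul, sum_sub_distrib]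

lemma wip_sub_right (f g h : Ω → ℝ) : wip w f (g - h) = wip w f g - wip w f h := by
  simp only [wip, Pi.sub_apply, mul_sub, sum_sub_distrib]

lemma wip_smul_right (c : ℝ) (f g : Ω → ℝ) : wip w f (c • g) = c * wip w f g := by
  simp only [wip, Pi.smul_apply, smul_eq_mul, mul_sum]
  exact sum_congr rfl fun _ _ => by ring

lemma wip_sum_right {ι : Type*} (s : Finset ι) (f : Ω → ℝ) (g : ι → Ω → ℝ) :
    wip w f (∑ i ∈ s, g i) = ∑ i ∈ s, wip w f (g i) := by
  simp only [wip, Finset.sum_apply, mul_sum]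
  exact sum_comm

lemma wip_self_nonneg (hw : ∀ σ, 0 ≤ w σ) (f : Ω → ℝ) : 0 ≤ wip w f f :=
  sum_nonneg fun σ _ => by rw [mul_assoc]; exact mul_nonneg (hw σ) (mul_self_nonneg _)

lemma wip_sq_le (hw : ∀ σ, 0 ≤ w σ) (f g : Ω → ℝ) :
    wip w f g ^ 2 ≤ wip w f f * wip w g g := by
  have h := sum_mul_sq_le_sq_mul_sq univ (fun σ => √(w σ) * f σ) (fun σ => √(w σ) * g σ)
  have e : ∀ (f g : Ω → ℝ) σ, √(w σ) * f σ * (√(w σ) * g σ) = w σ * f σ * g σ := by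
    intro f g σ
    rw [mul_mul_mul_comm, Real.mul_self_sqrt (hw σ), mul_assoc]
  simp only [sq (_ * _), e] at h
  exact h

/-- The kernel `w σ * w τ / mass of the class` is symmetric, because equivalent points share their
class. -/
lemma condAvg_adjoint (f g : Ω → ℝ) :
    wip w g (condAvg w r f) = wip w (condAvg w r g) f := by
  have key : ∀ f g : Ω → ℝ, wip w g (condAvg w r f) =
      ∑ σ, ∑ τ, if r σ τ then w σ * w τ * (g σ * f τ) /
        (∑ τ ∈ univ.filter (fun τ => r σ τ), w τ) else 0 := by
    intro f g
    refine sum_congr rfl fun σ _ => ?_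
    rw [condAvg, ← sum_filter, ← mul_div_assoc, mul_sum, sum_div]
    exact sum_congr rfl fun τ _ => by ring
  rw [wip_comm (condAvg w r g), key, key, sum_comm]
  refine sum_congr rfl fun σ _ => sum_congr rfl fun τ _ => ?_
  by_cases h : r τ σ
  · rw [if_pos h, if_pos (r.symm h), filter_rel_congr r h]
    ring
  · rw [if_neg h, if_neg fun h' => h (r.symm h')]

lemma wip_condAvg_self (hw : ∀ σ, 0 < w σ) (f : Ω → ℝ) :
    wip w f (condAvg w r f) = wip w (condAvg w r f) (condAvg w r f) := by
  conv_lhs => rw [← condAvg_idem r hw f]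
  rw [condAvg_adjoint r]

lemma wip_sub_condAvg_self (hw : ∀ σ, 0 < w σ) (f : Ω → ℝ) :
    wip w (f - condAvg w r f) (f - condAvg w r f) = wip w f f - wip w f (condAvg w r f) := by
  rw [wip_sub_left, wip_sub_right, wip_sub_right, wip_comm (condAvg w r f) f,
    wip_condAvg_self r hw]
  ring

/-- The operator averaging the conditional averages of a family of equivalence relations. -/
noncomputable def avgOp {ι : Type*} [Fintype ι] (w : Ω → ℝ) (r : ι → Setoid Ω) (f : Ω → ℝ) :
    Ω → ℝ :=
  (1 / (Fintype.card ι : ℝ)) • ∑ i, condAvg w (r i) f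

variable {ι : Type*} [Fintype ι] (R : ι → Setoid Ω)

lemma avgOp_adjoint (f g : Ω → ℝ) :
    wip w g (avgOp w R f) = wip w (avgOp w R g) f := by
  rw [wip_comm (avgOp w R g), avgOp, avgOp, wip_smul_right, wip_smul_right, wip_sum_right,
    wip_sum_right]
  congr 1
  exact sum_congr rfl fun i _ => by rw [condAvg_adjoint, wip_comm]

/-- An average of orthogonal projections has its spectrum in `[0, 1]`, so its square is dominated by
itself. There are no negative eigenvalues to worry about, and a bound on the Dirichlet form suffices
for `L²` contraction. The proof sums `0 ≤ ‖g - E_i f‖²` over the projections `E_i`. -/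
lemma wip_avgOp_le (hw : ∀ σ, 0 < w σ) (f : Ω → ℝ) :
    wip w (avgOp w R f) (avgOp w R f) ≤ wip w f (avgOp w R f) := by
  have hw' : ∀ σ, 0 ≤ w σ := fun σ => (hw σ).le
  set g := avgOp w R f with hg
  have hr : ∀ h, wip w h g = 1 / (Fintype.card ι : ℝ) * ∑ i, wip w h (condAvg w (R i) f) := by
    intro h; rw [hg, avgOp, wip_smul_right, wip_sum_right]
  rcases isEmpty_or_nonempty ι with hι | hι
  · rw [hr, hr]; simp
  have hN : (0 : ℝ) < Fintype.card ι := by exact_mod_cast Fintype.card_pos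
  have h1 : ∀ i, 2 * wip w g (condAvg w (R i) f) ≤ wip w g g + wip w f (condAvg w (R i) f) := by
    intro i
    have h2 := wip_self_nonneg hw' (g - condAvg w (R i) f)
    rw [wip_sub_left, wip_sub_right, wip_sub_right, wip_comm (condAvg w (R i) f) g,
      ← wip_condAvg_self _ hw] at h2
    linarith
  have h3 := sum_le_sum fun i (_ : i ∈ univ) => h1 i
  rw [← mul_sum, sum_add_distrib, sum_const, card_univ, nsmul_eq_mul] at h3
  have e1 := hr g
  have e2 := hr f
  have e3 : ∑ i, wip w g (condAvg w (R i) f) = Fintype.card ι * wip w g g := by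
    rw [e1]; field_simp
  have e4 : ∑ i, wip w f (condAvg w (R i) f) = Fintype.card ι * wip w f g := by
    rw [e2]; field_simp
  rw [e3, e4] at h3
  nlinarith

/-- The Dirichlet form is the mean of the local variances. Applied both to blocks and to single
vertices, it is what makes the two dynamics comparable. -/
lemma wip_sub_avgOp [Nonempty ι] (hw : ∀ σ, 0 < w σ) (f : Ω → ℝ) :
    wip w f f - wip w f (avgOp w R f) = 1 / (Fintype.card ι : ℝ) *
      ∑ i, wip w (f - condAvg w (R i) f) (f - condAvg w (R i) f) := by
  have hN : (0 : ℝ) < Fintype.card ι := by exact_mod_cast Fintype.card_pos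
  simp only [wip_sub_condAvg_self _ hw, sum_sub_distrib, sum_const, card_univ, nsmul_eq_mul,
    avgOp, wip_smul_right, wip_sum_right]
  field_simp

lemma avgOp_const [Nonempty ι] (hw : ∀ σ, 0 < w σ) (c : ℝ) :
    avgOp w R (fun _ => c) = fun _ => c := by
  have hN : (0 : ℝ) < Fintype.card ι := by exact_mod_cast Fintype.card_pos
  funext σ
  simp only [avgOp, condAvg_of_invariant _ hw (fun _ : Ω => c) fun _ _ _ => rfl, sum_const,
    card_univ, Pi.smul_apply, smul_eq_mul, nsmul_eq_mul]
  change _ * ((Fintype.card ι : ℝ) * c) = c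
  field_simp

lemma wip_one_avgOp [Nonempty ι] (hw : ∀ σ, 0 < w σ) (f : Ω → ℝ) :
    wip w (fun _ => 1) (avgOp w R f) = wip w (fun _ => 1) f := by
  rw [avgOp_adjoint R, avgOp_const R hw]

lemma le_of_forall_pow_le {x y C : ℝ} (hy : 0 ≤ y)
    (h : ∀ t : ℕ, x ^ t ≤ C * y ^ t) : x ≤ y := by
  by_contra! hxy
  rcases hy.eq_or_lt with rfl | hy
  · have := h 1
    simp at this
    linarith
  · obtain ⟨t, ht⟩ := pow_unbounded_of_one_lt C ((one_lt_div hy).2 hxy)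
    rw [div_pow, lt_div_iff₀ (pow_pos hy t)] at ht
    exact absurd (h t) (not_le.2 ht)

/-- A contraction estimate for some functional dominating the norm gives a spectral gap. -/
lemma wip_avgOp_le_of_contraction [Nonempty ι] (hw : ∀ σ, 0 < w σ) (L : (Ω → ℝ) → ℝ) {ρ : ℝ}
    (hρ : 0 ≤ ρ) (hL : ∀ f, wip w (fun _ => 1) f = 0 → wip w f f ≤ L f ^ 2)
    (hL0 : ∀ f, 0 ≤ L f) (hc : ∀ f, L (avgOp w R f) ≤ ρ * L f) (f : Ω → ℝ)
    (hf : wip w (fun _ => 1) f = 0) :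
    wip w f (avgOp w R f) ≤ ρ * wip w f f := by
  have hw' : ∀ σ, 0 ≤ w σ := fun σ => (hw σ).le
  set F : ℕ → Ω → ℝ := fun t => (avgOp w R)^[t] f with hF
  have hFs : ∀ t, F (t + 1) = avgOp w R (F t) := fun t => Function.iterate_succ_apply' _ _ _
  set s : ℕ → ℝ := fun t => wip w (F t) (F t) with hs
  have hs0 : ∀ t, 0 ≤ s t := fun t => wip_self_nonneg hw' _
  have hmean : ∀ t, wip w (fun _ => 1) (F t) = 0 := by
    intro t
    induction t with
    | zero => exact hf
    | succ t ih => rw [hFs, wip_one_avgOp R hw, ih]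
  have hLt : ∀ t, L (F t) ≤ ρ ^ t * L f := by
    intro t
    induction t with
    | zero => simp [hF]
    | succ t ih =>
      rw [hFs]
      refine (hc _).trans ?_
      rw [pow_succ', mul_assoc]
      exact mul_le_mul_of_nonneg_left ih hρ
  -- By self-adjointness and Cauchy–Schwarz the sequence `s t = ‖P^t f‖²` is log-convex. Its first
  -- ratio `s 1 / s 0` is therefore at most its asymptotic growth rate, which `L` bounds by `ρ ^ 2`;
  -- the constant relating `L` and the norm disappears in the limit.
  have hconv : ∀ t, s (t + 1) ^ 2 ≤ s t * s (t + 2) := by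
    intro t
    have : s (t + 1) = wip w (F t) (F (t + 2)) := by
      rw [hFs (t + 1), avgOp_adjoint R, ← hFs]
    rw [this]
    exact wip_sq_le hw' _ _
  have hmono : ∀ t, s 1 * s t ≤ s 0 * s (t + 1) := by
    intro t
    induction t with
    | zero => rw [mul_comm]
    | succ t ih =>
      rcases (hs0 (t + 1)).eq_or_lt with h0 | h0
      · rw [← h0, mul_zero]; exact mul_nonneg (hs0 _) (hs0 _)
      · have h1 := hconv t
        refine le_of_mul_le_mul_right (a := s (t + 1)) ?_ h0
        calc s 1 * s (t + 1) * s (t + 1) = s 1 * s (t + 1) ^ 2 := by ring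
          _ ≤ s 1 * (s t * s (t + 2)) := mul_le_mul_of_nonneg_left h1 (hs0 _)
          _ = s 1 * s t * s (t + 2) := by ring
          _ ≤ s 0 * s (t + 1) * s (t + 2) := mul_le_mul_of_nonneg_right ih (hs0 _)
          _ = _ := by ring
  rcases (hs0 0).eq_or_lt with h0 | h0
  · have h1 := wip_sq_le hw' f (avgOp w R f)
    have h2 : wip w f f = 0 := h0.symm
    rw [h2, zero_mul] at h1
    rw [h2, mul_zero]
    exact (pow_eq_zero_iff (two_ne_zero)).1 (le_antisymm h1 (sq_nonneg _)) |>.le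
  have hpow : ∀ t, (s 1 / s 0) ^ t * s 0 ≤ s t := by
    intro t
    induction t with
    | zero => simp
    | succ t ih =>
      rw [pow_succ', mul_assoc]
      calc s 1 / s 0 * ((s 1 / s 0) ^ t * s 0) ≤ s 1 / s 0 * s t :=
            mul_le_mul_of_nonneg_left ih (div_nonneg (hs0 _) (hs0 _))
        _ = s 1 * s t / s 0 := by ring
        _ ≤ s (t + 1) := by rw [div_le_iff₀ h0, mul_comm (s (t + 1))]; exact hmono t
  have hle : s 1 / s 0 ≤ ρ ^ 2 := by
    refine le_of_forall_pow_le (C := L f ^ 2 / s 0) (sq_nonneg _)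
      fun t => ?_
    rw [div_mul_eq_mul_div, le_div_iff₀ h0]
    refine (hpow t).trans ((hL _ (hmean t)).trans ?_)
    calc L (F t) ^ 2 ≤ (ρ ^ t * L f) ^ 2 := pow_le_pow_left₀ (hL0 _) (hLt t) 2
      _ = _ := by ring
  have h1 : s 1 ≤ ρ ^ 2 * s 0 := (div_le_iff₀ h0).1 hle
  refine abs_le_of_sq_le_sq' ?_ (mul_nonneg hρ h0.le) |>.2
  refine (wip_sq_le hw' _ _).trans ?_
  have h2 : wip w f f * wip w (avgOp w R f) (avgOp w R f) = s 0 * s 1 := rfl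
  rw [h2, mul_pow]
  change _ ≤ ρ ^ 2 * s 0 ^ 2
  nlinarith

end CondAvg

/-! ### From `L²` contraction to total variation -/

section Mixing

open Finset

variable {Ω : Type*} [Fintype Ω] [DecidableEq Ω]

/-- An `L²` contraction of a reversible chain bounds the total variation distance. -/
lemma tvDist_pow_le {P : Matrix Ω Ω ℝ} {π : Ω → ℝ} (hπ : ∀ x, 0 < π x) (hsum : ∑ x, π x = 1)
    (hrev : ∀ x y, π x * P x y = π y * P y x) (hrow : ∀ x, ∑ y, P x y = 1) {ρ : ℝ}
    (hgap : ∀ f : Ω → ℝ, wip π (fun _ => 1) f = 0 →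
      wip π (P.mulVec f) (P.mulVec f) ≤ ρ * wip π f f) (hρ : 0 ≤ ρ) (t : ℕ) (x : Ω) :
    4 * tvDist ((P ^ t) x) π ^ 2 ≤ ρ ^ t / π x := by
  have hπ' : ∀ x, 0 ≤ π x := fun x => (hπ x).le
  have h1 : ∀ f : Ω → ℝ, wip π (fun _ => 1) (P.mulVec f) = wip π (fun _ => 1) f := by
    intro f
    simp only [wip, Matrix.mulVec, dotProduct, mul_one, mul_sum]
    rw [sum_comm]
    refine sum_congr rfl fun y _ => ?_
    simp only [← mul_assoc, hrev _ y]
    rw [← sum_mul, ← mul_sum, hrow, mul_one]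
  -- The density of the point mass at `x` relative to `π`, minus its mean. By reversibility the
  -- centred density of `P ^ t x` is obtained by applying `P` to it as an operator on functions.
  set f0 : Ω → ℝ := fun y => (if x = y then 1 / π x else 0) - 1 with hf0
  set F : ℕ → Ω → ℝ := fun t => (P.mulVec)^[t] f0 with hF
  have hFs : ∀ t, F (t + 1) = P.mulVec (F t) := fun t => Function.iterate_succ_apply' _ _ _
  have hmean : ∀ t, wip π (fun _ => 1) (F t) = 0 := by
    intro t
    induction t with
    | zero =>
      change wip π (fun _ => 1) f0 = 0
      simp only [wip, hf0, mul_one, mul_sub, sum_sub_distrib, hsum, mul_ite, mul_zero, sum_ite_eq,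
        mem_univ, if_true]
      rw [mul_one_div_cancel (hπ x).ne', sub_self]
    | succ t ih => rw [hFs, h1, ih]
  have hnorm : ∀ t, wip π (F t) (F t) ≤ ρ ^ t * (1 / π x) := by
    intro t
    induction t with
    | zero =>
      change wip π f0 f0 ≤ _
      have : wip π f0 f0 = 1 / π x - 1 := by
        have e : ∀ y, π y * f0 y * f0 y =
            (if x = y then (1 / π x - 2) else 0) + π y := by
          intro y
          by_cases h : x = y
          · subst h
            have := (hπ x).ne'
            simp only [hf0, if_true]
            field_simp
            ring
          · simp [hf0, h]
        simp only [wip, e, sum_add_distrib, hsum, sum_ite_eq, mem_univ, if_true]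
        ring
      rw [this]
      simp
    | succ t ih =>
      rw [hFs]
      refine (hgap _ (hmean t)).trans ?_
      rw [pow_succ', mul_assoc]
      exact mul_le_mul_of_nonneg_left ih hρ
  have hF' : ∀ t y, π y * F t y = (P ^ t) x y - π y := by
    intro t
    induction t with
    | zero =>
      intro y
      change π y * f0 y = _
      by_cases h : x = y
      · subst h
        have := (hπ x).ne'
        simp only [hf0, if_true, pow_zero, Matrix.one_apply_eq]
        field_simp
      · simp [hf0, h]
    | succ t ih =>
      intro y
      rw [hFs, pow_succ, Matrix.mul_apply, Matrix.mulVec, dotProduct, mul_sum]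
      have e : ∀ z, π y * (P y z * F t z) = (P ^ t) x z * P z y - π y * P y z := by
        intro z
        rw [← mul_assoc, hrev y z, mul_assoc, mul_left_comm, ih z]
        ring
      rw [sum_congr rfl fun z _ => e z, sum_sub_distrib, ← mul_sum, hrow, mul_one]
  have htv : 2 * tvDist ((P ^ t) x) π = wip π (fun _ => 1) (fun y => |F t y|) := by
    simp only [tvDist, wip, mul_one]
    rw [← mul_assoc, mul_one_div_cancel two_ne_zero, one_mul]
    refine sum_congr rfl fun y _ => ?_
    rw [← hF', abs_mul, abs_of_pos (hπ y)]
  have h2 := wip_sq_le hπ' (fun _ => 1) (fun y => |F t y|)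
  have h3 : wip π (fun _ => 1) (fun _ => 1) = 1 := by simp [wip, hsum]
  have h4 : wip π (fun y => |F t y|) (fun y => |F t y|) = wip π (F t) (F t) :=
    sum_congr rfl fun y _ => by rw [mul_assoc, abs_mul_abs_self, mul_assoc]
  rw [h3, h4, one_mul, ← htv] at h2
  have := hnorm t
  rw [mul_one_div] at this
  nlinarith

end Mixing

/-! ### Connected vertex sets and the edges they meet -/

section ConnSet

open Finset

variable {V : Type u} [DecidableEq V] (G : SimpleGraph V)

/-- The finite vertex sets inducing a connected subgraph, built by adding one vertex at a time. -/
inductive ConnSet : Finset V → Prop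
  | single (v : V) : ConnSet {v}
  | insert {T : Finset V} {v u : V} : ConnSet T → v ∉ T → u ∈ T → G.Adj u v →
      ConnSet (insert v T)

variable {G}

/-- Supplies the edge leaving a cluster `T ≠ B` inside the block, which saves one factor `lam` in
`marginal_le`. In the inductive step, remove the last vertex `v` from `T`: either nothing is left,
and the edge attaching `v` works, or the induction hypothesis applies unless `T` is exactly the old
block. -/
lemma ConnSet.exists_adj_of_ssubset {B : Finset V} (hB : ConnSet G B) {T : Finset V} (hT : T ⊆ B)
    (hne : T.Nonempty) (hTB : T ≠ B) : ∃ x ∈ T, ∃ y ∈ B \ T, G.Adj x y := by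
  induction hB generalizing T with
  | single v =>
    rcases subset_singleton_iff.1 hT with rfl | rfl
    · simp at hne
    · exact absurd rfl hTB
  | @insert B v u hB hv hu huv ih =>
    by_cases hvT : v ∈ T
    · rcases (T.erase v).eq_empty_or_nonempty with h0 | h0
      · have hTv : T = {v} := by
          apply subset_antisymm _ (singleton_subset_iff.2 hvT)
          intro x hx
          by_contra hxv
          have : x ∈ T.erase v := mem_erase.2 ⟨by simpa using hxv, hx⟩
          rw [h0] at this
          simp at this
        subst hTv
        have : u ≠ v := fun h => hv (h ▸ hu)
        exact ⟨v, mem_singleton_self v, u, by simp [hu, this], huv.symm⟩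
      · have hsub : T.erase v ⊆ B := by
          intro x hx
          have h1 := mem_erase.1 hx
          exact (mem_insert.1 (hT h1.2)).resolve_left h1.1
        have hne' : T.erase v ≠ B := by
          rintro rfl
          exact hTB (insert_erase hvT).symm
        obtain ⟨x, hx, y, hy, hxy⟩ := ih hsub h0 hne'
        rw [mem_sdiff, mem_erase] at hy
        refine ⟨x, mem_of_mem_erase hx, y, ?_, hxy⟩
        have hyv : y ≠ v := fun h => hv (h ▸ hy.1)
        exact mem_sdiff.2 ⟨mem_insert_of_mem hy.1, fun h => hy.2 ⟨hyv, h⟩⟩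
    · have hsub : T ⊆ B := fun x hx =>
        (mem_insert.1 (hT hx)).resolve_left fun h => hvT (h ▸ hx)
      by_cases hTB' : T = B
      · subst hTB'
        exact ⟨u, hu, v, by simp [hv], huv⟩
      · obtain ⟨x, hx, y, hy, hxy⟩ := ih hsub hne hTB'
        rw [mem_sdiff] at hy
        exact ⟨x, hx, y, mem_sdiff.2 ⟨mem_insert_of_mem hy.1, hy.2⟩, hxy⟩

lemma exists_connSet_card [Fintype V] (hG : G.Connected) (v : V) {m : ℕ} (hm : 1 ≤ m)
    (hmn : m ≤ Fintype.card V) : ∃ B, ConnSet G B ∧ v ∈ B ∧ B.card = m := by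
  induction m, hm using Nat.le_induction with
  | base => exact ⟨{v}, .single v, mem_singleton_self v, card_singleton v⟩
  | succ m _ ih =>
    obtain ⟨B, hB, hvB, hcard⟩ := ih (by omega)
    obtain ⟨z, hz⟩ : ∃ z, z ∉ B := by
      by_contra! h
      have : B = univ := eq_univ_iff_forall.2 h
      rw [this, card_univ] at hcard
      omega
    obtain ⟨p⟩ := hG.preconnected v z
    obtain ⟨d, _, h1, h2⟩ := p.exists_boundary_dart (B : Set V) hvB hz
    exact ⟨insert d.snd B, hB.insert h2 h1 d.adj, mem_insert_of_mem hvB,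
      by rw [card_insert_of_notMem h2, hcard]⟩

variable [Fintype V] [DecidableRel G.Adj]

variable (G) in
/-- The edges meeting a set of vertices. -/
def touch (T : Finset V) : Finset (Sym2 V) := G.edgeFinset.filter fun e => ∃ v ∈ T, v ∈ e

lemma touch_insert (T : Finset V) (v : V) :
    touch G (insert v T) = touch G T ∪ G.incidenceFinset v := by
  ext e
  simp only [touch, mem_filter, mem_union, mem_insert, exists_eq_or_imp,
    SimpleGraph.mem_incidenceFinset, SimpleGraph.incidenceSet, SimpleGraph.mem_edgeFinset,
    Set.mem_ofPred_eq]
  rw [and_or_left, or_comm]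

/-- The first vertex brings at most `Δ` edges. Each later one is attached through an edge already
counted, so it brings at most `Δ - 1` new ones. -/
lemma ConnSet.card_touch_le {T : Finset V} (hT : ConnSet G T) {Δ : ℕ} (hΔ : 1 ≤ Δ)
    (hdeg : ∀ v, G.degree v ≤ Δ) : (touch G T).card ≤ (Δ - 1) * T.card + 1 := by
  induction hT with
  | single v =>
    have : touch G {v} = G.incidenceFinset v := by
      have := touch_insert (G := G) ∅ v
      rw [insert_empty_eq] at this
      rw [this]
      simp [touch]
    rw [this, SimpleGraph.card_incidenceFinset_eq_degree, card_singleton]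
    have := hdeg v
    omega
  | @insert T v u hT hv hu huv ih =>
    rw [touch_insert, card_insert_of_notMem hv]
    have h1 : s(u, v) ∈ touch G T ∩ G.incidenceFinset v := by
      simp only [mem_inter, touch, mem_filter, SimpleGraph.mem_edgeFinset,
        SimpleGraph.mem_incidenceFinset, SimpleGraph.incidenceSet, Set.mem_ofPred_eq]
      exact ⟨⟨huv, u, hu, by simp⟩, huv, by simp⟩
    have h2 := card_union_add_card_inter (touch G T) (G.incidenceFinset v)
    have h3 : 1 ≤ (touch G T ∩ G.incidenceFinset v).card := card_pos.2 ⟨_, h1⟩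
    rw [SimpleGraph.card_incidenceFinset_eq_degree] at h2
    have h4 := hdeg v
    have h5 : (Δ - 1) * (T.card + 1) = (Δ - 1) * T.card + (Δ - 1) := by ring
    omega

end ConnSet

/-! ### Every colour is unlikely at a vertex of a connected block -/

section Marginal

open Finset

lemma sum_biUnion_le {ι α : Type*} [DecidableEq α] (s : Finset ι) (t : ι → Finset α) {f : α → ℝ}
    (hf : ∀ a, 0 ≤ f a) : ∑ a ∈ s.biUnion t, f a ≤ ∑ i ∈ s, ∑ a ∈ t i, f a := by
  classical
  induction s using Finset.induction_on with
  | empty => simp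
  | insert i s hi ih =>
    rw [biUnion_insert, sum_insert hi]
    have h := sum_union_inter (s₁ := t i) (s₂ := s.biUnion t) (f := f)
    have h' : 0 ≤ ∑ a ∈ t i ∩ s.biUnion t, f a := sum_nonneg fun a _ => hf a
    linarith

variable {V : Type u} [Fintype V] [DecidableEq V] (G : SimpleGraph V) [DecidableRel G.Adj]

/-- Two configurations are equivalent if they agree outside `B`. -/
def agreeOff (q : ℕ) (B : Finset V) : Setoid (V → Fin q) where
  r σ τ := ∀ v, v ∉ B → σ v = τ v
  iseqv := ⟨fun _ _ _ => rfl, fun h v hv => (h v hv).symm,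
    fun h h' v hv => (h v hv).trans (h' v hv)⟩

instance (q : ℕ) (B : Finset V) (σ : V → Fin q) : DecidablePred fun τ => agreeOff q B σ τ :=
  fun τ => inferInstanceAs (Decidable (∀ v, v ∉ B → σ v = τ v))

variable {q : ℕ}

lemma agreeOff_iff {V : Type*} {B : Finset V} {σ τ : V → Fin q} :
    agreeOff q B σ τ ↔ ∀ v, v ∉ B → σ v = τ v := Iff.rfl

lemma map_isDiag_congr {V : Type*} {σ τ : V → Fin q} {e : Sym2 V} (h : ∀ v ∈ e, σ v = τ v) :
    (e.map σ).IsDiag ↔ (e.map τ).IsDiag := by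
  induction e with
  | h x y =>
    rw [Sym2.map_mk, Sym2.map_mk, Sym2.mk_isDiag_iff, Sym2.mk_isDiag_iff, h x (by simp),
      h y (by simp)]

lemma monoEdges_le_of_agreeOff {T : Finset V} {σ τ : V → Fin q} (h : agreeOff q T σ τ) :
    monoEdges G σ ≤ monoEdges G τ + ((touch G T).filter fun e => (e.map σ).IsDiag).card := by
  unfold monoEdges
  refine (card_le_card ?_).trans (card_union_le _ _)
  intro e he
  rw [mem_filter] at he
  by_cases ht : ∃ v ∈ T, v ∈ e
  · exact mem_union_right _ (mem_filter.2 ⟨mem_filter.2 ⟨he.1, ht⟩, he.2⟩)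
  · refine mem_union_left _ (mem_filter.2 ⟨he.1, ?_⟩)
    rw [← map_isDiag_congr fun v hv => h v fun hvT => ht ⟨v, hvT, hv⟩]
    exact he.2

/-- Replace the colours on `T`. -/
def patch {T : Finset V} (τ : V → Fin q) (η : T → Fin q) (v : V) : Fin q :=
  if h : v ∈ T then η ⟨v, h⟩ else τ v

lemma agreeOff_patch {V : Type*} [DecidableEq V] {T : Finset V} (τ : V → Fin q) (η : T → Fin q) :
    agreeOff q T τ (patch τ η) := fun v hv => by simp [patch, hv]

/-- Recolouring a set on which all configurations of `X` coincide. -/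
lemma sum_mul_pow_card_le {lam : ℝ} (hlam : 1 ≤ lam) {B T : Finset V} (hTB : T ⊆ B)
    (σ : V → Fin q) (X : Finset (V → Fin q)) {K : ℕ} (hXσ : ∀ τ ∈ X, agreeOff q B σ τ)
    (hXT : ∀ τ ∈ X, ∀ τ' ∈ X, ∀ v ∈ T, τ v = τ' v)
    (hK : ∀ τ ∈ X, ((touch G T).filter fun e => (e.map τ).IsDiag).card ≤ K) :
    (∑ τ ∈ X, lam ^ monoEdges G τ) * (q : ℝ) ^ T.card ≤
      lam ^ K * ∑ τ ∈ univ.filter (fun τ => agreeOff q B σ τ), lam ^ monoEdges G τ := by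
  have hlam0 : 0 ≤ lam := zero_le_one.trans hlam
  -- Overwriting the colours on `T` loses no information, since the members of `X` all agree there.
  have hinj : Set.InjOn (fun p : (V → Fin q) × (T → Fin q) => patch p.1 p.2)
      (X ×ˢ (univ : Finset (T → Fin q)) : Finset _) := by
    rintro ⟨τ, η⟩ h1 ⟨τ', η'⟩ h2 h
    simp only [coe_product, Set.mem_prod, mem_coe] at h1 h2
    have hη : η = η' := by
      funext ⟨v, hv⟩
      simpa [patch, hv] using congrFun h v
    have hτ : τ = τ' := by
      funext v
      by_cases hv : v ∈ T
      · exact hXT _ h1.1 _ h2.1 v hv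
      · simpa [patch, hv] using congrFun h v
    rw [hη, hτ]
  calc (∑ τ ∈ X, lam ^ monoEdges G τ) * (q : ℝ) ^ T.card
      = ∑ p ∈ X ×ˢ (univ : Finset (T → Fin q)), lam ^ monoEdges G p.1 := by
        rw [sum_product]
        simp only [sum_const, card_univ, Fintype.card_fun, Fintype.card_fin, Fintype.card_coe,
          nsmul_eq_mul, Nat.cast_pow]
        rw [← mul_sum, mul_comm]
    _ ≤ ∑ p ∈ X ×ˢ (univ : Finset (T → Fin q)), lam ^ K * lam ^ monoEdges G (patch p.1 p.2) := by
        refine sum_le_sum fun p hp => ?_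
        rw [← pow_add]
        refine pow_le_pow_right₀ hlam ?_
        have h1 := monoEdges_le_of_agreeOff G (agreeOff_patch p.1 p.2)
        have h2 := hK p.1 (mem_product.1 hp).1
        omega
    _ = lam ^ K * ∑ τ ∈ (X ×ˢ (univ : Finset (T → Fin q))).image fun p => patch p.1 p.2,
          lam ^ monoEdges G τ := by
        rw [sum_image hinj, mul_sum]
    _ ≤ _ := by
        refine mul_le_mul_of_nonneg_left ?_ (pow_nonneg hlam0 _)
        refine sum_le_sum_of_subset_of_nonneg ?_ fun _ _ _ => pow_nonneg hlam0 _
        intro τ hτ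
        obtain ⟨p, hp, rfl⟩ := mem_image.1 hτ
        refine mem_filter.2 ⟨mem_univ _, fun v hv => ?_⟩
        rw [hXσ p.1 (mem_product.1 hp).1 v hv]
        exact agreeOff_patch p.1 p.2 v fun h => hv (hTB h)

/-- Inside a connected block, every colour has small probability at every vertex, whatever the
boundary condition. -/
theorem marginal_le {lam : ℝ} (hlam : 1 ≤ lam) (hq : 0 < q) {Δ : ℕ} (hΔ : 1 ≤ Δ)
    (hdeg : ∀ v, G.degree v ≤ Δ) {B : Finset V} (hB : ConnSet G B) {θ : ℝ} (hθ1 : θ ≤ 1)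
    (h1 : lam ^ (Δ - 1) ≤ θ * q) (h2 : lam ^ ((Δ - 1) * B.card + 1) ≤ θ * q ^ B.card)
    (σ : V → Fin q) {x : V} (hx : x ∈ B) (a : Fin q) :
    ∑ τ ∈ univ.filter (fun τ => agreeOff q B σ τ ∧ τ x = a), lam ^ monoEdges G τ ≤
      2 ^ B.card * θ *
        ∑ τ ∈ univ.filter (fun τ => agreeOff q B σ τ), lam ^ monoEdges G τ := by
  classical
  have hlam0 : 0 ≤ lam := zero_le_one.trans hlam
  have hq' : (0 : ℝ) < q := by exact_mod_cast hq
  have hθ0 : 0 ≤ θ := by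
    by_contra! h
    have : 0 ≤ lam ^ (Δ - 1) := pow_nonneg hlam0 _
    nlinarith
  set Z := ∑ τ ∈ univ.filter (fun τ => agreeOff q B σ τ), lam ^ monoEdges G τ with hZ
  have hZ0 : 0 ≤ Z := sum_nonneg fun _ _ => pow_nonneg hlam0 _
  -- The event that `T` has colour `a` and no neighbour of `T` in `B \ T` does. For connected `T`
  -- containing `x` this says that `T` is the `a`-cluster of `x` in `B`.
  let X : Finset V → Finset (V → Fin q) := fun T => univ.filter fun τ =>
    agreeOff q B σ τ ∧ (∀ v ∈ T, τ v = a) ∧ ∀ v ∈ B \ T, ∀ u ∈ T, G.Adj u v → τ v ≠ a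
  let 𝒯 : Finset (Finset V) := B.powerset.filter fun T => ConnSet G T ∧ x ∈ T
  have hX : ∀ T ∈ 𝒯, ∑ τ ∈ X T, lam ^ monoEdges G τ ≤ θ * Z := by
    intro T hT
    obtain ⟨hTB, hTc, hxT⟩ : T ⊆ B ∧ ConnSet G T ∧ x ∈ T := by simpa [𝒯] using hT
    have key : ∀ K : ℕ, lam ^ K ≤ θ * (q : ℝ) ^ T.card →
        (∀ τ ∈ X T, ((touch G T).filter fun e => (e.map τ).IsDiag).card ≤ K) →
        ∑ τ ∈ X T, lam ^ monoEdges G τ ≤ θ * Z := by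
      intro K hK hK'
      have h := sum_mul_pow_card_le G hlam hTB σ (X T) (K := K)
        (fun τ hτ => (mem_filter.1 hτ).2.1)
        (fun τ hτ τ' hτ' v hv => by
          rw [(mem_filter.1 hτ).2.2.1 v hv, (mem_filter.1 hτ').2.2.1 v hv]) hK'
      refine le_of_mul_le_mul_right (a := (q : ℝ) ^ T.card) (h.trans ?_) (pow_pos hq' _)
      calc lam ^ K * Z ≤ θ * (q : ℝ) ^ T.card * Z := mul_le_mul_of_nonneg_right hK hZ0
        _ = _ := by ring
    -- For `T = B` all `(Δ - 1) * B.card + 1` touched edges may be monochromatic, hence the separate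
    -- hypothesis `h2`. Otherwise an edge from `T` to `B \ T` is not, and `h1` suffices.
    by_cases hTB' : T = B
    · subst hTB'
      exact key _ h2 fun τ _ => (card_filter_le _ _).trans (hTc.card_touch_le hΔ hdeg)
    · refine key ((Δ - 1) * T.card) ?_ fun τ hτ => ?_
      · rw [pow_mul]
        calc (lam ^ (Δ - 1)) ^ T.card ≤ (θ * q) ^ T.card :=
              pow_le_pow_left₀ (pow_nonneg hlam0 _) h1 _
          _ = θ ^ T.card * q ^ T.card := mul_pow _ _ _
          _ ≤ θ * q ^ T.card := by
              refine mul_le_mul_of_nonneg_right ?_ (pow_pos hq' _).le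
              exact pow_le_of_le_one hθ0 hθ1 (card_pos.2 ⟨x, hxT⟩).ne'
      · obtain ⟨u, hu, v, hv, huv⟩ := hB.exists_adj_of_ssubset hTB ⟨x, hxT⟩ hTB'
        have hτ' := (mem_filter.1 hτ).2
        have hmem : s(u, v) ∈ touch G T :=
          mem_filter.2 ⟨SimpleGraph.mem_edgeFinset.2 huv, u, hu, by simp⟩
        have hlt : ((touch G T).filter fun e => (e.map τ).IsDiag).card < (touch G T).card := by
          refine card_lt_card (filter_ssubset.2 ⟨s(u, v), hmem, ?_⟩)
          rw [Sym2.map_mk, Sym2.mk_isDiag_iff, hτ'.2.1 u hu]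
          exact fun h => hτ'.2.2 v hv u hu huv h.symm
        have := hTc.card_touch_le hΔ hdeg
        omega
  have hcover : univ.filter (fun τ => agreeOff q B σ τ ∧ τ x = a) ⊆ 𝒯.biUnion X := by
    intro τ hτ
    obtain ⟨hτσ, hτx⟩ := (mem_filter.1 hτ).2
    let 𝒮 := 𝒯.filter fun T => ∀ v ∈ T, τ v = a
    have hne : 𝒮.Nonempty := ⟨{x}, by simp [𝒮, 𝒯, hx, hτx, ConnSet.single]⟩
    obtain ⟨T, hT, hmax⟩ := exists_max_image 𝒮 card hne
    obtain ⟨hT1, hT2⟩ := mem_filter.1 hT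
    refine mem_biUnion.2 ⟨T, hT1, mem_filter.2 ⟨mem_univ _, hτσ, hT2, ?_⟩⟩
    intro v hv u hu huv hva
    obtain ⟨hTB, hTc, hxT⟩ : T ⊆ B ∧ ConnSet G T ∧ x ∈ T := by simpa [𝒯] using hT1
    obtain ⟨hvB, hvT⟩ := mem_sdiff.1 hv
    have : insert v T ∈ 𝒮 := by
      simp only [𝒮, 𝒯, mem_filter, mem_powerset, insert_subset_iff, mem_insert]
      refine ⟨⟨⟨hvB, hTB⟩, hTc.insert hvT hu huv, Or.inr hxT⟩, ?_⟩
      rintro y (rfl | hy)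
      · exact hva
      · exact hT2 y hy
    have := hmax _ this
    rw [card_insert_of_notMem hvT] at this
    omega
  calc _ ≤ ∑ τ ∈ 𝒯.biUnion X, lam ^ monoEdges G τ :=
        sum_le_sum_of_subset_of_nonneg hcover fun _ _ _ => pow_nonneg hlam0 _
    _ ≤ ∑ T ∈ 𝒯, ∑ τ ∈ X T, lam ^ monoEdges G τ :=
        sum_biUnion_le _ _ fun _ => pow_nonneg hlam0 _
    _ ≤ ∑ T ∈ 𝒯, θ * Z := sum_le_sum hX
    _ = (𝒯.card : ℝ) * (θ * Z) := by rw [sum_const, nsmul_eq_mul]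
    _ ≤ 2 ^ B.card * (θ * Z) := by
        refine mul_le_mul_of_nonneg_right ?_ (mul_nonneg hθ0 hZ0)
        have : 𝒯.card ≤ 2 ^ B.card := (card_filter_le _ _).trans (card_powerset B).le
        exact_mod_cast this
    _ = _ := by ring

end Marginal

/-! ### Comparison of two weighted averages -/

section Averages

open Finset

/-- Two weights that are proportional outside a set of small mass have close averages. -/
lemma abs_avg_sub_avg_le {α : Type*} (S : Finset α) (w w' f : α → ℝ) (b : α → Prop)
    [DecidablePred b] {D ρ k : ℝ} (hw : ∀ x ∈ S, 0 < w x) (hw' : ∀ x ∈ S, 0 < w' x)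
    (hS : S.Nonempty) (hf : ∀ x ∈ S, ∀ y ∈ S, |f x - f y| ≤ D)
    (hk : ∀ x ∈ S, ¬ b x → w' x = k * w x)
    (hb : ∑ x ∈ S.filter b, w x ≤ ρ * ∑ x ∈ S, w x)
    (hb' : ∑ x ∈ S.filter b, w' x ≤ ρ * ∑ x ∈ S, w' x) :
    |(∑ x ∈ S, w' x * f x) / (∑ x ∈ S, w' x) - (∑ x ∈ S, w x * f x) / ∑ x ∈ S, w x| ≤
      2 * ρ * D := by
  obtain ⟨x0, hx0⟩ := hS
  have hD : 0 ≤ D := (abs_nonneg _).trans (hf x0 hx0 x0 hx0)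
  -- `c` is the average of `f` over the points outside `b`. It is the same for both weights, which
  -- are proportional there, so each full average differs from `c` only through its bad mass.
  obtain ⟨c, hc, hc0⟩ : ∃ c, (∀ x ∈ S, |f x - c| ≤ D) ∧
      ∑ x ∈ S.filter (fun x => ¬ b x), w x * (f x - c) = 0 := by
    rcases (S.filter fun x => ¬ b x).eq_empty_or_nonempty with h | h
    · exact ⟨f x0, fun x hx => hf x hx x0 hx0, by rw [h, sum_empty]⟩
    · have hpos : 0 < ∑ x ∈ S.filter (fun x => ¬ b x), w x :=
        sum_pos (fun x hx => hw x (mem_filter.1 hx).1) h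
      refine ⟨(∑ x ∈ S.filter (fun x => ¬ b x), w x * f x) /
        ∑ x ∈ S.filter (fun x => ¬ b x), w x, fun x hx => ?_, ?_⟩
      · have e : f x - (∑ x ∈ S.filter (fun x => ¬ b x), w x * f x) /
            ∑ x ∈ S.filter (fun x => ¬ b x), w x =
            (∑ y ∈ S.filter (fun x => ¬ b x), w y * (f x - f y)) /
              ∑ x ∈ S.filter (fun x => ¬ b x), w x := by
          simp only [mul_sub, sum_sub_distrib, ← sum_mul]
          field_simp
        rw [e, abs_div, abs_of_pos hpos, div_le_iff₀ hpos, mul_sum]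
        refine (abs_sum_le_sum_abs _ _).trans (sum_le_sum fun y hy => ?_)
        have hy := (mem_filter.1 hy).1
        rw [abs_mul, abs_of_pos (hw y hy), mul_comm]
        exact mul_le_mul_of_nonneg_right (hf x hx y hy) (hw y hy).le
      · simp only [mul_sub, sum_sub_distrib, ← sum_mul]
        field_simp
        simp
  have main : ∀ u : α → ℝ, (∀ x ∈ S, 0 < u x) →
      ∑ x ∈ S.filter (fun x => ¬ b x), u x * (f x - c) = 0 →
      ∑ x ∈ S.filter b, u x ≤ ρ * ∑ x ∈ S, u x →
      |(∑ x ∈ S, u x * f x) / (∑ x ∈ S, u x) - c| ≤ ρ * D := by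
    intro u hu hu0 hub
    have hpos : 0 < ∑ x ∈ S, u x := sum_pos hu ⟨x0, hx0⟩
    have e : (∑ x ∈ S, u x * f x) / (∑ x ∈ S, u x) - c =
        (∑ x ∈ S.filter b, u x * (f x - c)) / ∑ x ∈ S, u x := by
      rw [← add_zero (∑ x ∈ S.filter b, u x * (f x - c)), ← hu0, sum_filter_add_sum_filter_not]
      simp only [mul_sub, sum_sub_distrib, ← sum_mul]
      field_simp
    rw [e, abs_div, abs_of_pos hpos, div_le_iff₀ hpos]
    calc |∑ x ∈ S.filter b, u x * (f x - c)| ≤ ∑ x ∈ S.filter b, u x * D := by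
          refine (abs_sum_le_sum_abs _ _).trans (sum_le_sum fun y hy => ?_)
          have hy := (mem_filter.1 hy).1
          rw [abs_mul, abs_of_pos (hu y hy)]
          exact mul_le_mul_of_nonneg_left (hc y hy) (hu y hy).le
      _ = (∑ x ∈ S.filter b, u x) * D := by rw [sum_mul]
      _ ≤ ρ * (∑ x ∈ S, u x) * D := mul_le_mul_of_nonneg_right hub hD
      _ = _ := by ring
  have h1 := main w hw hc0 hb
  have h2 := main w' hw' (by
    rw [← mul_zero k, ← hc0, mul_sum]
    refine sum_congr rfl fun x hx => ?_
    rw [hk x (mem_filter.1 hx).1 (mem_filter.1 hx).2, mul_assoc]) hb'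
  rw [abs_le] at h1 h2 ⊢
  constructor <;> linarith [h1.1, h1.2, h2.1, h2.2]

end Averages

/-! ### Oscillation of a function at a vertex -/

section Oscillation

open Finset Function

variable {V : Type u} [Fintype V] [DecidableEq V] {q : ℕ}

/-- The largest change of `f` when the colour of `x` is changed. -/
noncomputable def osc (f : (V → Fin q) → ℝ) (x : V) : ℝ :=
  ⨆ p : (V → Fin q) × Fin q, |f (update p.1 x p.2) - f p.1|

lemma abs_sub_le_osc (f : (V → Fin q) → ℝ) (x : V) (σ : V → Fin q) (c : Fin q) :
    |f (update σ x c) - f σ| ≤ osc f x :=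
  le_ciSup (f := fun p : (V → Fin q) × Fin q => |f (update p.1 x p.2) - f p.1|)
    (Set.finite_range _).bddAbove (σ, c)

lemma osc_nonneg {V : Type*} [DecidableEq V] (f : (V → Fin q) → ℝ) (x : V) : 0 ≤ osc f x :=
  Real.iSup_nonneg fun _ => abs_nonneg _

lemma osc_le {V : Type*} [DecidableEq V] {f : (V → Fin q) → ℝ} {x : V} {D : ℝ} (hD : 0 ≤ D)
    (h : ∀ σ c, |f (update σ x c) - f σ| ≤ D) : osc f x ≤ D :=
  Real.iSup_le (fun p => h p.1 p.2) hD

/-- Pass from `σ` to `τ` by changing the vertices of `B` one at a time. -/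
lemma abs_sub_le_sum_osc (f : (V → Fin q) → ℝ) {B : Finset V} {σ τ : V → Fin q}
    (h : agreeOff q B σ τ) : |f σ - f τ| ≤ ∑ x ∈ B, osc f x := by
  induction B using Finset.induction_on generalizing σ with
  | empty =>
    have : σ = τ := funext fun v => h v (by simp)
    simp [this]
  | insert x B hx ih =>
    have h1 : agreeOff q B (update σ x (τ x)) τ := by
      intro v hv
      by_cases hvx : v = x
      · subst hvx; simp
      · rw [update_of_ne hvx]
        exact h v (by simp [hv, hvx])
    have h2 := abs_sub_le_osc f x σ (τ x)
    rw [sum_insert hx]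
    calc |f σ - f τ| ≤ |f (update σ x (τ x)) - f σ| + |f (update σ x (τ x)) - f τ| := by
          rw [abs_sub_comm _ (f σ)]; exact abs_sub_le _ _ _
      _ ≤ _ := add_le_add h2 (ih h1)

end Oscillation

/-! ### Effect of a single recolouring on the Hamiltonian -/

section Update

open Finset Function

variable {V : Type u} [Fintype V] [DecidableEq V] (G : SimpleGraph V) [DecidableRel G.Adj] {q : ℕ}

lemma monoEdges_eq_add_nbrCount (σ : V → Fin q) (x : V) :
    monoEdges G σ = (G.edgeFinset.filter fun e => x ∉ e ∧ (e.map σ).IsDiag).card +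
      nbrCount G σ x (σ x) := by
  have h1 : nbrCount G σ x (σ x) =
      (G.edgeFinset.filter fun e => x ∈ e ∧ (e.map σ).IsDiag).card := by
    unfold nbrCount
    refine card_bij (fun u _ => s(x, u)) ?_ ?_ ?_
    · intro u hu
      rw [mem_filter, SimpleGraph.mem_neighborFinset] at hu
      simp [hu.1, hu.2]
    · intro u _ v _ h
      exact Sym2.congr_right.1 h
    · intro e he
      simp only [mem_filter, SimpleGraph.mem_edgeFinset] at he
      obtain ⟨h1, h2, h3⟩ := he
      obtain ⟨u, rfl⟩ := Sym2.mem_iff_exists.1 h2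
      refine ⟨u, ?_, rfl⟩
      rw [mem_filter, SimpleGraph.mem_neighborFinset]
      rw [Sym2.map_mk, Sym2.mk_isDiag_iff] at h3
      exact ⟨h1, h3.symm⟩
  rw [h1, monoEdges, ← card_union_of_disjoint]
  · congr 1
    ext e
    simp only [mem_filter, mem_union]
    tauto
  · rw [disjoint_filter]
    tauto

lemma nbrCount_update (σ : V → Fin q) (x : V) (b c : Fin q) :
    nbrCount G (update σ x b) x c = nbrCount G σ x c := by
  unfold nbrCount
  congr 1
  refine filter_congr fun u hu => ?_
  rw [update_of_ne]
  exact ((SimpleGraph.mem_neighborFinset _ _ _).1 hu).ne'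

lemma monoEdges_update (σ : V → Fin q) (x : V) (b : Fin q) :
    monoEdges G (update σ x b) + nbrCount G σ x (σ x) = monoEdges G σ + nbrCount G σ x b := by
  rw [monoEdges_eq_add_nbrCount G (update σ x b) x, monoEdges_eq_add_nbrCount G σ x, update_self,
    nbrCount_update]
  have : (G.edgeFinset.filter fun e => x ∉ e ∧ (e.map (update σ x b)).IsDiag) =
      G.edgeFinset.filter fun e => x ∉ e ∧ (e.map σ).IsDiag := by
    refine filter_congr fun e _ => and_congr_right fun hx => ?_
    refine map_isDiag_congr fun v hv => update_of_ne ?_ _ _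
    rintro rfl
    exact hx hv
  rw [this]
  omega

end Update

/-! ### Block resampling contracts the total oscillation -/

section BlockContraction

open Finset Function

variable {V : Type u} [Fintype V] [DecidableEq V] (G : SimpleGraph V) [DecidableRel G.Adj] {q : ℕ}

lemma condAvg_agreeOff (w f : (V → Fin q) → ℝ) (B : Finset V) (σ : V → Fin q) :
    condAvg w (agreeOff q B) f σ =
      (∑ τ ∈ univ.filter (fun τ => agreeOff q B σ τ), w τ * f τ) /
        ∑ τ ∈ univ.filter (fun τ => agreeOff q B σ τ), w τ := by
  unfold condAvg
  congr!

/-- Recolouring `x` is a bijection between the classes of the two boundary conditions. It turns a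
change of boundary condition into a change of weight on one fixed class. -/
lemma sum_update_class {B : Finset V} {x : V} (hx : x ∉ B) (σ : V → Fin q) (b : Fin q)
    (p : (V → Fin q) → Prop) [DecidablePred p] (g : (V → Fin q) → ℝ)
    (hp : ∀ τ, p (update τ x b) ↔ p τ) :
    ∑ τ ∈ univ.filter (fun τ => agreeOff q B (update σ x b) τ ∧ p τ), g τ =
      ∑ τ ∈ univ.filter (fun τ => agreeOff q B σ τ ∧ p τ), g (update τ x b) := by
  symm
  refine sum_bij' (fun τ _ => update τ x b) (fun τ _ => update τ x (σ x)) ?_ ?_ ?_ ?_ ?_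
  · intro τ hτ
    simp only [mem_filter, mem_univ, true_and, agreeOff_iff] at hτ ⊢
    refine ⟨fun v hv => ?_, (hp τ).2 hτ.2⟩
    by_cases hvx : v = x
    · subst hvx; simp
    · rw [update_of_ne hvx, update_of_ne hvx, hτ.1 v hv]
  · intro τ hτ
    simp only [mem_filter, mem_univ, true_and, agreeOff_iff] at hτ ⊢
    have e : update (update τ x (σ x)) x b = τ := by
      have := hτ.1 x hx
      rw [update_self] at this
      rw [update_idem, this, update_eq_self]
    refine ⟨fun v hv => ?_, (hp _).1 (by rw [e]; exact hτ.2)⟩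
    by_cases hvx : v = x
    · subst hvx; simp
    · have := hτ.1 v hv
      rw [update_of_ne hvx] at this
      rw [update_of_ne hvx, this]
  · intro τ hτ
    simp only [mem_filter, mem_univ, true_and, agreeOff_iff] at hτ
    rw [update_idem, hτ.1 x hx, update_eq_self]
  · intro τ hτ
    simp only [mem_filter, mem_univ, true_and, agreeOff_iff] at hτ
    have := hτ.1 x hx
    rw [update_self] at this
    rw [update_idem, this, update_eq_self]
  · intro τ _
    rfl

/-- Effect of changing the colour of a vertex outside the block on the block average. -/
lemma osc_condAvg_le {lam : ℝ} (hlam : 1 ≤ lam) {B : Finset V} {ϑ : ℝ} (hϑ : 0 ≤ ϑ)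
    (hmarg : ∀ (σ : V → Fin q), ∀ u ∈ B, ∀ a : Fin q,
      ∑ τ ∈ univ.filter (fun τ => agreeOff q B σ τ ∧ τ u = a), lam ^ monoEdges G τ ≤
        ϑ * ∑ τ ∈ univ.filter (fun τ => agreeOff q B σ τ), lam ^ monoEdges G τ)
    (f : (V → Fin q) → ℝ) {x : V} (hx : x ∉ B) :
    osc (condAvg (fun τ => lam ^ monoEdges G τ) (agreeOff q B) f) x ≤
      osc f x + 4 * ϑ * (B.filter (fun u => G.Adj x u)).card * ∑ y ∈ B, osc f y := by
  have hlam0 : 0 < lam := zero_lt_one.trans_le hlam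
  have hsum0 : 0 ≤ ∑ y ∈ B, osc f y := sum_nonneg fun _ _ => osc_nonneg _ _
  refine osc_le (add_nonneg (osc_nonneg _ _) (by positivity)) fun σ b => ?_
  set W : (V → Fin q) → ℝ := fun τ => lam ^ monoEdges G τ with hW
  have hW0 : ∀ τ, 0 < W τ := fun τ => pow_pos hlam0 _
  set S := univ.filter (fun τ => agreeOff q B σ τ) with hS
  set a := σ x with ha
  have hSne : S.Nonempty := ⟨σ, mem_filter.2 ⟨mem_univ _, (agreeOff q B).refl σ⟩⟩
  have hsum : ∀ g : (V → Fin q) → ℝ,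
      ∑ τ ∈ univ.filter (fun τ => agreeOff q B (update σ x b) τ), g τ =
        ∑ τ ∈ S, g (update τ x b) := by
    intro g
    simpa using sum_update_class hx σ b (fun _ => True) g (by simp)
  rw [condAvg_agreeOff, condAvg_agreeOff, hsum, hsum]
  set N := B.filter (fun u => G.Adj x u) with hN
  -- The old and new weights have a ratio depending only on how many neighbours of `x` have colours
  -- `a` and `b`. Unless a neighbour inside the block has one of these colours, the counts are fixed
  -- by the boundary. A union bound over neighbours and the two colours gives `bad` relative mass at
  -- most `2 * ϑ * N.card`.
  let bad : (V → Fin q) → Prop := fun τ => ∃ u ∈ N, τ u = a ∨ τ u = b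
  let cnt : Fin q → ℕ := fun c => ((G.neighborFinset x).filter fun u => u ∉ B ∧ σ u = c).card
  have hcnt : ∀ τ ∈ S, ¬ bad τ → ∀ c, c = a ∨ c = b → nbrCount G τ x c = cnt c := by
    intro τ hτ hbad c hc
    have hτ' := agreeOff_iff.1 (mem_filter.1 hτ).2
    unfold nbrCount
    congr 1
    refine filter_congr fun u hu => ?_
    have huadj := (SimpleGraph.mem_neighborFinset _ _ _).1 hu
    by_cases huB : u ∈ B
    · simp only [huB, not_true_eq_false, false_and, iff_false]
      rintro rfl
      exact hbad ⟨u, mem_filter.2 ⟨huB, huadj⟩, hc⟩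
    · simp [huB, hτ' u huB]
  have hbound : ∀ (σ' : V → Fin q), ∑ τ ∈ univ.filter (fun τ => agreeOff q B σ' τ ∧ bad τ), W τ ≤
      2 * ϑ * N.card * ∑ τ ∈ univ.filter (fun τ => agreeOff q B σ' τ), W τ := by
    intro σ'
    calc _ ≤ ∑ τ ∈ N.biUnion (fun u => univ.filter (fun τ => agreeOff q B σ' τ ∧ τ u = a) ∪
            univ.filter (fun τ => agreeOff q B σ' τ ∧ τ u = b)), W τ := by
          refine sum_le_sum_of_subset_of_nonneg ?_ fun τ _ _ => (hW0 τ).le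
          intro τ hτ
          obtain ⟨_, h1, u, hu, h2⟩ := mem_filter.1 hτ
          refine mem_biUnion.2 ⟨u, hu, ?_⟩
          simp only [mem_union, mem_filter, mem_univ, true_and]
          exact h2.imp (fun h => ⟨h1, h⟩) fun h => ⟨h1, h⟩
      _ ≤ ∑ u ∈ N, (2 * ϑ * ∑ τ ∈ univ.filter (fun τ => agreeOff q B σ' τ), W τ) := by
          refine (sum_biUnion_le _ _ fun τ => (hW0 τ).le).trans (sum_le_sum fun u hu => ?_)
          have huB := (mem_filter.1 hu).1
          have h1 := hmarg σ' u huB a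
          have h2 := hmarg σ' u huB b
          have h3 := sum_union_inter (s₁ := univ.filter (fun τ => agreeOff q B σ' τ ∧ τ u = a))
            (s₂ := univ.filter (fun τ => agreeOff q B σ' τ ∧ τ u = b)) (f := W)
          have h4 : 0 ≤ ∑ τ ∈ univ.filter (fun τ => agreeOff q B σ' τ ∧ τ u = a) ∩
            univ.filter (fun τ => agreeOff q B σ' τ ∧ τ u = b), W τ :=
            sum_nonneg fun τ _ => (hW0 τ).le
          simp only [hW] at h3 h4 ⊢
          linarith
      _ = _ := by rw [sum_const, nsmul_eq_mul]; ring
  have hbadup : ∀ τ : V → Fin q, bad (update τ x b) ↔ bad τ := by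
    intro τ
    refine exists_congr fun u => and_congr_right fun hu => ?_
    rw [update_of_ne]
    rintro rfl
    exact hx (mem_filter.1 hu).1
  have h1 : |(∑ τ ∈ S, W (update τ x b) * f τ) / (∑ τ ∈ S, W (update τ x b)) -
      (∑ τ ∈ S, W τ * f τ) / ∑ τ ∈ S, W τ| ≤
        2 * (2 * ϑ * N.card) * ∑ y ∈ B, osc f y := by
    classical
    refine abs_avg_sub_avg_le S W (fun τ => W (update τ x b)) f bad
      (k := lam ^ cnt b / lam ^ cnt a) (fun τ _ => hW0 τ) (fun τ _ => hW0 _) hSne ?_ ?_ ?_ ?_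
    · intro τ hτ τ' hτ'
      exact abs_sub_le_sum_osc f ((agreeOff q B).trans ((agreeOff q B).symm (mem_filter.1 hτ).2)
        (mem_filter.1 hτ').2)
    · intro τ hτ hbad
      have hτx : τ x = a := (agreeOff_iff.1 (mem_filter.1 hτ).2 x hx).symm
      have e := monoEdges_update G τ x b
      rw [hτx, hcnt τ hτ hbad a (Or.inl rfl), hcnt τ hτ hbad b (Or.inr rfl)] at e
      rw [div_mul_eq_mul_div, eq_div_iff (pow_pos hlam0 _).ne', ← pow_add, ← pow_add, e, add_comm]
    · have := hbound σ
      rwa [← filter_filter] at this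
    · have := hbound (update σ x b)
      rw [sum_update_class hx σ b bad W hbadup, hsum, ← filter_filter] at this
      exact this
  have hpos : 0 < ∑ τ ∈ S, W (update τ x b) := sum_pos (fun τ _ => hW0 _) hSne
  -- The change splits in two: here the argument of `f` moves under a fixed weight, while in `h1`
  -- the weight moves under a fixed `f`.
  have h2 : |(∑ τ ∈ S, W (update τ x b) * f (update τ x b)) / (∑ τ ∈ S, W (update τ x b)) -
      (∑ τ ∈ S, W (update τ x b) * f τ) / (∑ τ ∈ S, W (update τ x b))| ≤ osc f x := by
    rw [← sub_div, ← sum_sub_distrib, abs_div, abs_of_pos hpos, div_le_iff₀ hpos, mul_sum]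
    refine (abs_sum_le_sum_abs _ _).trans (sum_le_sum fun τ _ => ?_)
    rw [← mul_sub, abs_mul, abs_of_pos (hW0 _), mul_comm]
    exact mul_le_mul_of_nonneg_right (abs_sub_le_osc f x τ b) (hW0 _).le
  refine (abs_sub_le _ _ _).trans ((add_le_add h2 h1).trans (le_of_eq ?_))
  ring

lemma osc_condAvg_of_mem (w f : (V → Fin q) → ℝ) {B : Finset V} {x : V} (hx : x ∈ B) :
    osc (condAvg w (agreeOff q B) f) x = 0 := by
  refine le_antisymm (osc_le le_rfl fun σ b => ?_) (osc_nonneg _ _)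
  rw [condAvg_congr (agreeOff q B) (σ := update σ x b) (τ := σ), sub_self, abs_zero]
  intro v hv
  rw [update_of_ne]
  rintro rfl
  exact hv hx

/-- All oscillation on `B` disappears. At most `Δ * B.card` edges leave `B`, and each transmits at
most `4 * ϑ` times the erased amount, so by `hϑB` no more than half comes back. -/
lemma sum_osc_condAvg_le {lam : ℝ} (hlam : 1 ≤ lam) {Δ : ℕ} (hdeg : ∀ v, G.degree v ≤ Δ)
    {B : Finset V} {ϑ : ℝ} (hϑ : 0 ≤ ϑ) (hϑB : 8 * ϑ * (Δ * B.card) ≤ 1)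
    (hmarg : ∀ (σ : V → Fin q), ∀ u ∈ B, ∀ a : Fin q,
      ∑ τ ∈ univ.filter (fun τ => agreeOff q B σ τ ∧ τ u = a), lam ^ monoEdges G τ ≤
        ϑ * ∑ τ ∈ univ.filter (fun τ => agreeOff q B σ τ), lam ^ monoEdges G τ)
    (f : (V → Fin q) → ℝ) :
    ∑ x, osc (condAvg (fun τ => lam ^ monoEdges G τ) (agreeOff q B) f) x ≤
      ∑ x, osc f x - 1 / 2 * ∑ y ∈ B, osc f y := by
  have hsum0 : 0 ≤ ∑ y ∈ B, osc f y := sum_nonneg fun _ _ => osc_nonneg _ _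
  have h1 : ∑ x, osc (condAvg (fun τ => lam ^ monoEdges G τ) (agreeOff q B) f) x ≤
      ∑ x ∈ Bᶜ, (osc f x +
        4 * ϑ * (B.filter (fun u => G.Adj x u)).card * ∑ y ∈ B, osc f y) := by
    rw [← sum_add_sum_compl B, sum_eq_zero fun x hx => osc_condAvg_of_mem _ f hx, zero_add]
    exact sum_le_sum fun x hx => osc_condAvg_le G hlam hϑ hmarg f (mem_compl.1 hx)
  have h2 : ∑ x ∈ Bᶜ, ((B.filter (fun u => G.Adj x u)).card : ℝ) ≤ Δ * B.card := by
    have : ∑ x ∈ Bᶜ, (B.filter (fun u => G.Adj x u)).card ≤ Δ * B.card := by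
      calc ∑ x ∈ Bᶜ, (B.filter (fun u => G.Adj x u)).card
          ≤ ∑ x, (B.filter (fun u => G.Adj x u)).card :=
            sum_le_sum_of_subset (subset_univ _)
        _ = ∑ u ∈ B, (univ.filter (fun x => G.Adj x u)).card :=
            sum_card_bipartiteAbove_eq_sum_card_bipartiteBelow G.Adj
        _ ≤ ∑ u ∈ B, Δ := by
            refine sum_le_sum fun u _ => ?_
            refine le_trans (le_of_eq ?_) (hdeg u)
            rw [← SimpleGraph.card_neighborFinset_eq_degree]
            congr 1
            ext x
            simp [SimpleGraph.adj_comm]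
        _ = _ := by rw [sum_const, smul_eq_mul, mul_comm]
    exact_mod_cast this
  rw [sum_add_distrib, ← sum_mul, ← mul_sum] at h1
  have h3 := sum_add_sum_compl B (osc f)
  have h4 : 4 * ϑ * (∑ x ∈ Bᶜ, ((B.filter (fun u => G.Adj x u)).card : ℝ)) *
      ∑ y ∈ B, osc f y ≤ 1 / 2 * ∑ y ∈ B, osc f y := by
    refine mul_le_mul_of_nonneg_right ?_ hsum0
    have := mul_le_mul_of_nonneg_left h2 (by positivity : 0 ≤ 4 * ϑ)
    linarith
  linarith

lemma sum_osc_condAvg_univ (w f : (V → Fin q) → ℝ) :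
    ∑ x, osc (condAvg w (agreeOff q univ) f) x = 0 :=
  sum_eq_zero fun x _ => osc_condAvg_of_mem w f (mem_univ x)

/-- Averaging over blocks contracts the total oscillation. -/
lemma sum_osc_avgOp_le [Nonempty V] (w : (V → Fin q) → ℝ) (B : V → Finset V)
    (hB : ∀ v f, ∑ x, osc (condAvg w (agreeOff q (B v)) f) x ≤
      ∑ x, osc f x - 1 / 2 * osc f v) (f : (V → Fin q) → ℝ) :
    ∑ x, osc (avgOp w (fun v => agreeOff q (B v)) f) x ≤
      (1 - 1 / (2 * Fintype.card V)) * ∑ x, osc f x := by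
  have hn : (0 : ℝ) < Fintype.card V := by exact_mod_cast Fintype.card_pos
  have h1 : ∀ x, osc (avgOp w (fun v => agreeOff q (B v)) f) x ≤
      1 / (Fintype.card V : ℝ) * ∑ v, osc (condAvg w (agreeOff q (B v)) f) x := by
    intro x
    refine osc_le (mul_nonneg (by positivity) (sum_nonneg fun _ _ => osc_nonneg _ _)) fun σ c => ?_
    simp only [avgOp, Pi.smul_apply, smul_eq_mul, Finset.sum_apply]
    rw [← mul_sub, ← sum_sub_distrib, abs_mul, abs_of_pos (by positivity)]
    refine mul_le_mul_of_nonneg_left ?_ (by positivity)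
    exact (abs_sum_le_sum_abs _ _).trans (sum_le_sum fun v _ => abs_sub_le_osc _ x σ c)
  refine (sum_le_sum fun x _ => h1 x).trans ?_
  rw [← mul_sum, sum_comm]
  refine (mul_le_mul_of_nonneg_left (sum_le_sum fun v _ => hB v f) (by positivity)).trans ?_
  rw [sum_sub_distrib, sum_const, card_univ, nsmul_eq_mul, ← mul_sum]
  apply le_of_eq
  field_simp

end BlockContraction

/-! ### Glauber dynamics as an average of projections, and comparison with blocks -/

section Gibbs

open Finset Function

variable {V : Type u} [Fintype V] [DecidableEq V] (G : SimpleGraph V) [DecidableRel G.Adj] {q : ℕ}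
  {lam : ℝ}

lemma partitionFn_pos (hlam : 0 < lam) (hq : 0 < q) : 0 < partitionFn G lam q :=
  sum_pos (fun _ _ => pow_pos hlam _) ⟨fun _ => ⟨0, hq⟩, mem_univ _⟩

lemma gibbs_pos (hlam : 0 < lam) (hq : 0 < q) (σ : V → Fin q) : 0 < gibbs G lam q σ :=
  div_pos (pow_pos hlam _) (partitionFn_pos G hlam hq)

lemma sum_gibbs (hlam : 0 < lam) (hq : 0 < q) : ∑ σ, gibbs G lam q σ = 1 := by
  simp only [gibbs, ← sum_div]
  exact div_self (partitionFn_pos G hlam hq).ne'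

lemma condAvg_gibbs (hlam : 0 < lam) (hq : 0 < q) (r : Setoid (V → Fin q)) :
    condAvg (gibbs G lam q) r = condAvg (fun τ => lam ^ monoEdges G τ) r := by
  funext f σ
  have h := (partitionFn_pos G hlam hq).ne'
  simp only [condAvg, gibbs, div_mul_eq_mul_div, ← sum_div]
  rw [div_div_div_cancel_right₀ h]

lemma sum_class_singleton (σ : V → Fin q) (x : V) (g : (V → Fin q) → ℝ) :
    ∑ τ ∈ univ.filter (fun τ => agreeOff q {x} σ τ), g τ = ∑ c, g (update σ x c) := by
  symm
  refine sum_bij (fun c _ => update σ x c) ?_ ?_ ?_ fun _ _ => rfl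
  · intro c _
    refine mem_filter.2 ⟨mem_univ _, fun v hv => ?_⟩
    rw [update_of_ne (by simpa using hv)]
  · intro c _ c' _ h
    exact update_injective σ x h
  · intro τ hτ
    refine ⟨τ x, mem_univ _, ?_⟩
    funext v
    by_cases hv : v = x
    · subst hv; simp
    · rw [update_of_ne hv, (mem_filter.1 hτ).2 v (by simpa using hv)]

lemma condAvg_singleton (hlam : 0 < lam) (hq : 0 < q) (σ : V → Fin q) (x : V)
    (f : (V → Fin q) → ℝ) : condAvg (gibbs G lam q) (agreeOff q {x}) f σ =
      ∑ c, localDist G lam σ x c * f (update σ x c) := by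
  rw [condAvg_gibbs G hlam hq, condAvg_agreeOff, sum_class_singleton, sum_class_singleton]
  have e : ∀ c, lam ^ monoEdges G (update σ x c) =
      lam ^ monoEdges G σ / lam ^ nbrCount G σ x (σ x) * lam ^ nbrCount G σ x c := by
    intro c
    rw [div_mul_eq_mul_div, eq_div_iff (pow_pos hlam _).ne', ← pow_add, ← pow_add,
      monoEdges_update]
  simp only [e, localDist, mul_assoc, ← mul_sum]
  rw [mul_div_mul_left _ _ (div_pos (pow_pos hlam _) (pow_pos hlam _)).ne', sum_div]
  exact sum_congr rfl fun c _ => by ring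

/-- The heat-bath update at `v` is the Gibbs conditional expectation given the colours off `v`. Row
sums and reversibility of the chain are then read off from `avgOp`. -/
lemma glauber_mulVec (hlam : 0 < lam) (hq : 0 < q) (f : (V → Fin q) → ℝ) :
    (glauber G lam q).mulVec f = avgOp (gibbs G lam q) (fun v => agreeOff q {v}) f := by
  funext σ
  simp only [Matrix.mulVec, dotProduct, glauber, avgOp, Pi.smul_apply, smul_eq_mul,
    Finset.sum_apply, condAvg_singleton G hlam hq, sum_mul, mul_sum]
  rw [sum_comm]
  refine sum_congr rfl fun v _ => ?_
  rw [sum_comm]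
  refine sum_congr rfl fun c _ => ?_
  simp [mul_assoc]

lemma glauber_row_sum [Nonempty V] (hlam : 0 < lam) (hq : 0 < q) (σ : V → Fin q) :
    ∑ τ, glauber G lam q σ τ = 1 := by
  have h := congrFun (glauber_mulVec G hlam hq fun _ => 1) σ
  rw [avgOp_const _ (gibbs_pos G hlam hq)] at h
  simpa [Matrix.mulVec, dotProduct] using h

lemma glauber_reversible (hlam : 0 < lam) (hq : 0 < q) (σ τ : V → Fin q) :
    gibbs G lam q σ * glauber G lam q σ τ = gibbs G lam q τ * glauber G lam q τ σ := by
  have h := avgOp_adjoint (w := gibbs G lam q) (fun v : V => agreeOff q {v})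
    (Pi.single τ 1) (Pi.single σ 1)
  rw [← glauber_mulVec G hlam hq, ← glauber_mulVec G hlam hq] at h
  simpa [wip, Matrix.mulVec_single, Pi.single_apply] using h

lemma glauber_nonneg (hlam : 0 < lam) (σ τ : V → Fin q) : 0 ≤ glauber G lam q σ τ := by
  unfold glauber localDist
  refine sum_nonneg fun v _ => mul_nonneg (by positivity) (sum_nonneg fun c _ => mul_nonneg
    (div_nonneg (by positivity) (sum_nonneg fun _ _ => by positivity)) ?_)
  split_ifs <;> simp

lemma card_touch_le {Δ : ℕ} (hdeg : ∀ v, G.degree v ≤ Δ) (B : Finset V) :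
    (touch G B).card ≤ Δ * B.card := by
  have h : touch G B ⊆ B.biUnion fun v => G.incidenceFinset v := by
    intro e he
    obtain ⟨h1, v, hv, hve⟩ := mem_filter.1 he
    refine mem_biUnion.2 ⟨v, hv, ?_⟩
    rw [SimpleGraph.mem_incidenceFinset]
    exact ⟨SimpleGraph.mem_edgeFinset.1 h1, hve⟩
  refine (card_le_card h).trans (card_biUnion_le.trans ?_)
  rw [mul_comm, ← smul_eq_mul, ← sum_const]
  refine sum_le_sum fun v _ => ?_
  rw [SimpleGraph.card_incidenceFinset_eq_degree]
  exact hdeg v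

lemma monoEdges_le_add {Δ : ℕ} (hdeg : ∀ v, G.degree v ≤ Δ) {B : Finset V} {σ τ : V → Fin q}
    (h : agreeOff q B σ τ) : monoEdges G σ ≤ monoEdges G τ + Δ * B.card :=
  (monoEdges_le_of_agreeOff G h).trans
    (Nat.add_le_add_left ((card_filter_le _ _).trans (card_touch_le G hdeg B)) _)

lemma card_class_le (B : Finset V) (σ : V → Fin q) :
    (univ.filter (fun τ => agreeOff q B σ τ)).card ≤ q ^ B.card := by
  have : (univ.filter (fun τ => agreeOff q B σ τ)).card ≤ (univ : Finset (B → Fin q)).card := by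
    refine card_le_card_of_injOn (fun τ v => τ v) (fun _ _ => mem_coe.2 (mem_univ _)) ?_
    intro τ hτ τ' hτ' h
    funext v
    by_cases hv : v ∈ B
    · exact congrFun h ⟨v, hv⟩
    · rw [← (mem_filter.1 hτ).2 v hv, (mem_filter.1 hτ').2 v hv]
  simpa using this

/-- A class has at most `q ^ B.card` members, and changing the colours on `B` affects at most `Δ *
B.card` edges. With `B = univ` this is also the lower bound on `π` behind `one_div_gibbs_le`. -/
lemma gibbs_class_le (hlam : 1 ≤ lam) (hq : 0 < q) {Δ : ℕ} (hdeg : ∀ v, G.degree v ≤ Δ)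
    (B : Finset V) (σ : V → Fin q) :
    ∑ τ ∈ univ.filter (fun τ => agreeOff q B σ τ), gibbs G lam q τ ≤
      q ^ B.card * lam ^ (Δ * B.card) * gibbs G lam q σ := by
  have hlam0 : 0 < lam := zero_lt_one.trans_le hlam
  have hZ := partitionFn_pos G hlam0 hq
  have h1 : ∀ τ ∈ univ.filter (fun τ => agreeOff q B σ τ),
      gibbs G lam q τ ≤ lam ^ (Δ * B.card) * gibbs G lam q σ := by
    intro τ hτ
    rw [gibbs, gibbs, ← mul_div_assoc, ← pow_add]
    refine div_le_div_of_nonneg_right (pow_le_pow_right₀ hlam ?_) hZ.le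
    rw [add_comm]
    exact monoEdges_le_add G hdeg ((agreeOff q B).symm (mem_filter.1 hτ).2)
  refine (sum_le_card_nsmul _ _ _ h1).trans ?_
  rw [nsmul_eq_mul, mul_assoc]
  refine mul_le_mul_of_nonneg_right ?_
    (mul_nonneg (pow_nonneg hlam0.le _) (gibbs_pos G hlam0 hq σ).le)
  exact_mod_cast card_class_le B σ

/-- Any two members of the class are joined by recolouring single vertices `x ∈ B`. Such a move
leaves the average over the colour of `x` unchanged, so `f` changes by at most two deviations from
that average. -/
lemma sub_condAvg_sq_le {w f : (V → Fin q) → ℝ} (hw : ∀ σ, 0 < w σ) (B : Finset V)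
    (σ : V → Fin q) : (f σ - condAvg w (agreeOff q B) f σ) ^ 2 ≤
      4 * B.card * ∑ x ∈ B, ∑ ζ ∈ univ.filter (fun τ => agreeOff q B σ τ),
        (f ζ - condAvg w (agreeOff q {x}) f ζ) ^ 2 := by
  set S := univ.filter (fun τ => agreeOff q B σ τ) with hS
  set H : V → ℝ := fun x => ∑ ζ ∈ S, (f ζ - condAvg w (agreeOff q {x}) f ζ) ^ 2 with hH
  have hH0 : ∀ x, 0 ≤ H x := fun x => sum_nonneg fun _ _ => sq_nonneg _
  have hmem : ∀ ζ, ζ ∈ S ↔ agreeOff q B σ ζ := fun ζ => by simp [hS]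
  -- Truncating to the class makes the global oscillation at `x ∈ B` a quantity of this class alone,
  -- since recolouring `x` never leaves it.
  let F : (V → Fin q) → ℝ := fun ζ => if agreeOff q B σ ζ then f ζ else 0
  have hosc : ∀ x ∈ B, osc F x ≤ 2 * √(H x) := by
    intro x hx
    refine osc_le (by positivity) fun ζ c => ?_
    have hup : agreeOff q B ζ (update ζ x c) := by
      intro v hv
      rw [update_of_ne]
      rintro rfl
      exact hv hx
    by_cases hζ : agreeOff q B σ ζ
    · have hζ' := (agreeOff q B).trans hζ hup
      simp only [F, if_pos hζ, if_pos hζ']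
      have hle : ∀ ζ, agreeOff q B σ ζ →
          |f ζ - condAvg w (agreeOff q {x}) f ζ| ≤ √(H x) := by
        intro ζ hζ
        rw [← Real.sqrt_sq_eq_abs]
        exact Real.sqrt_le_sqrt (single_le_sum (f := fun ζ =>
          (f ζ - condAvg w (agreeOff q {x}) f ζ) ^ 2) (fun _ _ => sq_nonneg _) ((hmem ζ).2 hζ))
      have e : condAvg w (agreeOff q {x}) f (update ζ x c) =
          condAvg w (agreeOff q {x}) f ζ := by
        refine condAvg_congr _ (fun v hv => ?_) f
        rw [update_of_ne (by simpa using hv)]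
      have h1 := hle _ hζ
      have h2 := hle _ hζ'
      rw [e] at h2
      rw [abs_le] at *
      constructor <;> linarith [h1.1, h1.2, h2.1, h2.2]
    · have hζ' : ¬ agreeOff q B σ (update ζ x c) := fun h =>
        hζ ((agreeOff q B).trans h ((agreeOff q B).symm hup))
      simp only [F, if_neg hζ, if_neg hζ', sub_self, abs_zero]
      positivity
  have hdiff : ∀ τ ∈ S, |f σ - f τ| ≤ ∑ x ∈ B, 2 * √(H x) := by
    intro τ hτ
    have h := abs_sub_le_sum_osc F ((hmem τ).1 hτ)
    simp only [F, if_pos ((agreeOff q B).refl σ), if_pos ((hmem τ).1 hτ)] at h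
    exact h.trans (sum_le_sum hosc)
  have habs : |f σ - condAvg w (agreeOff q B) f σ| ≤ ∑ x ∈ B, 2 * √(H x) := by
    have hpos : 0 < ∑ τ ∈ S, w τ :=
      sum_pos (fun τ _ => hw τ) ⟨σ, (hmem σ).2 ((agreeOff q B).refl σ)⟩
    rw [condAvg_agreeOff]
    have e : f σ - (∑ τ ∈ S, w τ * f τ) / ∑ τ ∈ S, w τ =
        (∑ τ ∈ S, w τ * (f σ - f τ)) / ∑ τ ∈ S, w τ := by
      simp only [mul_sub, sum_sub_distrib, ← sum_mul]
      field_simp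
    rw [e, abs_div, abs_of_pos hpos, div_le_iff₀ hpos, mul_sum]
    refine (abs_sum_le_sum_abs _ _).trans (sum_le_sum fun τ hτ => ?_)
    rw [abs_mul, abs_of_pos (hw τ), mul_comm]
    exact mul_le_mul_of_nonneg_right (hdiff τ hτ) (hw τ).le
  calc (f σ - condAvg w (agreeOff q B) f σ) ^ 2
      = |f σ - condAvg w (agreeOff q B) f σ| ^ 2 := (sq_abs _).symm
    _ ≤ (∑ x ∈ B, 2 * √(H x)) ^ 2 := pow_le_pow_left₀ (abs_nonneg _) habs 2
    _ ≤ B.card * ∑ x ∈ B, (2 * √(H x)) ^ 2 := sq_sum_le_card_mul_sum_sq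
    _ = _ := by
        have e : ∑ x ∈ B, (2 * √(H x)) ^ 2 = 4 * ∑ x ∈ B, H x := by
          rw [mul_sum]
          refine sum_congr rfl fun x _ => ?_
          rw [mul_pow, Real.sq_sqrt (hH0 x)]
          norm_num
        rw [e]
        ring

/-- The variance over a bounded block is controlled by the single-site variances. -/
lemma wip_sub_condAvg_block_le (hlam : 1 ≤ lam) (hq : 0 < q) {Δ : ℕ}
    (hdeg : ∀ v, G.degree v ≤ Δ) {B : Finset V} {m : ℕ} (hBm : B.card ≤ m)
    (f : (V → Fin q) → ℝ) :
    wip (gibbs G lam q) (f - condAvg (gibbs G lam q) (agreeOff q B) f)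
        (f - condAvg (gibbs G lam q) (agreeOff q B) f) ≤
      4 * m * (q ^ m * lam ^ (Δ * m)) *
        ∑ x, wip (gibbs G lam q) (f - condAvg (gibbs G lam q) (agreeOff q {x}) f)
          (f - condAvg (gibbs G lam q) (agreeOff q {x}) f) := by
  have hlam0 : 0 < lam := zero_lt_one.trans_le hlam
  set π := gibbs G lam q with hπ
  have hπ0 : ∀ σ, 0 < π σ := gibbs_pos G hlam0 hq
  set h : V → (V → Fin q) → ℝ := fun x => f - condAvg π (agreeOff q {x}) f with hh
  have hq1 : (1 : ℝ) ≤ q := by exact_mod_cast hq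
  have hK : (q : ℝ) ^ B.card * lam ^ (Δ * B.card) ≤ q ^ m * lam ^ (Δ * m) :=
    mul_le_mul (pow_le_pow_right₀ hq1 hBm)
      (pow_le_pow_right₀ hlam (Nat.mul_le_mul_left _ hBm)) (pow_pos hlam0 _).le (by positivity)
  have hnn : ∀ x, 0 ≤ wip π (h x) (h x) := fun x => wip_self_nonneg (fun σ => (hπ0 σ).le) _
  have e1 : ∀ x, ∑ σ, π σ * ∑ ζ ∈ univ.filter (fun τ => agreeOff q B σ τ), h x ζ ^ 2 ≤
      q ^ m * lam ^ (Δ * m) * wip π (h x) (h x) := by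
    intro x
    calc ∑ σ, π σ * ∑ ζ ∈ univ.filter (fun τ => agreeOff q B σ τ), h x ζ ^ 2
        = ∑ ζ, h x ζ ^ 2 * ∑ σ ∈ univ.filter (fun τ => agreeOff q B ζ τ), π σ := by
          simp only [mul_sum, sum_filter]
          rw [sum_comm]
          refine sum_congr rfl fun ζ _ => sum_congr rfl fun σ _ => ?_
          by_cases hr : agreeOff q B σ ζ
          · rw [if_pos hr, if_pos ((agreeOff q B).symm hr), mul_comm]
          · rw [if_neg hr, if_neg fun h' => hr ((agreeOff q B).symm h'), mul_zero, mul_zero]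
      _ ≤ ∑ ζ, h x ζ ^ 2 * (q ^ m * lam ^ (Δ * m) * π ζ) := by
          refine sum_le_sum fun ζ _ => mul_le_mul_of_nonneg_left ?_ (sq_nonneg _)
          exact (gibbs_class_le G hlam hq hdeg B ζ).trans
            (mul_le_mul_of_nonneg_right hK (hπ0 ζ).le)
      _ = _ := by
          rw [wip, mul_sum]
          exact sum_congr rfl fun ζ _ => by ring
  calc wip π (f - condAvg π (agreeOff q B) f) (f - condAvg π (agreeOff q B) f)
      = ∑ σ, π σ * (f σ - condAvg π (agreeOff q B) f σ) ^ 2 :=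
        sum_congr rfl fun σ _ => by simp only [Pi.sub_apply]; ring
    _ ≤ ∑ σ, π σ * (4 * B.card * ∑ x ∈ B,
          ∑ ζ ∈ univ.filter (fun τ => agreeOff q B σ τ), h x ζ ^ 2) :=
        sum_le_sum fun σ _ => mul_le_mul_of_nonneg_left (sub_condAvg_sq_le hπ0 B σ) (hπ0 σ).le
    _ = 4 * B.card * ∑ x ∈ B, ∑ σ, π σ *
          ∑ ζ ∈ univ.filter (fun τ => agreeOff q B σ τ), h x ζ ^ 2 := by
        rw [sum_comm, mul_sum]
        refine sum_congr rfl fun σ _ => ?_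
        rw [← mul_sum]
        ring
    _ ≤ 4 * B.card * ∑ x ∈ B, q ^ m * lam ^ (Δ * m) * wip π (h x) (h x) :=
        mul_le_mul_of_nonneg_left (sum_le_sum fun x _ => e1 x) (by positivity)
    _ = 4 * B.card * (q ^ m * lam ^ (Δ * m)) * ∑ x ∈ B, wip π (h x) (h x) := by
        rw [← mul_sum]; ring
    _ ≤ _ := by
        have hBm' : (B.card : ℝ) ≤ m := by exact_mod_cast hBm
        refine mul_le_mul ?_ ?_ (sum_nonneg fun x _ => hnn x) (by positivity)
        · exact mul_le_mul_of_nonneg_right (by linarith) (by positivity)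
        · exact sum_le_sum_of_subset_of_nonneg (subset_univ _) fun x _ _ => hnn x

/-- A mean-zero `f` is at each point the average of its differences `f σ - f τ`, each bounded by the
total oscillation. This makes the total oscillation an admissible functional `L` for
`wip_avgOp_le_of_contraction`. -/
lemma wip_self_le_sum_osc_sq {π : (V → Fin q) → ℝ} (hπ : ∀ σ, 0 < π σ) (hsum : ∑ σ, π σ = 1)
    (f : (V → Fin q) → ℝ) (hf : wip π (fun _ => 1) f = 0) :
    wip π f f ≤ (∑ x, osc f x) ^ 2 := by
  have hf' : ∑ τ, π τ * f τ = 0 := by simpa [wip] using hf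
  have h1 : ∀ σ, |f σ| ≤ ∑ x, osc f x := by
    intro σ
    have e : f σ = ∑ τ, π τ * (f σ - f τ) := by
      simp only [mul_sub, sum_sub_distrib, hf', ← sum_mul, hsum, one_mul, sub_zero]
    rw [e]
    calc |∑ τ, π τ * (f σ - f τ)| ≤ ∑ τ, π τ * ∑ x, osc f x := by
          refine (abs_sum_le_sum_abs _ _).trans (sum_le_sum fun τ _ => ?_)
          rw [abs_mul, abs_of_pos (hπ τ)]
          refine mul_le_mul_of_nonneg_left ?_ (hπ τ).le
          exact abs_sub_le_sum_osc f fun v hv => absurd (mem_univ v) hv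
      _ = _ := by rw [← sum_mul, hsum, one_mul]
  calc wip π f f ≤ ∑ σ, π σ * (∑ x, osc f x) ^ 2 := by
        refine sum_le_sum fun σ _ => ?_
        rw [mul_assoc, ← sq, ← sq_abs]
        exact mul_le_mul_of_nonneg_left (pow_le_pow_left₀ (abs_nonneg _) (h1 σ) 2) (hπ σ).le
    _ = _ := by rw [← sum_mul, hsum, one_mul]

/-- Poincaré inequality for the Glauber dynamics from a contracting family of bounded blocks. -/
lemma glauber_gap [Nonempty V] (hlam : 1 ≤ lam) (hq : 0 < q) {Δ : ℕ}
    (hdeg : ∀ v, G.degree v ≤ Δ) {m : ℕ} (hm : 1 ≤ m) (B : V → Finset V)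
    (hBm : ∀ v, (B v).card ≤ m)
    (hB : ∀ v (f : (V → Fin q) → ℝ),
      ∑ x, osc (condAvg (gibbs G lam q) (agreeOff q (B v)) f) x ≤
        ∑ x, osc f x - 1 / 2 * osc f v)
    (f : (V → Fin q) → ℝ) (hf : wip (gibbs G lam q) (fun _ => 1) f = 0) :
    wip (gibbs G lam q) ((glauber G lam q).mulVec f) ((glauber G lam q).mulVec f) ≤
      (1 - 1 / (8 * m * (q ^ m * lam ^ (Δ * m)) * (Fintype.card V : ℝ) ^ 2)) *
        wip (gibbs G lam q) f f := by
  have hlam0 : 0 < lam := zero_lt_one.trans_le hlam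
  have hπ0 := gibbs_pos G hlam0 hq
  have hn : (1 : ℝ) ≤ Fintype.card V := by exact_mod_cast Fintype.card_pos
  have hq0 : (0 : ℝ) < q := by exact_mod_cast hq
  have hm0 : (0 : ℝ) < m := by exact_mod_cast hm
  set n : ℝ := (Fintype.card V : ℝ) with hn'
  set K : ℝ := 4 * m * (q ^ m * lam ^ (Δ * m)) with hK
  have hK0 : 0 < K := by positivity
  have hblock : wip (gibbs G lam q) f (avgOp (gibbs G lam q) (fun v => agreeOff q (B v)) f) ≤
      (1 - 1 / (2 * n)) * wip (gibbs G lam q) f f := by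
    refine wip_avgOp_le_of_contraction _ hπ0 (fun f => ∑ x, osc f x) ?_
      (fun f hf => wip_self_le_sum_osc_sq hπ0 (sum_gibbs G hlam0 hq) f hf)
      (fun f => sum_nonneg fun x _ => osc_nonneg f x) (sum_osc_avgOp_le _ B hB) f hf
    rw [sub_nonneg, div_le_one (by linarith)]
    linarith
  have e1 := wip_sub_avgOp (w := gibbs G lam q) (fun v => agreeOff q (B v)) hπ0 f
  have e2 := wip_sub_avgOp (w := gibbs G lam q) (fun v : V => agreeOff q {v}) hπ0 f
  rw [← hn'] at e1 e2
  set S := ∑ x, wip (gibbs G lam q) (f - condAvg (gibbs G lam q) (agreeOff q {x}) f)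
          (f - condAvg (gibbs G lam q) (agreeOff q {x}) f) with hS
  -- Crude: every block variance is charged to all single-site variances, ignoring how often blocks
  -- overlap. This accounts for the second power of the number of vertices in the gap.
  have h1 : ∑ v, wip (gibbs G lam q) (f - condAvg (gibbs G lam q) (agreeOff q (B v)) f)
      (f - condAvg (gibbs G lam q) (agreeOff q (B v)) f) ≤ n * (K * S) := by
    refine (sum_le_sum fun v _ => wip_sub_condAvg_block_le G hlam hq hdeg (hBm v) f).trans ?_
    rw [sum_const, card_univ, nsmul_eq_mul]
  rw [glauber_mulVec G hlam0 hq]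
  refine (wip_avgOp_le _ hπ0 f).trans ?_
  have e3 : wip (gibbs G lam q) f (avgOp (gibbs G lam q) (fun v => agreeOff q {v}) f) =
      wip (gibbs G lam q) f f - 1 / n * S := by linarith
  rw [e3]
  have h2 : 1 / (2 * n) * wip (gibbs G lam q) f f ≤ K * S := by
    have h3 : 1 / n * ∑ v, wip (gibbs G lam q)
        (f - condAvg (gibbs G lam q) (agreeOff q (B v)) f)
        (f - condAvg (gibbs G lam q) (agreeOff q (B v)) f) ≤ K * S := by
      refine (mul_le_mul_of_nonneg_left h1 (by positivity)).trans (le_of_eq ?_)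
      field_simp
    linarith
  have h4 : 1 / (8 * m * (q ^ m * lam ^ (Δ * m)) * n ^ 2) * wip (gibbs G lam q) f f ≤
      1 / n * S := by
    have : 1 / (8 * m * (q ^ m * lam ^ (Δ * m)) * n ^ 2) * wip (gibbs G lam q) f f =
        1 / (K * n) * (1 / (2 * n) * wip (gibbs G lam q) f f) := by
      rw [hK]; field_simp; ring
    rw [this]
    refine (mul_le_mul_of_nonneg_left h2 (by positivity)).trans (le_of_eq ?_)
    field_simp
  linarith

lemma one_div_gibbs_le (hlam : 1 ≤ lam) (hq : 0 < q) {Δ : ℕ} (hdeg : ∀ v, G.degree v ≤ Δ)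
    (σ : V → Fin q) : 1 / gibbs G lam q σ ≤ ((q : ℝ) * lam ^ Δ) ^ Fintype.card V := by
  have hlam0 : 0 < lam := zero_lt_one.trans_le hlam
  have h := gibbs_class_le G hlam hq hdeg univ σ
  have e : univ.filter (fun τ => agreeOff q univ σ τ) = univ :=
    filter_true_of_mem fun τ _ v hv => absurd (mem_univ v) hv
  rw [e, sum_gibbs G hlam0 hq, card_univ] at h
  rwa [div_le_iff₀ (gibbs_pos G hlam0 hq σ), mul_pow, ← pow_mul]

end Gibbs

/-! ### Polynomial mixing time -/

section Rapid

open Finset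

lemma mixingTime_le {Ω : Type*} [Fintype Ω] [DecidableEq Ω] {P : Matrix Ω Ω ℝ} {π : Ω → ℝ}
    {ε : ℝ} {t : ℕ} (h : ∀ x, tvDist ((P ^ t) x) π ≤ ε) : mixingTime P π ε ≤ t :=
  iSup_le fun x => iInf₂_le t (h x)

variable {V : Type u} [Fintype V] [DecidableEq V] (G : SimpleGraph V) [DecidableRel G.Adj] {q : ℕ}
  {lam : ℝ}

lemma glauberMixingTime_le [Nonempty V] (hlam : 1 ≤ lam) (hq : 0 < q) {Δ : ℕ}
    (hdeg : ∀ v, G.degree v ≤ Δ) {κ : ℝ} (hκ0 : 0 < κ)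
    (hκ : 1 ≤ κ * (Fintype.card V : ℝ) ^ 2)
    (hgap : ∀ f : (V → Fin q) → ℝ, wip (gibbs G lam q) (fun _ => 1) f = 0 →
      wip (gibbs G lam q) ((glauber G lam q).mulVec f) ((glauber G lam q).mulVec f) ≤
        (1 - 1 / (κ * (Fintype.card V : ℝ) ^ 2)) * wip (gibbs G lam q) f f)
    {ε : ℝ} (hε : 0 < ε) (hε1 : ε < 1) :
    (glauberMixingTime G lam q ε : ℝ≥0∞) ≤
      ENNReal.ofReal ((κ * (Real.log (q * lam ^ Δ) + 2) + 1) * (Fintype.card V : ℝ) ^ 3 *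
        (1 + Real.log (1 / ε))) := by
  have hlam0 : 0 < lam := zero_lt_one.trans_le hlam
  have hn : (1 : ℝ) ≤ Fintype.card V := by exact_mod_cast Fintype.card_pos
  have hq1 : (1 : ℝ) ≤ q := by exact_mod_cast hq
  set n : ℝ := (Fintype.card V : ℝ) with hn'
  have hA : 1 ≤ (q : ℝ) * lam ^ Δ := one_le_mul_of_one_le_of_one_le hq1 (one_le_pow₀ hlam)
  set A := (q : ℝ) * lam ^ Δ with hA'
  have hlogA : 0 ≤ Real.log A := Real.log_nonneg hA
  set ℓ := Real.log (1 / ε) with hℓ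
  have hℓ0 : 0 ≤ ℓ := Real.log_nonneg (by rw [le_div_iff₀ hε]; linarith)
  -- At this time the gap gives decay `exp (-x / (κ n²)) = ε² / A^n`, and `A^n` bounds `1 / π σ`.
  -- Relaxation time `n²` times `log (1 / π σ)` of order `n` gives the exponent `3`.
  set x : ℝ := κ * n ^ 2 * (n * Real.log A + 2 * ℓ) with hx
  have hx0 : 0 ≤ x := by positivity
  set t := ⌈x⌉₊ with ht
  have ht1 : x ≤ t := Nat.le_ceil x
  have ht2 : (t : ℝ) ≤ x + 1 := (Nat.ceil_lt_add_one hx0).le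
  have hmix : glauberMixingTime G lam q ε ≤ t := by
    refine mixingTime_le fun σ => ?_
    have hρ : 0 ≤ 1 - 1 / (κ * n ^ 2) := by
      rw [sub_nonneg, div_le_one (by positivity)]
      exact hκ
    have h := tvDist_pow_le (gibbs_pos G hlam0 hq) (sum_gibbs G hlam0 hq)
      (glauber_reversible G hlam0 hq) (glauber_row_sum G hlam0 hq) hgap hρ t σ
    have h1 : (1 - 1 / (κ * n ^ 2)) ^ t ≤ Real.exp (-(n * Real.log A + 2 * ℓ)) := by
      calc (1 - 1 / (κ * n ^ 2)) ^ t ≤ Real.exp (-(1 / (κ * n ^ 2))) ^ t :=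
            pow_le_pow_left₀ hρ (Real.one_sub_le_exp_neg _) t
        _ = Real.exp (-(t / (κ * n ^ 2))) := by
            rw [← Real.exp_nat_mul]; congr 1; ring
        _ ≤ _ := by
            rw [Real.exp_le_exp, neg_le_neg_iff, le_div_iff₀ (by positivity)]
            calc _ = x := by rw [hx]; ring
              _ ≤ t := ht1
    have h2 : Real.exp (-(n * Real.log A + 2 * ℓ)) = ε ^ 2 / A ^ Fintype.card V := by
      rw [neg_add, Real.exp_add, Real.exp_neg, hn', ← Real.log_pow, Real.exp_log (by positivity),
        hℓ, one_div, Real.log_inv, mul_neg, neg_neg,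
        show 2 * Real.log ε = Real.log (ε ^ 2) by rw [Real.log_pow]; norm_num,
        Real.exp_log (by positivity)]
      field_simp
    have h3 := one_div_gibbs_le G hlam hq hdeg σ
    have h4 : 4 * tvDist ((glauber G lam q ^ t) σ) (gibbs G lam q) ^ 2 ≤ ε ^ 2 := by
      refine h.trans ?_
      rw [div_eq_mul_one_div]
      calc _ ≤ ε ^ 2 / A ^ Fintype.card V * A ^ Fintype.card V :=
            mul_le_mul (h1.trans h2.le) h3
              (div_nonneg zero_le_one (gibbs_pos G hlam0 hq σ).le) (by positivity)
        _ = ε ^ 2 := by field_simp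
    refine abs_le_of_sq_le_sq' ?_ hε.le |>.2
    nlinarith [sq_nonneg (tvDist ((glauber G lam q ^ t) σ) (gibbs G lam q))]
  calc (glauberMixingTime G lam q ε : ℝ≥0∞) ≤ ((t : ℕ∞) : ℝ≥0∞) :=
        ENat.toENNReal_le.2 hmix
    _ = ENNReal.ofReal t := by simp
    _ ≤ _ := by
        refine ENNReal.ofReal_le_ofReal (ht2.trans ?_)
        rw [hx]
        have hn3 : n ^ 2 ≤ n ^ 3 := pow_le_pow_right₀ hn (by norm_num)
        have hn3' : 1 ≤ n ^ 3 := one_le_pow₀ hn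
        have e1 : κ * n ^ 2 * (2 * ℓ) ≤ κ * n ^ 3 * (2 * ℓ) :=
          mul_le_mul_of_nonneg_right (mul_le_mul_of_nonneg_left hn3 hκ0.le) (by positivity)
        have e2 : 0 ≤ κ * n ^ 3 * Real.log A * ℓ := by positivity
        have e3 : 0 ≤ κ * n ^ 3 := by positivity
        have e4 : 0 ≤ n ^ 3 * ℓ := by positivity
        nlinarith

/-- Rapid mixing for many colours on connected graphs of bounded degree. -/
theorem mixesRapidlyOn_of_lt {Δ : ℕ} (hΔ : 1 ≤ Δ) {m : ℕ} (hm : 1 ≤ m) {η : ℝ} (hη : 0 ≤ η)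
    (hmη : 1 ≤ η * m) (hlam : 1 ≤ lam)
    (hq : 8 * 2 ^ m * Δ * m * lam ^ ((Δ : ℝ) - 1 + η) < (q : ℝ)) :
    MixesRapidlyOn.{u} lam q (ConnectedMaxDegree Δ) := by
  classical
  have hlam0 : 0 < lam := zero_lt_one.trans_le hlam
  have hm1 : (1 : ℝ) ≤ m := by exact_mod_cast hm
  have hΔ1 : (1 : ℝ) ≤ Δ := by exact_mod_cast hΔ
  -- Chosen so that, with `θ = 1 / c` and marginals at most `ϑ = 2 ^ m / c`, the condition `8 * ϑ *
  -- (Δ * m) ≤ 1` holds with equality.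
  set c : ℝ := 8 * 2 ^ m * Δ * m with hc
  have hc1 : 1 ≤ c := by
    have : (1 : ℝ) ≤ 2 ^ m := one_le_pow₀ (by norm_num)
    have h1 : (1 : ℝ) ≤ 8 * 2 ^ m := by linarith
    exact one_le_mul_of_one_le_of_one_le (one_le_mul_of_one_le_of_one_le h1 hΔ1) hm1
  have hc0 : 0 < c := zero_lt_one.trans_le hc1
  have hq0' : (0 : ℝ) < q := lt_trans (by positivity) hq
  have hq0 : 0 < q := by exact_mod_cast hq0'
  have hΔcast : ((Δ - 1 : ℕ) : ℝ) = (Δ : ℝ) - 1 := by rw [Nat.cast_sub hΔ, Nat.cast_one]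
  have h1 : lam ^ (Δ - 1) ≤ 1 / c * q := by
    rw [one_div, inv_mul_eq_div, le_div_iff₀ hc0, mul_comm]
    refine le_trans (mul_le_mul_of_nonneg_left ?_ hc0.le) hq.le
    rw [← Real.rpow_natCast, hΔcast]
    exact Real.rpow_le_rpow_of_exponent_le hlam (by linarith)
  -- The exponent `+ 1` is absorbed by `η * m ≥ 1`, the only place where the size of the block
  -- matters.
  have h2 : lam ^ ((Δ - 1) * m + 1) ≤ 1 / c * q ^ m := by
    rw [one_div, inv_mul_eq_div, le_div_iff₀ hc0, mul_comm]
    calc c * lam ^ ((Δ - 1) * m + 1) ≤ c ^ m * (lam ^ ((Δ : ℝ) - 1 + η)) ^ m := by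
          refine mul_le_mul (le_self_pow₀ hc1 (by omega)) ?_ (by positivity) (by positivity)
          rw [← Real.rpow_natCast, ← Real.rpow_natCast, ← Real.rpow_mul hlam0.le]
          refine Real.rpow_le_rpow_of_exponent_le hlam ?_
          rw [Nat.cast_add, Nat.cast_mul, hΔcast]
          push_cast
          linarith
      _ = (c * lam ^ ((Δ : ℝ) - 1 + η)) ^ m := (mul_pow _ _ _).symm
      _ ≤ _ := pow_le_pow_left₀ (by positivity) hq.le m
  refine ⟨8 * m * (q ^ m * lam ^ (Δ * m)) * (Real.log (q * lam ^ Δ) + 2) + 1, 3, ?_⟩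
  intro V _ G hG ε hε hε1
  obtain ⟨hconn, hmax⟩ := hG
  have hdeg : ∀ v, G.degree v ≤ Δ := fun v => (G.degree_le_maxDegree v).trans (by convert hmax)
  have : Nonempty V := hconn.nonempty
  have hblock : ∀ v : V, ∃ B : Finset V, B.card ≤ m ∧ ∀ f : (V → Fin q) → ℝ,
      ∑ x, osc (condAvg (gibbs G lam q) (agreeOff q B) f) x ≤
        ∑ x, osc f x - 1 / 2 * osc f v := by
    intro v
    by_cases hmn : m ≤ Fintype.card V
    · obtain ⟨B, hB, hvB, hcard⟩ := exists_connSet_card hconn v hm hmn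
      refine ⟨B, hcard.le, fun f => ?_⟩
      rw [condAvg_gibbs G hlam0 hq0]
      refine (sum_osc_condAvg_le G hlam hdeg (ϑ := 2 ^ B.card * (1 / c)) (by positivity) ?_ ?_
        f).trans ?_
      · rw [hcard]
        apply le_of_eq
        have : c ≠ 0 := hc0.ne'
        field_simp
        rw [hc]
      · intro σ u hu a
        exact marginal_le G hlam hq0 hΔ hdeg hB (by rw [div_le_one hc0]; exact hc1) h1
          (by rw [hcard]; exact h2) σ hu a
      · have := single_le_sum (fun x _ => osc_nonneg f x) hvB
        linarith
    -- With fewer than `m` vertices the whole graph is the block, and resampling it leaves no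
    -- oscillation.
    · refine ⟨univ, by rw [card_univ]; omega, fun f => ?_⟩
      rw [sum_osc_condAvg_univ]
      have h3 := single_le_sum (fun x _ => osc_nonneg f x) (mem_univ v)
      have h4 := osc_nonneg f v
      linarith
  choose B hBm hB using hblock
  have hn : (1 : ℝ) ≤ Fintype.card V := by exact_mod_cast Fintype.card_pos
  have hq1 : (1 : ℝ) ≤ q := by exact_mod_cast hq0
  have hκ : 1 ≤ 8 * m * ((q : ℝ) ^ m * lam ^ (Δ * m)) :=
    one_le_mul_of_one_le_of_one_le (by linarith)
      (one_le_mul_of_one_le_of_one_le (one_le_pow₀ hq1) (one_le_pow₀ hlam))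
  have h := glauberMixingTime_le G hlam hq0 hdeg (κ := 8 * m * ((q : ℝ) ^ m * lam ^ (Δ * m)))
    (by linarith) (one_le_mul_of_one_le_of_one_le hκ (one_le_pow₀ hn))
    (glauber_gap G hlam hq0 hdeg hm B hBm hB) hε hε1
  convert h

end Rapid

/-! ### Lower bounds on mixing times from bottlenecks -/

section Bottleneck

open Finset

variable {Ω : Type*} [Fintype Ω] [DecidableEq Ω] {P : Matrix Ω Ω ℝ} {π : Ω → ℝ}

lemma sum_sub_le_tvDist {φ ψ : Ω → ℝ} (h : ∑ x, φ x = ∑ x, ψ x) (S : Finset Ω) :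
    ∑ x ∈ S, (ψ x - φ x) ≤ tvDist φ ψ := by
  have h1 := sum_add_sum_compl S fun x => ψ x - φ x
  rw [sum_sub_distrib (s := univ), h, sub_self] at h1
  have h2 := sum_add_sum_compl S fun x => |φ x - ψ x|
  have h3 : ∑ x ∈ S, (ψ x - φ x) ≤ ∑ x ∈ S, |φ x - ψ x| :=
    sum_le_sum fun x _ => by rw [abs_sub_comm]; exact le_abs_self _
  have h4 : -∑ x ∈ Sᶜ, (ψ x - φ x) ≤ ∑ x ∈ Sᶜ, |φ x - ψ x| := by
    rw [← sum_neg_distrib]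
    exact sum_le_sum fun x _ => by rw [neg_sub]; exact le_abs_self _
  unfold tvDist
  linarith

lemma pow_nonneg_apply (hP : ∀ x y, 0 ≤ P x y) (t : ℕ) (x y : Ω) : 0 ≤ (P ^ t) x y := by
  induction t generalizing y with
  | zero => rw [pow_zero, Matrix.one_apply]; split_ifs <;> simp
  | succ t ih =>
    rw [pow_succ, Matrix.mul_apply]
    exact sum_nonneg fun z _ => mul_nonneg (ih z) (hP z y)

lemma pow_row_sum (hrow : ∀ x, ∑ y, P x y = 1) (t : ℕ) (x : Ω) : ∑ y, (P ^ t) x y = 1 := by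
  induction t with
  | zero => simp [Matrix.one_apply]
  | succ t ih =>
    simp only [pow_succ, Matrix.mul_apply]
    rw [sum_comm]
    simp only [← mul_sum, hrow, mul_one, ih]

lemma tvDist_pow_succ_le (hP : ∀ x y, 0 ≤ P x y) (hrow : ∀ x, ∑ y, P x y = 1)
    (hstat : ∀ y, ∑ x, π x * P x y = π y) (t : ℕ) (x : Ω) :
    tvDist ((P ^ (t + 1)) x) π ≤ tvDist ((P ^ t) x) π := by
  refine mul_le_mul_of_nonneg_left ?_ (by norm_num)
  calc ∑ y, |(P ^ (t + 1)) x y - π y| = ∑ y, |∑ z, ((P ^ t) x z - π z) * P z y| := by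
        refine sum_congr rfl fun y _ => ?_
        rw [pow_succ, Matrix.mul_apply]
        simp only [sub_mul, sum_sub_distrib, hstat]
    _ ≤ ∑ y, ∑ z, |(P ^ t) x z - π z| * P z y := by
        refine sum_le_sum fun y _ => (abs_sum_le_sum_abs _ _).trans (le_of_eq ?_)
        refine sum_congr rfl fun z _ => ?_
        rw [abs_mul, abs_of_nonneg (hP z y)]
    _ = _ := by
        rw [sum_comm]
        simp only [← mul_sum, hrow, mul_one]

lemma tvDist_pow_antitone (hP : ∀ x y, 0 ≤ P x y) (hrow : ∀ x, ∑ y, P x y = 1)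
    (hstat : ∀ y, ∑ x, π x * P x y = π y) (x : Ω) :
    Antitone fun t => tvDist ((P ^ t) x) π :=
  antitone_nat_of_succ_le fun t => tvDist_pow_succ_le hP hrow hstat t x

/-- A set of mass at most one half that can only be left through a small subset is a bottleneck. -/
theorem bottleneck_le (hP : ∀ x y, 0 ≤ P x y) (hrow : ∀ x, ∑ y, P x y = 1)
    (hstat : ∀ y, ∑ x, π x * P x y = π y) (hπ : ∀ x, 0 ≤ π x) (hsum : ∑ x, π x = 1)
    (A D : Finset Ω) (hexit : ∀ x ∈ A, x ∉ D → ∀ y, y ∉ A → P x y = 0)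
    (hA : ∑ x ∈ A, π x ≤ 1 / 2) {ε : ℝ} {t : ℕ} (ht : ∀ x, tvDist ((P ^ t) x) π ≤ ε) :
    (1 / 2 - ε) * ∑ x ∈ A, π x ≤ t * ∑ x ∈ D, π x := by
  -- The chain started from `π` restricted to `A`. It stays below the stationary `π`, so each step
  -- moves at most the mass of `D` out of `A`.
  set u : ℕ → Ω → ℝ := fun t y => ∑ x ∈ A, π x * (P ^ t) x y with hu
  have hu0 : ∀ t y, 0 ≤ u t y := fun t y =>
    sum_nonneg fun x _ => mul_nonneg (hπ x) (pow_nonneg_apply hP t x y)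
  have hus : ∀ t y, u (t + 1) y = ∑ z, u t z * P z y := by
    intro t y
    simp only [hu, pow_succ, Matrix.mul_apply, mul_sum, sum_mul]
    rw [sum_comm]
    exact sum_congr rfl fun z _ => sum_congr rfl fun x _ => by ring
  have hule : ∀ t y, u t y ≤ π y := by
    intro t
    induction t with
    | zero =>
      intro y
      simp only [hu, pow_zero, Matrix.one_apply, mul_ite, mul_one, mul_zero, sum_ite_eq']
      split_ifs
      · exact le_rfl
      · exact hπ y
    | succ t ih =>
      intro y
      rw [hus, ← hstat y]
      exact sum_le_sum fun z _ => mul_le_mul_of_nonneg_right (ih z) (hP z y)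
  have hD0 : 0 ≤ ∑ x ∈ D, π x := sum_nonneg fun x _ => hπ x
  have hm : ∀ t : ℕ, ∑ y ∈ Aᶜ, u t y ≤ t * ∑ x ∈ D, π x := by
    intro t
    induction t with
    | zero =>
      simp only [Nat.cast_zero, zero_mul]
      refine le_of_eq (sum_eq_zero fun y hy => ?_)
      simp only [hu, pow_zero, Matrix.one_apply, mul_ite, mul_one, mul_zero, sum_ite_eq']
      rw [if_neg (mem_compl.1 hy)]
    | succ t ih =>
      have hz : ∀ z, ∑ y ∈ Aᶜ, u t z * P z y ≤
          (if z ∈ Aᶜ then u t z else 0) + if z ∈ D then π z else 0 := by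
        intro z
        have h1 : ∑ y ∈ Aᶜ, P z y ≤ 1 := by
          rw [← hrow z]
          exact sum_le_sum_of_subset_of_nonneg (subset_univ _) fun y _ _ => hP z y
        have h2 : ∑ y ∈ Aᶜ, u t z * P z y ≤ u t z := by
          rw [← mul_sum]
          exact mul_le_of_le_one_right (hu0 t z) h1
        have h3 : (0 : ℝ) ≤ if z ∈ D then π z else 0 := by split_ifs; exacts [hπ z, le_rfl]
        by_cases hzA : z ∈ Aᶜ
        · rw [if_pos hzA]; linarith
        · rw [if_neg hzA, zero_add]
          by_cases hzD : z ∈ D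
          · rw [if_pos hzD]; exact h2.trans (hule t z)
          · rw [if_neg hzD]
            refine le_of_eq (sum_eq_zero fun y hy => ?_)
            rw [hexit z (by simpa using hzA) hzD y (mem_compl.1 hy), mul_zero]
      calc ∑ y ∈ Aᶜ, u (t + 1) y = ∑ z, ∑ y ∈ Aᶜ, u t z * P z y := by
            simp only [hus]; exact sum_comm
        _ ≤ ∑ z, ((if z ∈ Aᶜ then u t z else 0) + if z ∈ D then π z else 0) :=
            sum_le_sum fun z _ => hz z
        _ = ∑ z ∈ Aᶜ, u t z + ∑ z ∈ D, π z := by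
            rw [sum_add_distrib, sum_ite_mem, sum_ite_mem, univ_inter, univ_inter]
        _ ≤ _ := by push_cast; linarith
  refine le_trans ?_ (hm t)
  -- The complement of `A` has stationary mass at least `1 / 2`, so a mixed chain must put nearly
  -- that much there.
  have hx : ∀ x, 1 / 2 - ε ≤ ∑ y ∈ Aᶜ, (P ^ t) x y := by
    intro x
    have h1 := sum_sub_le_tvDist (φ := (P ^ t) x) (ψ := π)
      ((pow_row_sum hrow t x).trans hsum.symm) Aᶜ
    have h2 := sum_add_sum_compl A π
    rw [sum_sub_distrib] at h1
    have := ht x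
    linarith
  calc (1 / 2 - ε) * ∑ x ∈ A, π x = ∑ x ∈ A, π x * (1 / 2 - ε) := by rw [mul_comm, sum_mul]
    _ ≤ ∑ x ∈ A, π x * ∑ y ∈ Aᶜ, (P ^ t) x y :=
        sum_le_sum fun x _ => mul_le_mul_of_nonneg_left (hx x) (hπ x)
    _ = _ := by
        simp only [mul_sum, hu]
        exact sum_comm

/-- Each starting point has its own first time of being `ε`-close. Since the distance to `π` never
increases, all of them are close at the largest of these times. -/
lemma le_mixingTime (hP : ∀ x y, 0 ≤ P x y) (hrow : ∀ x, ∑ y, P x y = 1)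
    (hstat : ∀ y, ∑ x, π x * P x y = π y) {ε b : ℝ}
    (h : ∀ t : ℕ, (∀ x, tvDist ((P ^ t) x) π ≤ ε) → b ≤ t) :
    ENNReal.ofReal b ≤ (mixingTime P π ε : ℝ≥0∞) := by
  rcases eq_or_ne (mixingTime P π ε) ⊤ with htop | htop
  · rw [htop]; simp
  · obtain ⟨T, hT⟩ := ENat.ne_top_iff_exists.1 htop
    rw [← hT]
    have hb : b ≤ T := by
      refine h T fun x => ?_
      have h1 : mixingTimeFrom P π ε x ≤ T := by
        rw [hT]; exact le_iSup (fun x => mixingTimeFrom P π ε x) x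
      have h2 : mixingTimeFrom P π ε x < ((T + 1 : ℕ) : ℕ∞) :=
        lt_of_le_of_lt h1 (by exact_mod_cast Nat.lt_succ_self T)
      simp only [mixingTimeFrom, iInf_lt_iff] at h2
      obtain ⟨t, ht, htT⟩ := h2
      have htT' : t ≤ T := by
        have : t < T + 1 := by exact_mod_cast htT
        omega
      exact (tvDist_pow_antitone hP hrow hstat x htT').trans ht
    calc ENNReal.ofReal b ≤ ENNReal.ofReal T := ENNReal.ofReal_le_ofReal hb
      _ = _ := by simp

end Bottleneck

/-! ### The majority phase of one colour -/

section Majority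

open Finset Function

variable {V : Type u} [Fintype V] [DecidableEq V] (G : SimpleGraph V) [DecidableRel G.Adj] {q : ℕ}
  {lam : ℝ}

lemma glauber_stationary [Nonempty V] (hlam : 0 < lam) (hq : 0 < q) (τ : V → Fin q) :
    ∑ σ, gibbs G lam q σ * glauber G lam q σ τ = gibbs G lam q τ := by
  simp only [glauber_reversible G hlam hq _ τ]
  rw [← mul_sum, glauber_row_sum G hlam hq, mul_one]

lemma monoEdges_comp {V : Type*} [Fintype V] (G : SimpleGraph V) [DecidableRel G.Adj]
    (σ : V → Fin q) (e : Equiv.Perm (Fin q)) :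
    monoEdges G (e ∘ σ) = monoEdges G σ := by
  unfold monoEdges
  congr 1
  refine filter_congr fun s _ => ?_
  induction s with
  | h x y => simp [Sym2.map_mk, Sym2.mk_isDiag_iff]

/-- The vertices whose colour differs from `c`. -/
def offColour (c : Fin q) (σ : V → Fin q) : Finset V := univ.filter fun v => σ v ≠ c

/-- Exchanging `c` and `d` preserves the Gibbs measure and maps the set to its analogue for `d`. The
two are disjoint, as a common element would give `Fintype.card V ≤ 2 * k`. -/
lemma sum_gibbs_majority_le (hlam : 0 < lam) {c d : Fin q} (hcd : c ≠ d) {k : ℕ}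
    (hk : 2 * k < Fintype.card V) :
    ∑ σ ∈ univ.filter (fun σ : V → Fin q => (offColour c σ).card ≤ k), gibbs G lam q σ ≤
      1 / 2 := by
  have hq : 0 < q := c.pos
  set A := univ.filter (fun σ : V → Fin q => (offColour c σ).card ≤ k) with hA
  set A' := univ.filter (fun σ : V → Fin q => (offColour d σ).card ≤ k) with hA'
  have hoff : ∀ σ : V → Fin q, offColour d (Equiv.swap c d ∘ σ) = offColour c σ := by
    intro σ
    refine filter_congr fun v _ => not_congr ?_
    rw [comp_apply, Equiv.swap_apply_eq_iff, Equiv.swap_apply_right]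
  have hinv : ∀ σ : V → Fin q, Equiv.swap c d ∘ (Equiv.swap c d ∘ σ) = σ := by
    intro σ; funext v; simp
  have heq : ∑ σ ∈ A, gibbs G lam q σ = ∑ σ ∈ A', gibbs G lam q σ := by
    refine sum_bij' (fun σ _ => Equiv.swap c d ∘ σ) (fun σ _ => Equiv.swap c d ∘ σ) ?_ ?_ ?_ ?_ ?_
    · intro σ hσ
      simpa [hA', hoff] using (mem_filter.1 hσ).2
    · intro σ hσ
      have := hoff (Equiv.swap c d ∘ σ)
      rw [hinv] at this
      simpa [hA, ← this] using (mem_filter.1 hσ).2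
    · exact fun σ _ => hinv σ
    · exact fun σ _ => hinv σ
    · intro σ _
      rw [gibbs, gibbs, monoEdges_comp]
  have hdisj : Disjoint A A' := by
    rw [disjoint_left]
    intro σ h1 h2
    have h1 := (mem_filter.1 h1).2
    have h2 := (mem_filter.1 h2).2
    have h3 : (univ : Finset V) ⊆ offColour c σ ∪ offColour d σ := by
      intro v _
      simp only [offColour, mem_union, mem_filter, mem_univ, true_and]
      by_contra! h
      exact hcd (h.1.symm.trans h.2)
    have := (card_le_card h3).trans (card_union_le _ _)
    rw [card_univ] at this
    omega
  have h1 : ∑ σ ∈ A ∪ A', gibbs G lam q σ ≤ 1 := by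
    rw [← sum_gibbs G hlam hq]
    exact sum_le_sum_of_subset_of_nonneg (subset_univ _) fun σ _ _ => (gibbs_pos G hlam hq σ).le
  rw [sum_union hdisj, ← heq] at h1
  linarith

/-- Slow mixing from a bound on the weight of the configurations with exactly `k` vertices not of
a given colour. -/
lemma le_glauberMixingTime [Nonempty V] (hlam : 0 < lam) {c d : Fin q} (hcd : c ≠ d) {k : ℕ}
    (hk : 2 * k < Fintype.card V) {β : ℝ} (hβ : 0 < β)
    (hbd : ∑ σ ∈ univ.filter (fun σ : V → Fin q => (offColour c σ).card = k),
      lam ^ monoEdges G σ ≤ β * lam ^ G.edgeFinset.card) {ε : ℝ} (hε : ε < 1 / 2) :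
    ENNReal.ofReal ((1 / 2 - ε) / β) ≤ (glauberMixingTime G lam q ε : ℝ≥0∞) := by
  have hq : 0 < q := c.pos
  have hπ0 := gibbs_pos G hlam hq
  have hZ := partitionFn_pos G hlam hq
  refine le_mixingTime (glauber_nonneg G hlam) (glauber_row_sum G hlam hq)
    (glauber_stationary G hlam hq) fun t ht => ?_
  set A := univ.filter (fun σ : V → Fin q => (offColour c σ).card ≤ k) with hA
  set D := univ.filter (fun σ : V → Fin q => (offColour c σ).card = k) with hD
  -- One update changes the number of vertices off colour `c` by at most one, so level `k` cannot be
  -- skipped.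
  have hexit : ∀ σ ∈ A, σ ∉ D → ∀ τ, τ ∉ A → glauber G lam q σ τ = 0 := by
    intro σ hσ hσD τ hτ
    have hσ' : (offColour c σ).card < k := by
      have h1 := (mem_filter.1 hσ).2
      have h2 : (offColour c σ).card ≠ k := fun h => hσD (mem_filter.2 ⟨mem_univ _, h⟩)
      omega
    unfold glauber
    refine sum_eq_zero fun v _ => mul_eq_zero_of_right _ (sum_eq_zero fun b _ => ?_)
    rw [if_neg, mul_zero]
    rintro rfl
    refine hτ (mem_filter.2 ⟨mem_univ _, ?_⟩)
    have hsub : offColour c (update σ v b) ⊆ insert v (offColour c σ) := by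
      intro w hw
      by_cases hwv : w = v
      · exact hwv ▸ mem_insert_self _ _
      · refine mem_insert_of_mem ?_
        simpa [offColour, update_of_ne hwv] using hw
    have := (card_le_card hsub).trans (card_insert_le _ _)
    omega
  have hbot := bottleneck_le (glauber_nonneg G hlam) (glauber_row_sum G hlam hq)
    (glauber_stationary G hlam hq) (fun σ => (hπ0 σ).le) (sum_gibbs G hlam hq) A D hexit
    (sum_gibbs_majority_le G hlam hcd hk) ht
  have hAlow : lam ^ G.edgeFinset.card / partitionFn G lam q ≤ ∑ σ ∈ A, gibbs G lam q σ := by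
    have hmem : (fun _ => c : V → Fin q) ∈ A := by simp [hA, offColour]
    have := single_le_sum (fun σ _ => (hπ0 σ).le) hmem
    refine le_trans (le_of_eq ?_) this
    rw [gibbs]
    congr 2
    unfold monoEdges
    rw [filter_true_of_mem]
    intro e _
    induction e with
    | h x y => simp [Sym2.map_mk, Sym2.mk_isDiag_iff]
  have hDup : ∑ σ ∈ D, gibbs G lam q σ ≤
      β * (lam ^ G.edgeFinset.card / partitionFn G lam q) := by
    simp only [gibbs]
    rw [← sum_div, ← mul_div_assoc]
    exact div_le_div_of_nonneg_right hbd hZ.le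
  set X := lam ^ G.edgeFinset.card / partitionFn G lam q with hX
  have hX0 : 0 < X := div_pos (pow_pos hlam _) hZ
  rw [div_le_iff₀ hβ]
  refine le_of_mul_le_mul_right ?_ hX0
  calc (1 / 2 - ε) * X ≤ (1 / 2 - ε) * ∑ σ ∈ A, gibbs G lam q σ :=
        mul_le_mul_of_nonneg_left hAlow (by linarith)
    _ ≤ t * ∑ σ ∈ D, gibbs G lam q σ := hbot
    _ ≤ t * (β * X) := mul_le_mul_of_nonneg_left hDup (Nat.cast_nonneg t)
    _ = _ := by ring

end Majority

/-! ### Weight of the boundary level on a locally sparse graph -/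

section Counting

open Finset Function

/-- Such functions are constant on the classes generated by `a ~ p a`. As `p` has no fixed point,
every class has at least two elements, so there are at most half as many classes as points. -/
lemma card_invariant_fun_le {α : Type*} [Fintype α] [DecidableEq α] (q : ℕ) (hq : 0 < q)
    (p : α → α) (hp : ∀ a, p a ≠ a) :
    (univ.filter fun f : α → Fin q => ∀ a, f (p a) = f a).card ≤ q ^ (Fintype.card α / 2) := by
  classical
  let s : Setoid α := Relation.EqvGen.setoid fun a b => p a = b
  have hps : ∀ a, (Quotient.mk s (p a)) = Quotient.mk s a := fun a =>
    (Quotient.sound (s := s) (Relation.EqvGen.rel a (p a) rfl)).symm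
  have hcard : 2 * Fintype.card (Quotient s) ≤ Fintype.card α := by
    rw [← card_univ, ← card_univ]
    refine mul_card_image_le_card_of_maps_to (f := Quotient.mk s) (fun a _ => mem_univ _) 2 ?_
    intro b _
    induction b using Quotient.inductionOn with
    | h a =>
      have : ({p a, a} : Finset α) ⊆ univ.filter fun x => Quotient.mk s x = Quotient.mk s a := by
        intro x hx
        rw [mem_insert, mem_singleton] at hx
        rcases hx with rfl | rfl
        · simp [hps]
        · simp
      have h2 := card_le_card this
      rwa [card_pair (hp a)] at h2
  have hlift : ∀ f : α → Fin q, (∀ a, f (p a) = f a) → ∀ a b, s a b → f a = f b := by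
    intro f hf a b hab
    induction hab with
    | rel a b h => rw [← h, hf]
    | refl => rfl
    | symm _ _ _ ih => exact ih.symm
    | trans _ _ _ _ _ ih1 ih2 => exact ih1.trans ih2
  have h1 : (univ.filter fun f : α → Fin q => ∀ a, f (p a) = f a).card ≤
      (univ : Finset (Quotient s → Fin q)).card := by
    refine card_le_card_of_surjOn (fun g a => g (Quotient.mk s a)) ?_
    intro f hf
    have hf' := (mem_filter.1 hf).2
    exact ⟨Quotient.lift f (hlift f hf'), mem_coe.2 (mem_univ _), rfl⟩
  refine h1.trans ?_
  rw [card_univ, Fintype.card_fun, Fintype.card_fin]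
  exact Nat.pow_le_pow_right hq (by omega)

variable {V : Type u} [Fintype V] [DecidableEq V] (G : SimpleGraph V) [DecidableRel G.Adj] {q : ℕ}
  {lam : ℝ}

/-- The edges inside a set of vertices. -/
def inner (S : Finset V) : Finset (Sym2 V) := G.edgeFinset.filter fun e => ∀ v ∈ e, v ∈ S

lemma mul_card_le_touch_add_inner {Δ : ℕ} (hdeg : ∀ v, G.degree v = Δ) (S : Finset V) :
    Δ * S.card ≤ (touch G S).card + (inner G S).card := by
  have h1 : Δ * S.card = ∑ v ∈ S, (G.edgeFinset.filter fun e => v ∈ e).card := by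
    rw [mul_comm, ← smul_eq_mul, ← sum_const]
    refine sum_congr rfl fun v _ => ?_
    rw [← hdeg v, ← SimpleGraph.card_incidenceFinset_eq_degree,
      SimpleGraph.incidenceFinset_eq_filter]
  have h2 : ∑ v ∈ S, (G.edgeFinset.filter fun e => v ∈ e).card =
      ∑ e ∈ G.edgeFinset, (S.filter fun v => v ∈ e).card :=
    sum_card_bipartiteAbove_eq_sum_card_bipartiteBelow fun v e => v ∈ e
  rw [h1, h2, touch, inner, card_filter, card_filter, ← sum_add_distrib]
  refine sum_le_sum fun e he => ?_
  induction e with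
  | h x y =>
    by_cases hx : x ∈ S <;> by_cases hy : y ∈ S
    · have : S.filter (fun v => v ∈ s(x, y)) ⊆ {x, y} := by
        intro v hv; simpa using (mem_filter.1 hv).2
      have h3 := (card_le_card this).trans card_le_two
      have h4 : ∃ v ∈ S, v ∈ s(x, y) := ⟨x, hx, by simp⟩
      rw [if_pos h4, if_pos (by simp [hx, hy])]
      exact h3
    · have : S.filter (fun v => v ∈ s(x, y)) ⊆ {x} := by
        intro v hv
        obtain ⟨h5, h6⟩ := mem_filter.1 hv
        rcases Sym2.mem_iff.1 h6 with rfl | rfl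
        · simp
        · exact absurd h5 hy
      have h3 := card_le_card this
      rw [card_singleton] at h3
      have h4 : ∃ v ∈ S, v ∈ s(x, y) := ⟨x, hx, by simp⟩
      rw [if_pos h4]
      omega
    · have : S.filter (fun v => v ∈ s(x, y)) ⊆ {y} := by
        intro v hv
        obtain ⟨h5, h6⟩ := mem_filter.1 hv
        rcases Sym2.mem_iff.1 h6 with rfl | rfl
        · exact absurd h5 hx
        · simp
      have h3 := card_le_card this
      rw [card_singleton] at h3
      have h4 : ∃ v ∈ S, v ∈ s(x, y) := ⟨y, hy, by simp⟩
      rw [if_pos h4]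
      omega
    · have : S.filter (fun v => v ∈ s(x, y)) = ∅ := by
        rw [filter_eq_empty_iff]
        intro v hv h6
        rcases Sym2.mem_iff.1 h6 with rfl | rfl
        · exact hx hv
        · exact hy hv
      rw [this]
      simp

/-- The vertices of colour different from `c` with a neighbour of the same colour. -/
def paired (c : Fin q) (σ : V → Fin q) : Finset V :=
  (offColour c σ).filter fun v => ∃ u, G.Adj v u ∧ σ u = σ v

/-- A monochromatic edge either avoids the `k` vertices off colour `c` or lies inside `paired`.
Sparsity is used twice: the `k` vertices meet at least `Δ * k - (k + r)` edges, and `paired` spans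
at most its size plus `r`. -/
lemma monoEdges_add_le {Δ : ℕ} (hΔ : 1 ≤ Δ) (hdeg : ∀ v, G.degree v = Δ) {k r : ℕ}
    (hexp : ∀ S : Finset V, S.card ≤ k → (inner G S).card ≤ S.card + r) (c : Fin q)
    (σ : V → Fin q) (hσ : (offColour c σ).card = k) :
    monoEdges G σ + (Δ - 1) * k ≤ G.edgeFinset.card + 2 * r + (paired G c σ).card := by
  have hsub : (G.edgeFinset.filter fun e => (e.map σ).IsDiag) ⊆
      (G.edgeFinset \ touch G (offColour c σ)) ∪ inner G (paired G c σ) := by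
    intro e he
    induction e with
    | h x y =>
      obtain ⟨h1, h2⟩ := mem_filter.1 he
      rw [Sym2.map_mk, Sym2.mk_isDiag_iff] at h2
      have hxy : G.Adj x y := SimpleGraph.mem_edgeFinset.1 h1
      by_cases hx : σ x = c
      · refine mem_union_left _ (mem_sdiff.2 ⟨h1, fun ht => ?_⟩)
        obtain ⟨_, v, hv, hve⟩ := mem_filter.1 ht
        have hvc := (mem_filter.1 hv).2
        rcases Sym2.mem_iff.1 hve with rfl | rfl
        · exact hvc hx
        · exact hvc (h2 ▸ hx)
      · refine mem_union_right _ (mem_filter.2 ⟨h1, fun v hv => ?_⟩)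
        rcases Sym2.mem_iff.1 hv with rfl | rfl
        · exact mem_filter.2 ⟨mem_filter.2 ⟨mem_univ _, hx⟩, y, hxy, h2.symm⟩
        · exact mem_filter.2 ⟨mem_filter.2 ⟨mem_univ _, h2 ▸ hx⟩, x, hxy.symm, h2⟩
  have h1 := (card_le_card hsub).trans (card_union_le _ _)
  have h2 : (touch G (offColour c σ)).card ≤ G.edgeFinset.card := card_filter_le _ _
  rw [card_sdiff_of_subset (show touch G (offColour c σ) ⊆ G.edgeFinset from
    filter_subset _ _)] at h1
  have h3 := mul_card_le_touch_add_inner G hdeg (offColour c σ)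
  have h4 := hexp (offColour c σ) hσ.le
  have h5 := hexp (paired G c σ) ((card_filter_le _ _).trans hσ.le)
  rw [hσ] at h3 h4
  have h6 : Δ * k = (Δ - 1) * k + k := by
    obtain ⟨d, rfl⟩ := Nat.exists_eq_add_of_le' hΔ
    rw [Nat.add_sub_cancel]
    ring
  change (filter _ _).card + _ ≤ _
  omega

/-- Choose for each vertex of `S'` a neighbour of its own colour, in one of `Δ ^ S'.card` ways; it
lies in `S'` again. Given the choice, the colouring of `S'` is invariant under a fixed-point-free
map, hence only about `√q` colours per vertex. -/
lemma card_paired_fiber_le (hq : 0 < q) {Δ : ℕ} (hdeg : ∀ v, G.degree v = Δ) (c : Fin q)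
    (S S' : Finset V) :
    (univ.filter fun σ : V → Fin q => offColour c σ = S ∧ paired G c σ = S').card ≤
      Δ ^ S'.card * (q ^ (S \ S').card * q ^ (S'.card / 2)) := by
  classical
  let Y : (S' → V) → Finset (V → Fin q) := fun p => univ.filter fun σ =>
    (∀ v, v ∉ S → σ v = c) ∧ (∀ v, p v ∈ S') ∧ ∀ v, σ (p v) = σ v
  have hcover : (univ.filter fun σ : V → Fin q => offColour c σ = S ∧ paired G c σ = S') ⊆
      (Fintype.piFinset fun v : S' => G.neighborFinset v).biUnion Y := by
    intro σ hσ
    obtain ⟨_, h1, h2⟩ := mem_filter.1 hσ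
    have h3 : ∀ v : S', ∃ u, G.Adj v u ∧ σ u = σ v := by
      rintro ⟨v, hv⟩
      rw [← h2] at hv
      exact (mem_filter.1 hv).2
    choose p hp1 hp2 using h3
    refine mem_biUnion.2 ⟨p, Fintype.mem_piFinset.2 fun v => by simpa using hp1 v,
      mem_filter.2 ⟨mem_univ _, fun v hv => ?_, fun v => ?_, hp2⟩⟩
    · by_contra h
      exact hv (h1 ▸ mem_filter.2 ⟨mem_univ _, h⟩)
    · have hmem : ∀ w, w ∈ S' ↔ w ∈ paired G c σ := fun w => by rw [h2]
      have hv := (hmem v).1 v.2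
      rw [hmem]
      have hvc := (mem_filter.1 (mem_filter.1 hv).1).2
      exact mem_filter.2 ⟨mem_filter.2 ⟨mem_univ _, by rw [hp2]; exact hvc⟩, v, (hp1 v).symm,
        (hp2 v).symm⟩
  have hY : ∀ p ∈ Fintype.piFinset fun v : S' => G.neighborFinset v,
      (Y p).card ≤ q ^ (S \ S').card * q ^ (S'.card / 2) := by
    intro p hp
    by_cases hpS : ∀ v, p v ∈ S'
    · let p' : S' → S' := fun v => ⟨p v, hpS v⟩
      have hp' : ∀ v, p' v ≠ v := by
        intro v h
        have h1 := (SimpleGraph.mem_neighborFinset _ _ _).1 (Fintype.mem_piFinset.1 hp v)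
        exact h1.ne (congrArg Subtype.val h).symm
      have h1 := card_invariant_fun_le q hq p' hp'
      rw [Fintype.card_coe] at h1
      have h2 : (Y p).card ≤ ((univ : Finset (↥(S \ S') → Fin q)) ×ˢ
          univ.filter fun f : S' → Fin q => ∀ a, f (p' a) = f a).card := by
        refine card_le_card_of_injOn (fun σ => (fun v => σ v, fun v => σ v)) ?_ ?_
        · intro σ hσ
          have := (mem_filter.1 hσ).2.2.2
          refine mem_coe.2 (mem_product.2 ⟨mem_univ _, mem_filter.2 ⟨mem_univ _, this⟩⟩)
        · intro σ hσ τ hτ h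
          obtain ⟨h3, h4⟩ := Prod.mk.inj h
          funext v
          by_cases hv' : v ∈ S'
          · exact congrFun h4 ⟨v, hv'⟩
          · by_cases hv : v ∈ S
            · exact congrFun h3 ⟨v, mem_sdiff.2 ⟨hv, hv'⟩⟩
            · rw [(mem_filter.1 hσ).2.1 v hv, (mem_filter.1 hτ).2.1 v hv]
      rw [card_product, card_univ, Fintype.card_fun, Fintype.card_fin, Fintype.card_coe] at h2
      exact h2.trans (Nat.mul_le_mul_left _ h1)
    · have : Y p = ∅ := filter_eq_empty_iff.2 fun σ _ h => hpS h.2.1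
      rw [this, card_empty]
      exact Nat.zero_le _
  refine (card_le_card hcover).trans (card_biUnion_le.trans ((sum_le_sum hY).trans ?_))
  rw [sum_const, Fintype.card_piFinset, smul_eq_mul]
  simp [hdeg]

/-- Weight of the configurations with exactly `k` vertices not of colour `c`, under sparsity of
the small vertex sets. -/
theorem boundary_weight_le (hlam : 1 ≤ lam) {Δ : ℕ} (hΔ : 1 ≤ Δ) (hdeg : ∀ v, G.degree v = Δ)
    {k r : ℕ} (hexp : ∀ S : Finset V, S.card ≤ k → (inner G S).card ≤ S.card + r) (c : Fin q) :
    (∑ σ ∈ univ.filter (fun σ : V → Fin q => (offColour c σ).card = k),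
      lam ^ monoEdges G σ) * lam ^ ((Δ - 1) * k) ≤
    lam ^ (G.edgeFinset.card + 2 * r) *
      ((Fintype.card V).choose k * (Δ * (lam * √q + q)) ^ k) := by
  classical
  have hlam0 : 0 < lam := zero_lt_one.trans_le hlam
  have hq : 0 < q := c.pos
  have hq1 : (1 : ℝ) ≤ q := by exact_mod_cast hq
  have hsq : (1 : ℝ) ≤ √q := by rw [Real.one_le_sqrt]; exact hq1
  have hΔ1 : (1 : ℝ) ≤ Δ := by exact_mod_cast hΔ
  set E := G.edgeFinset.card with hE
  let X : Finset V → Finset V → Finset (V → Fin q) := fun S S' =>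
    univ.filter fun σ => offColour c σ = S ∧ paired G c σ = S'
  have hcover : univ.filter (fun σ : V → Fin q => (offColour c σ).card = k) ⊆
      (powersetCard k univ).biUnion fun S => S.powerset.biUnion fun S' => X S S' := by
    intro σ hσ
    refine mem_biUnion.2 ⟨offColour c σ, mem_powersetCard.2 ⟨subset_univ _, (mem_filter.1 hσ).2⟩,
      mem_biUnion.2 ⟨paired G c σ, mem_powerset.2 (filter_subset _ _), ?_⟩⟩
    simp [X]
  have hX : ∀ S ∈ powersetCard k (univ : Finset V), ∀ S' ∈ S.powerset,
      ∑ σ ∈ X S S', lam ^ monoEdges G σ * lam ^ ((Δ - 1) * k) ≤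
        lam ^ (E + 2 * r) * (Δ ^ k * ((lam * √q) ^ S'.card * (q : ℝ) ^ (S.card - S'.card))) := by
    intro S hS S' hS'
    have hSk := (mem_powersetCard.1 hS).2
    have hS'S := mem_powerset.1 hS'
    have h1 : ∀ σ ∈ X S S', lam ^ monoEdges G σ * lam ^ ((Δ - 1) * k) ≤
        lam ^ (E + 2 * r) * lam ^ S'.card := by
      intro σ hσ
      obtain ⟨_, h1, h2⟩ := mem_filter.1 hσ
      have := monoEdges_add_le G hΔ hdeg hexp c σ (by rw [h1, hSk])
      rw [h2] at this
      rw [← pow_add, ← pow_add]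
      exact pow_le_pow_right₀ hlam this
    refine (sum_le_card_nsmul _ _ _ h1).trans ?_
    rw [nsmul_eq_mul]
    have h2 : ((X S S').card : ℝ) ≤ Δ ^ k * ((q : ℝ) ^ (S.card - S'.card) * √q ^ S'.card) := by
      have h3 := card_paired_fiber_le G hq hdeg c S S'
      have h4 : ((X S S').card : ℝ) ≤
          Δ ^ S'.card * (q ^ (S \ S').card * q ^ (S'.card / 2)) := by exact_mod_cast h3
      refine h4.trans ?_
      rw [card_sdiff_of_subset hS'S]
      refine mul_le_mul (pow_le_pow_right₀ hΔ1 ((card_le_card hS'S).trans hSk.le)) ?_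
        (by positivity) (by positivity)
      refine mul_le_mul_of_nonneg_left ?_ (by positivity)
      calc (q : ℝ) ^ (S'.card / 2) = √q ^ (2 * (S'.card / 2)) := by
            rw [pow_mul, Real.sq_sqrt (by positivity)]
        _ ≤ _ := pow_le_pow_right₀ hsq (by omega)
    calc ((X S S').card : ℝ) * (lam ^ (E + 2 * r) * lam ^ S'.card)
        ≤ Δ ^ k * ((q : ℝ) ^ (S.card - S'.card) * √q ^ S'.card) *
          (lam ^ (E + 2 * r) * lam ^ S'.card) := mul_le_mul_of_nonneg_right h2 (by positivity)
      _ = _ := by rw [mul_pow]; ring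
  rw [sum_mul]
  calc _ ≤ ∑ σ ∈ (powersetCard k univ).biUnion fun S => S.powerset.biUnion fun S' => X S S',
          lam ^ monoEdges G σ * lam ^ ((Δ - 1) * k) :=
        sum_le_sum_of_subset_of_nonneg hcover fun _ _ _ => by positivity
    _ ≤ ∑ S ∈ powersetCard k univ, ∑ S' ∈ S.powerset, lam ^ (E + 2 * r) *
          (Δ ^ k * ((lam * √q) ^ S'.card * (q : ℝ) ^ (S.card - S'.card))) := by
        refine (sum_biUnion_le _ _ fun _ => by positivity).trans (sum_le_sum fun S hS => ?_)
        exact (sum_biUnion_le _ _ fun _ => by positivity).trans (sum_le_sum (hX S hS))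
    -- Each vertex of `S` is either paired, with factor `lam * √q`, or unpaired, with factor `q`;
    -- summing over `S'` is the binomial theorem.
    _ = ∑ S ∈ powersetCard k (univ : Finset V), lam ^ (E + 2 * r) *
          (Δ ^ k * (lam * √q + q) ^ k) := by
        refine sum_congr rfl fun S hS => ?_
        rw [← mul_sum, ← mul_sum, sum_pow_mul_eq_add_pow, (mem_powersetCard.1 hS).2]
    _ = _ := by
        rw [sum_const, card_powersetCard, card_univ, nsmul_eq_mul, mul_pow]
        ring

end Counting

/-! ### Edge switchings in regular graphs -/

section Switching

open Finset Classical

variable {V : Type u} [Fintype V]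

lemma isRegularOfDegree_iff_card (G : SimpleGraph V) [G.LocallyFinite] (Δ : ℕ) :
    G.IsRegularOfDegree Δ ↔ ∀ v, (univ.filter fun w => G.Adj v w).card = Δ := by
  refine forall_congr' fun v => ?_
  rw [← SimpleGraph.card_neighborFinset_eq_degree]
  have : G.neighborFinset v = univ.filter fun w => G.Adj v w := by
    ext w; simp
  rw [this]

/-- The `Δ`-regular graphs containing a given set of edges. -/
noncomputable def regularContaining (Δ : ℕ) (M : Finset (Sym2 V)) : Finset (SimpleGraph V) :=
  univ.filter fun G => (∀ v, (univ.filter fun w => G.Adj v w).card = Δ) ∧ ∀ e ∈ M, e ∈ G.edgeSet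

lemma mem_regularContaining {Δ : ℕ} {M : Finset (Sym2 V)} {G : SimpleGraph V} :
    G ∈ regularContaining Δ M ↔
      (∀ v, (univ.filter fun w => G.Adj v w).card = Δ) ∧ ∀ e ∈ M, e ∈ G.edgeSet := by
  simp [regularContaining]

/-- Replace the edges `ab`, `cd` by `ac`, `bd`. -/
def switch (G : SimpleGraph V) (a b c d : V) (hac : a ≠ c) (hbd : b ≠ d) : SimpleGraph V where
  Adj x y := (G.Adj x y ∧ s(x, y) ≠ s(a, b) ∧ s(x, y) ≠ s(c, d)) ∨ s(x, y) = s(a, c) ∨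
    s(x, y) = s(b, d)
  symm := ⟨fun x y h => by rwa [Sym2.eq_swap, G.adj_comm]⟩
  loopless := ⟨fun x h => by
    rcases h with h | h | h
    · exact h.1.ne rfl
    · rw [Sym2.eq_iff] at h
      rcases h with h | h
      · exact hac (h.1.symm.trans h.2)
      · exact hac (h.2.symm.trans h.1)
    · rw [Sym2.eq_iff] at h
      rcases h with h | h
      · exact hbd (h.1.symm.trans h.2)
      · exact hbd (h.2.symm.trans h.1)⟩

lemma sum_ite_sym2_eq {u w : V} (h : u ≠ w) (x : V) :
    ∑ y, (if s(x, y) = s(u, w) then 1 else 0 : ℕ) =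
      (if x = u then 1 else 0) + if x = w then 1 else 0 := by
  by_cases hu : x = u
  · subst hu
    rw [if_pos rfl, if_neg h]
    have : ∀ y, s(x, y) = s(x, w) ↔ y = w := fun y => Sym2.congr_right
    simp only [this, sum_ite_eq', mem_univ, if_true]
  · by_cases hw : x = w
    · subst hw
      rw [if_pos rfl, if_neg hu]
      have : ∀ y, s(x, y) = s(u, x) ↔ y = u := fun y => by
        rw [Sym2.eq_swap (a := u), Sym2.congr_right]
      simp [this]
    · rw [if_neg hu, if_neg hw]
      refine sum_eq_zero fun y _ => if_neg ?_
      rw [Sym2.eq_iff]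
      rintro (h | h)
      · exact hu h.1
      · exact hw h.1

lemma card_switch_adj {G : SimpleGraph V} {a b c d : V} (hac : a ≠ c) (hbd : b ≠ d)
    (hab : G.Adj a b) (hcd : G.Adj c d) (hac' : ¬ G.Adj a c) (hbd' : ¬ G.Adj b d) (x : V) :
    (univ.filter fun y => (switch G a b c d hac hbd).Adj x y).card =
      (univ.filter fun y => G.Adj x y).card := by
  have hne1 : s(a, b) ≠ s(c, d) := by
    rw [Ne, Sym2.eq_iff]
    rintro (⟨h, _⟩ | ⟨h1, h2⟩)
    · exact hac h
    · exact hac' (h2 ▸ hab)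
  have hne2 : s(a, c) ≠ s(b, d) := by
    rw [Ne, Sym2.eq_iff]
    rintro (⟨h, _⟩ | ⟨h1, h2⟩)
    · exact hab.ne h
    · exact hac' (h2 ▸ hab)
  have hadj : ∀ {u w y : V}, s(x, y) = s(u, w) → (G.Adj x y ↔ G.Adj u w) := by
    intro u w y h
    rw [← SimpleGraph.mem_edgeSet, h, SimpleGraph.mem_edgeSet]
  -- Indicator form of the switching, written additively. Summed over `y`, the removed and the added
  -- edges both contribute one at each of `a`, `b`, `c`, `d`, so degrees do not change.
  have key : ∀ y, (if (switch G a b c d hac hbd).Adj x y then 1 else 0 : ℕ) +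
      ((if s(x, y) = s(a, b) then 1 else 0) + if s(x, y) = s(c, d) then 1 else 0) =
      (if G.Adj x y then 1 else 0) +
      ((if s(x, y) = s(a, c) then 1 else 0) + if s(x, y) = s(b, d) then 1 else 0) := by
    intro y
    simp only [switch]
    by_cases h1 : s(x, y) = s(a, b)
    · have h2 := (hadj h1).2 hab
      have h3 : s(x, y) ≠ s(a, c) := fun h => hac' ((hadj h).1 h2)
      have h4 : s(x, y) ≠ s(b, d) := fun h => hbd' ((hadj h).1 h2)
      have h5 : s(x, y) ≠ s(c, d) := h1 ▸ hne1
      simp [h1, h2, h1 ▸ h3, h1 ▸ h4, hne1]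
    · by_cases h2 : s(x, y) = s(c, d)
      · have h3 := (hadj h2).2 hcd
        have h4 : s(x, y) ≠ s(a, c) := fun h => hac' ((hadj h).1 h3)
        have h5 : s(x, y) ≠ s(b, d) := fun h => hbd' ((hadj h).1 h3)
        simp [h2, h3, h2 ▸ h4, h2 ▸ h5, hne1.symm]
      · by_cases h3 : s(x, y) = s(a, c)
        · have h4 : ¬ G.Adj x y := fun h => hac' ((hadj h3).1 h)
          have h5 : s(x, y) ≠ s(b, d) := h3 ▸ hne2
          simp [h3, h4, h3 ▸ h1, h3 ▸ h2, hne2]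
        · by_cases h4 : s(x, y) = s(b, d)
          · have h5 : ¬ G.Adj x y := fun h => hbd' ((hadj h4).1 h)
            simp [h4, h5, h4 ▸ h1, h4 ▸ h2, hne2.symm]
          · simp [h1, h2, h3, h4]
  have hsum := sum_congr rfl fun y (_ : y ∈ univ) => key y
  simp only [sum_add_distrib, sum_ite_sym2_eq hab.ne, sum_ite_sym2_eq hcd.ne,
    sum_ite_sym2_eq hac, sum_ite_sym2_eq hbd] at hsum
  rw [card_filter, card_filter]
  omega

/-- The original graph is recovered from the switched one and the four vertices, which gives
injectivity in the double count. -/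
lemma adj_iff_switch {V : Type*} {G : SimpleGraph V} {a b c d : V} (hac : a ≠ c) (hbd : b ≠ d)
    (hab : G.Adj a b) (hcd : G.Adj c d) (hac' : ¬ G.Adj a c) (hbd' : ¬ G.Adj b d) (x y : V) :
    G.Adj x y ↔ ((switch G a b c d hac hbd).Adj x y ∧ s(x, y) ≠ s(a, c) ∧ s(x, y) ≠ s(b, d)) ∨
      s(x, y) = s(a, b) ∨ s(x, y) = s(c, d) := by
  have e : ∀ {u w : V}, s(x, y) = s(u, w) → (G.Adj x y ↔ G.Adj u w) := by
    intro u w h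
    rw [← SimpleGraph.mem_edgeSet, h, SimpleGraph.mem_edgeSet]
  constructor
  · intro h
    by_cases h1 : s(x, y) = s(a, b)
    · exact Or.inr (Or.inl h1)
    by_cases h2 : s(x, y) = s(c, d)
    · exact Or.inr (Or.inr h2)
    exact Or.inl ⟨Or.inl ⟨h, h1, h2⟩, fun h' => hac' ((e h').1 h), fun h' => hbd' ((e h').1 h)⟩
  · rintro (⟨h | h | h, h1, h2⟩ | h | h)
    · exact h.1
    · exact absurd h h1
    · exact absurd h h2
    · exact (e h).2 hab
    · exact (e h).2 hcd

lemma card_pairs_sym2_mem_le (M : Finset (Sym2 V)) :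
    (univ.filter fun p : V × V => s(p.1, p.2) ∈ M).card ≤ 2 * M.card := by
  have h : (univ.filter fun p : V × V => s(p.1, p.2) ∈ M) ⊆
      M.biUnion fun e => univ.filter fun p : V × V => s(p.1, p.2) = e := by
    intro p hp
    exact mem_biUnion.2 ⟨_, (mem_filter.1 hp).2, mem_filter.2 ⟨mem_univ _, rfl⟩⟩
  refine (card_le_card h).trans (card_biUnion_le.trans ?_)
  rw [mul_comm, ← smul_eq_mul, ← sum_const]
  refine sum_le_sum fun e _ => ?_
  induction e with
  | h x y =>
    refine (card_le_card (t := {(x, y), (y, x)}) ?_).trans card_le_two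
    rintro ⟨c, d⟩ hp
    have := (mem_filter.1 hp).2
    rw [Sym2.eq_iff] at this
    rcases this with ⟨h1, h2⟩ | ⟨h1, h2⟩
    · simp only at h1 h2; subst h1; subst h2; simp
    · simp only at h1 h2; subst h1; subst h2; simp

variable {Δ : ℕ}

lemma card_adj_pairs {G : SimpleGraph V} (hG : ∀ v, (univ.filter fun w => G.Adj v w).card = Δ)
    (S : Finset V) : (univ.filter fun p : V × V => p.1 ∈ S ∧ G.Adj p.1 p.2).card = S.card * Δ := by
  rw [card_filter, Fintype.sum_prod_type]
  have : ∀ x, ∑ y, (if x ∈ S ∧ G.Adj x y then 1 else 0 : ℕ) = if x ∈ S then Δ else 0 := by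
    intro x
    by_cases hx : x ∈ S
    · simp only [hx, true_and, if_true]
      rw [← card_filter, hG]
    · simp [hx]
  simp only [this]
  rw [sum_ite_mem, univ_inter, sum_const, smul_eq_mul]

/-- The ordered edges `cd` available for a switching with `ab`. -/
noncomputable def switchable (G : SimpleGraph V) (M : Finset (Sym2 V)) (a b : V) :
    Finset (V × V) :=
  univ.filter fun p => G.Adj p.1 p.2 ∧ s(p.1, p.2) ∉ M ∧ (a ≠ p.1 ∧ ¬ G.Adj a p.1) ∧
    (b ≠ p.2 ∧ ¬ G.Adj b p.2)

/-- Of the ordered edges `cd`, exclude those in `M` (two orientations each), those with `c` in the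
closed neighbourhood of `a`, and those with `d` in that of `b`. -/
lemma card_switchable {G : SimpleGraph V} (hG : ∀ v, (univ.filter fun w => G.Adj v w).card = Δ)
    (M : Finset (Sym2 V)) (a b : V) :
    Fintype.card V * Δ ≤ (switchable G M a b).card + 2 * M.card + 2 * ((Δ + 1) * Δ) := by
  let N : V → Finset V := fun v => insert v (univ.filter fun w => G.Adj v w)
  have hN : ∀ v, (N v).card = Δ + 1 := fun v => by
    rw [card_insert_of_notMem (by simp), hG]
  let B : V → Finset (V × V) := fun v => univ.filter fun p => p.1 ∈ N v ∧ G.Adj p.1 p.2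
  have hB : ∀ v, (B v).card = (Δ + 1) * Δ := fun v => by rw [card_adj_pairs hG, hN]
  have hall : (univ.filter fun p : V × V => G.Adj p.1 p.2).card = Fintype.card V * Δ := by
    have := card_adj_pairs hG univ
    simpa using this
  have hsub : (univ.filter fun p : V × V => G.Adj p.1 p.2) ⊆
      ((switchable G M a b ∪ univ.filter fun p : V × V => s(p.1, p.2) ∈ M) ∪ B a) ∪
        (B b).image Prod.swap := by
    rintro ⟨c, d⟩ hp
    have hcd : G.Adj c d := (mem_filter.1 hp).2
    simp only [mem_union, mem_image, B, N, switchable, mem_filter, mem_univ, true_and,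
      mem_insert, Prod.exists, Prod.swap_prod_mk, Prod.mk.injEq]
    by_cases h1 : s(c, d) ∈ M
    · exact Or.inl (Or.inl (Or.inr h1))
    · by_cases h2 : c = a ∨ G.Adj a c
      · exact Or.inl (Or.inr ⟨h2, hcd⟩)
      · by_cases h3 : d = b ∨ G.Adj b d
        · exact Or.inr ⟨d, c, ⟨h3, hcd.symm⟩, rfl, rfl⟩
        · push Not at h2 h3
          exact Or.inl (Or.inl (Or.inl ⟨hcd, h1, ⟨h2.1.symm, h2.2⟩, h3.1.symm, h3.2⟩))
  have h := card_le_card hsub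
  have h1 := card_union_le ((switchable G M a b ∪ univ.filter fun p : V × V => s(p.1, p.2) ∈ M) ∪
    B a) ((B b).image Prod.swap)
  have h2 := card_union_le (switchable G M a b ∪ univ.filter fun p : V × V => s(p.1, p.2) ∈ M)
    (B a)
  have h3 := card_union_le (switchable G M a b) (univ.filter fun p : V × V => s(p.1, p.2) ∈ M)
  have h4 := card_pairs_sym2_mem_le M
  have h5 : ((B b).image Prod.swap).card ≤ (B b).card := card_image_le
  rw [hB] at h2 h5
  omega

/-- Double counting of switchings that destroy `e = ab` and keep `M`. A graph containing `e` admits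
nearly `nΔ` of them, whereas a resulting graph arises at most `Δ * Δ` times, because `c` is now a
neighbour of `a` and `d` of `b`. -/
lemma regularContaining_insert_le (M : Finset (Sym2 V)) {e : Sym2 V} (he : e ∉ M) :
    (regularContaining Δ (insert e M)).card * (Fintype.card V * Δ) ≤
      (regularContaining Δ (insert e M)).card * (2 * M.card + 2 * ((Δ + 1) * Δ)) +
        (regularContaining Δ M).card * (Δ * Δ) := by
  induction e with
  | h a b =>
  set N1 := regularContaining Δ (insert s(a, b) M) with hN1
  set N0 := regularContaining Δ M with hN0
  have h1 : ∀ G ∈ N1, (∀ v, (univ.filter fun w => G.Adj v w).card = Δ) ∧ G.Adj a b ∧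
      ∀ f ∈ M, f ∈ G.edgeSet := by
    intro G hG
    obtain ⟨_, h, h'⟩ := mem_filter.1 hG
    exact ⟨h, h' _ (mem_insert_self _ _), fun f hf => h' f (mem_insert_of_mem hf)⟩
  have hdouble : ∑ G ∈ N1, (switchable G M a b).card ≤ N0.card * (Δ * Δ) := by
    have hsrc : ∑ G ∈ N1, (switchable G M a b).card =
        (N1.sigma fun G => switchable G M a b).card := (card_sigma _ _).symm
    have htgt : N0.card * (Δ * Δ) = (N0.sigma fun G => (univ.filter fun w => G.Adj a w) ×ˢ
        (univ.filter fun w => G.Adj b w)).card := by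
      rw [card_sigma, ← smul_eq_mul, ← sum_const]
      refine sum_congr rfl fun G hG => ?_
      have hreg := (mem_filter.1 hG).2.1
      rw [card_product, hreg, hreg]
    rw [hsrc, htgt]
    have hsw : ∀ p ∈ N1.sigma fun G => switchable G M a b, a ≠ p.2.1 ∧ b ≠ p.2.2 := by
      intro p hp
      have := (mem_filter.1 (mem_sigma.1 hp).2).2
      exact ⟨this.2.2.1.1, this.2.2.2.1⟩
    let φ : (Σ _ : SimpleGraph V, V × V) → (Σ _ : SimpleGraph V, V × V) := fun p =>
      if h : a ≠ p.2.1 ∧ b ≠ p.2.2 then ⟨switch p.1 a b p.2.1 p.2.2 h.1 h.2, p.2⟩ else p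
    refine card_le_card_of_injOn φ ?_ ?_
    · rintro ⟨G, c, d⟩ hp
      have hne := hsw _ hp
      obtain ⟨hG, hcd⟩ := mem_sigma.1 hp
      obtain ⟨_, hadj, hM, ⟨_, hac⟩, ⟨_, hbd⟩⟩ := mem_filter.1 hcd
      obtain ⟨hreg, hab, hGM⟩ := h1 G hG
      simp only [φ, dif_pos hne]
      refine mem_coe.2 (mem_sigma.2 ⟨mem_filter.2 ⟨mem_univ _, fun v => ?_, fun f hf => ?_⟩,
        mem_product.2 ⟨mem_filter.2 ⟨mem_univ _, ?_⟩, mem_filter.2 ⟨mem_univ _, ?_⟩⟩⟩)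
      · rw [card_switch_adj hne.1 hne.2 hab hadj hac hbd, hreg]
      · have hf' := hGM f hf
        induction f with
        | h x y =>
          exact Or.inl ⟨hf', fun h => he (h ▸ hf), fun h => hM (h ▸ hf)⟩
      · exact Or.inr (Or.inl rfl)
      · exact Or.inr (Or.inr rfl)
    · rintro ⟨G, c, d⟩ hp ⟨G', c', d'⟩ hp' heq
      have hne := hsw _ hp
      have hne' := hsw _ hp'
      simp only [φ, dif_pos hne, dif_pos hne', Sigma.mk.injEq, heq_eq_eq, Prod.mk.injEq] at heq
      obtain ⟨h2, rfl, rfl⟩ := heq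
      have hGG : G = G' := by
        obtain ⟨hG, hcd⟩ := mem_sigma.1 hp
        obtain ⟨hG', hcd'⟩ := mem_sigma.1 hp'
        obtain ⟨_, hadj, _, ⟨_, hac⟩, ⟨_, hbd⟩⟩ := mem_filter.1 hcd
        obtain ⟨_, hadj', _, ⟨_, hac'⟩, ⟨_, hbd'⟩⟩ := mem_filter.1 hcd'
        ext x y
        rw [adj_iff_switch hne.1 hne.2 (h1 G hG).2.1 hadj hac hbd,
          adj_iff_switch hne.1 hne.2 (h1 G' hG').2.1 hadj' hac' hbd', h2]
      rw [hGG]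
  calc N1.card * (Fintype.card V * Δ)
      ≤ ∑ G ∈ N1, ((switchable G M a b).card + (2 * M.card + 2 * ((Δ + 1) * Δ))) := by
        rw [← smul_eq_mul, ← sum_const]
        refine sum_le_sum fun G hG => ?_
        have := card_switchable (h1 G hG).1 M a b
        omega
    _ = ∑ G ∈ N1, (switchable G M a b).card +
          N1.card * (2 * M.card + 2 * ((Δ + 1) * Δ)) := by
        rw [sum_add_distrib, sum_const, smul_eq_mul]
    _ ≤ _ := by omega

/-- A prescribed set of edges is unlikely to be contained in a random regular graph. -/
theorem card_regularContaining_le (hV : 0 < Fintype.card V) (hΔ : 0 < Δ) (M : Finset (Sym2 V))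
    (hM : 2 * (2 * M.card + 2 * ((Δ + 1) * Δ)) ≤ Fintype.card V * Δ) :
    ((regularContaining Δ M).card : ℝ) ≤
      (2 * Δ / Fintype.card V) ^ M.card * (regularContaining Δ (∅ : Finset (Sym2 V))).card := by
  have hV' : (0 : ℝ) < Fintype.card V := by exact_mod_cast hV
  have hΔ' : (0 : ℝ) < Δ := by exact_mod_cast hΔ
  induction M using Finset.induction_on with
  | empty => simp
  | insert e M he ih =>
    rw [card_insert_of_notMem he] at hM ⊢
    have ih := ih (by omega)
    have h1 := regularContaining_insert_le (Δ := Δ) M he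
    set x := (regularContaining Δ (insert e M)).card
    set y := (regularContaining Δ M).card
    set n := Fintype.card V
    have h2 : x * (n * Δ) ≤ 2 * (y * (Δ * Δ)) := by
      have h3 : x * (2 * (2 * M.card + 2 * ((Δ + 1) * Δ))) ≤ x * (n * Δ) :=
        Nat.mul_le_mul_left _ (by omega)
      have h4 : x * (2 * (2 * M.card + 2 * ((Δ + 1) * Δ))) =
        2 * (x * (2 * M.card + 2 * ((Δ + 1) * Δ))) := by ring
      omega
    have h3 : (x : ℝ) * (n * Δ) ≤ 2 * (y * (Δ * Δ)) := by exact_mod_cast h2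
    have h4 : (x : ℝ) ≤ 2 * Δ / n * y := by
      rw [div_mul_eq_mul_div, le_div_iff₀ hV']
      refine le_of_mul_le_mul_right ?_ hΔ'
      linarith
    rw [pow_succ', mul_assoc]
    exact h4.trans (mul_le_mul_of_nonneg_left ih (by positivity))

end Switching

/-! ### Existence of regular graphs -/

section Existence

open Finset Classical

/-- Connection set of a circulant graph. For odd `Δ` it must contain a self-inverse residue, so the
interval is centred at `n / 2`. -/
lemma exists_symmetric_nat_set {n Δ : ℕ} (hn : Δ < n) (he : Even (n * Δ)) :
    ∃ T : Finset ℕ, (∀ i ∈ T, 0 < i ∧ i < n ∧ n - i ∈ T) ∧ T.card = Δ := by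
  rcases Nat.even_or_odd Δ with ⟨h, hh⟩ | hΔ
  · refine ⟨Icc 1 h ∪ Icc (n - h) (n - 1), fun i hi => ?_, ?_⟩
    · simp only [mem_union, mem_Icc] at hi ⊢
      omega
    · rw [card_union_of_disjoint, Nat.card_Icc, Nat.card_Icc]
      · omega
      · rw [disjoint_left]
        intro i hi hi'
        rw [mem_Icc] at hi hi'
        omega
  · have hn2 : Even n := by
      rcases Nat.even_mul.1 he with h | h
      · exact h
      · exact absurd h (Nat.not_even_iff_odd.2 hΔ)
    obtain ⟨h, hh⟩ := hΔ
    obtain ⟨m, hm⟩ := hn2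
    refine ⟨Icc (m - h) (m + h), fun i hi => ?_, ?_⟩
    · rw [mem_Icc] at hi ⊢
      omega
    · rw [Nat.card_Icc]
      omega

lemma exists_regular_of_symmetric {V Γ : Type*} [Fintype V] [AddCommGroup Γ] (g : V → Γ)
    (hg : Function.Bijective g) (S : Finset Γ) (hneg : ∀ s ∈ S, -s ∈ S) (h0 : 0 ∉ S) :
    ∃ G : SimpleGraph V, ∀ v, (univ.filter fun w => G.Adj v w).card = S.card := by
  obtain ⟨G, hG⟩ : ∃ G : SimpleGraph V, ∀ x y, G.Adj x y ↔ g y - g x ∈ S :=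
    ⟨{ Adj := fun x y => g y - g x ∈ S
       symm := ⟨fun x y h => by simpa using hneg _ h⟩
       loopless := ⟨fun x h => h0 (by simpa using h)⟩ }, fun _ _ => Iff.rfl⟩
  refine ⟨G, fun v => ?_⟩
  refine card_bij (fun y _ => g y - g v) (fun y hy => (hG v y).1 (mem_filter.1 hy).2) ?_ ?_
  · intro y _ y' _ h
    exact hg.1 (sub_left_injective h)
  · intro s hs
    obtain ⟨y, hy⟩ := hg.2 (s + g v)
    have e : g y - g v = s := by rw [hy, add_sub_cancel_right]
    exact ⟨y, mem_filter.2 ⟨mem_univ _, (hG v y).2 (e.symm ▸ hs)⟩, e⟩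

/-- Ensures that the denominator in `AlmostAllRegular` is nonzero for large admissible `n`. The
witness is a Cayley graph of `ZMod n`. -/
lemma regularContaining_nonempty {n Δ : ℕ} (hn : Δ < n) (he : Even (n * Δ)) :
    (regularContaining Δ (∅ : Finset (Sym2 (Fin n)))).Nonempty := by
  obtain ⟨T, hT, hcard⟩ := exists_symmetric_nat_set hn he
  have : NeZero n := ⟨by omega⟩
  have hcast : ∀ {i j : ℕ}, i < n → j < n → (i : ZMod n) = j → i = j := by
    intro i j hi hj h
    rw [ZMod.natCast_eq_natCast_iff] at h
    exact Nat.ModEq.eq_of_lt_of_lt h hi hj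
  have hS : (T.image fun i : ℕ => (i : ZMod n)).card = Δ := by
    rw [card_image_of_injOn, hcard]
    intro i hi j hj h
    exact hcast (hT i hi).2.1 (hT j hj).2.1 h
  have hbij : Function.Bijective fun x : Fin n => ((x : ℕ) : ZMod n) := by
    rw [Fintype.bijective_iff_injective_and_card]
    exact ⟨fun x y h => Fin.ext (hcast x.2 y.2 h), by simp [ZMod.card]⟩
  obtain ⟨G, hG⟩ := exists_regular_of_symmetric _ hbij (T.image fun i : ℕ => (i : ZMod n))
    (fun s hs => by
      obtain ⟨i, hi, rfl⟩ := mem_image.1 hs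
      refine mem_image.2 ⟨n - i, (hT i hi).2.2, ?_⟩
      rw [Nat.cast_sub (hT i hi).2.1.le, ZMod.natCast_self, zero_sub])
    (fun h => by
      obtain ⟨i, hi, h⟩ := mem_image.1 h
      have := hcast (hT i hi).2.1 (by omega : 0 < n) (by simpa using h)
      have := (hT i hi).1
      omega)
  refine ⟨G, ?_⟩
  rw [mem_regularContaining]
  exact ⟨fun v => (hG v).trans hS, fun e he => absurd he (notMem_empty e)⟩

end Existence

/-! ### Random regular graphs have no small dense sets -/

section Sparsity

open Finset Classical

lemma choose_mul_pow_le_exp (n s : ℕ) {x : ℝ} (hx : 0 ≤ x) :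
    (n.choose s : ℝ) * x ^ s ≤ Real.exp (n * x) := by
  calc (n.choose s : ℝ) * x ^ s ≤ (x + 1) ^ n := by
        rw [add_pow]
        rcases le_or_gt s n with h | h
        · have := single_le_sum (f := fun m => x ^ m * 1 ^ (n - m) * (n.choose m : ℝ))
            (fun i _ => by positivity) (mem_range.2 (Nat.lt_succ_of_le h))
          simpa [mul_comm] using this
        · rw [Nat.choose_eq_zero_of_lt h, Nat.cast_zero, zero_mul]
          exact sum_nonneg fun i _ => by positivity
    _ ≤ Real.exp x ^ n := pow_le_pow_left₀ (by positivity) (Real.add_one_le_exp x) n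
    _ = _ := by rw [← Real.exp_nat_mul]

variable {V : Type u} [Fintype V]

/-- Some small vertex set spans more than `|S| + r` edges. -/
def HasDenseSet (k r : ℕ) (G : SimpleGraph V) : Prop :=
  ∃ S : Finset V, S.card ≤ k ∧ ∃ M ⊆ S.sym2, M.card = S.card + r + 1 ∧ ∀ e ∈ M, e ∈ G.edgeSet

lemma card_inner_le_of_not_hasDenseSet {k r : ℕ} {G : SimpleGraph V} [DecidableEq V]
    [DecidableRel G.Adj] (h : ¬ HasDenseSet k r G) (S : Finset V) (hS : S.card ≤ k) :
    (inner G S).card ≤ S.card + r := by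
  by_contra! hlt
  obtain ⟨M, hM, hcard⟩ := exists_subset_card_eq (Nat.succ_le_of_lt hlt)
  refine h ⟨S, hS, M, fun e he => ?_, hcard, fun e he => ?_⟩
  · rw [mem_sym2_iff]
    exact (mem_filter.1 (hM he)).2
  · exact SimpleGraph.mem_edgeFinset.1 (mem_filter.1 (hM he)).1

/-- Random regular graphs are locally sparse. -/
theorem card_hasDenseSet_le {Δ k r : ℕ} (hΔ : 0 < Δ) (hk : 0 < k) (hrk : r ≤ k)
    (hkn : 2 * (2 * (2 * k + 1) + 2 * ((Δ + 1) * Δ)) ≤ Fintype.card V * Δ)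
    (hV : 0 < Fintype.card V) :
    (((regularContaining Δ (∅ : Finset (Sym2 V))).filter (HasDenseSet k r)).card : ℝ) ≤
      (k + 1) * (Real.exp (2 * k) * (2 * Δ) ^ (3 * k) * (k / Fintype.card V) ^ (r + 1)) *
        (regularContaining Δ (∅ : Finset (Sym2 V))).card := by
  set n := Fintype.card V with hn
  set N : ℝ := ((regularContaining Δ (∅ : Finset (Sym2 V))).card : ℝ) with hN
  have hn0 : (0 : ℝ) < n := by exact_mod_cast hV
  have hk0 : (0 : ℝ) < k := by exact_mod_cast hk
  have hΔ1 : (1 : ℝ) ≤ 2 * Δ := by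
    have : (1 : ℝ) ≤ Δ := by exact_mod_cast hΔ
    linarith
  have hcover : (regularContaining Δ (∅ : Finset (Sym2 V))).filter (HasDenseSet k r) ⊆
      (range (k + 1)).biUnion fun s => (powersetCard s (univ : Finset V)).biUnion fun S =>
        (powersetCard (s + r + 1) S.sym2).biUnion fun M => regularContaining Δ M := by
    intro G hG
    obtain ⟨h1, S, hS, M, hM, hcard, hMG⟩ := mem_filter.1 hG
    refine mem_biUnion.2 ⟨S.card, mem_range.2 (by omega), mem_biUnion.2 ⟨S,
      mem_powersetCard.2 ⟨subset_univ _, rfl⟩, mem_biUnion.2 ⟨M,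
        mem_powersetCard.2 ⟨hM, hcard⟩, ?_⟩⟩⟩
    exact mem_regularContaining.2 ⟨(mem_regularContaining.1 h1).1, hMG⟩
  have hM : ∀ s ∈ range (k + 1), ∀ S ∈ powersetCard s (univ : Finset V),
      ∀ M ∈ powersetCard (s + r + 1) S.sym2,
      ((regularContaining Δ M).card : ℝ) ≤ (2 * Δ / n) ^ (s + r + 1) * N := by
    intro s hs S _ M hM
    have hMc := (mem_powersetCard.1 hM).2
    rw [mem_range] at hs
    rw [← hMc]
    exact card_regularContaining_le hV hΔ M (by rw [hMc, ← hn]; omega)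
  have hs : ∀ s ∈ range (k + 1), ∑ S ∈ powersetCard s (univ : Finset V),
      ∑ M ∈ powersetCard (s + r + 1) S.sym2, ((regularContaining Δ M).card : ℝ) ≤
      Real.exp (2 * k) * (2 * Δ) ^ (3 * k) * (k / n) ^ (r + 1) * N := by
    intro s hs
    have hsk : s ≤ k := by rw [mem_range] at hs; omega
    have h1 : ∀ S ∈ powersetCard s (univ : Finset V),
        ∑ M ∈ powersetCard (s + r + 1) S.sym2, ((regularContaining Δ M).card : ℝ) ≤
        k ^ (s + r + 1) * Real.exp k * ((2 * Δ / n) ^ (s + r + 1) * N) := by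
      intro S hS
      refine (sum_le_card_nsmul _ _ _ (hM s hs S hS)).trans ?_
      rw [nsmul_eq_mul, card_powersetCard]
      refine mul_le_mul_of_nonneg_right ?_ (by positivity)
      -- With at most `k * k` possible edges, `x = 1 / k` costs only `exp k`. Below, `x = k / n`
      -- does the same for the choice of `S`. The powers of `n` then cancel down to `(k / n) ^ (r +
      -- 1)`.
      have h2 := choose_mul_pow_le_exp S.sym2.card (s + r + 1) (x := 1 / k) (by positivity)
      have h3 : (S.sym2.card : ℝ) * (1 / k) ≤ k := by
        rw [mul_one_div, div_le_iff₀ hk0]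
        have : S.sym2.card ≤ k * k := by
          rw [card_sym2, (mem_powersetCard.1 hS).2, Nat.choose_two_right, Nat.add_sub_cancel]
          have : (s + 1) * s ≤ 2 * (k * k) := by nlinarith
          omega
        exact_mod_cast this
      have h4 := h2.trans (Real.exp_le_exp.2 h3)
      rw [one_div, inv_pow, ← div_eq_mul_inv, div_le_iff₀ (pow_pos hk0 _)] at h4
      linarith
    refine (sum_le_card_nsmul _ _ _ h1).trans ?_
    rw [nsmul_eq_mul, card_powersetCard, card_univ, ← hn]
    have h2 : (n.choose s : ℝ) ≤ Real.exp k * (n / k) ^ s := by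
      have h3 := choose_mul_pow_le_exp n s (x := k / n) (by positivity)
      rw [mul_div_cancel₀ _ hn0.ne', div_pow, mul_div_assoc', div_le_iff₀ (pow_pos hn0 _)] at h3
      rw [div_pow, mul_div_assoc', le_div_iff₀ (pow_pos hk0 _)]
      exact h3
    calc (n.choose s : ℝ) * (k ^ (s + r + 1) * Real.exp k * ((2 * Δ / n) ^ (s + r + 1) * N))
        ≤ Real.exp k * (n / k) ^ s *
          (k ^ (s + r + 1) * Real.exp k * ((2 * Δ / n) ^ (s + r + 1) * N)) :=
          mul_le_mul_of_nonneg_right h2 (by positivity)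
      _ = Real.exp k * Real.exp k * (2 * Δ) ^ (s + r + 1) * (k / n) ^ (r + 1) * N := by
          rw [add_assoc s r 1, pow_add _ s, pow_add _ s, pow_add _ s, div_pow, div_pow, div_pow,
            div_pow]
          field_simp
      _ ≤ Real.exp k * Real.exp k * (2 * Δ) ^ (3 * k) * (k / n) ^ (r + 1) * N := by
          have : (2 * Δ : ℝ) ^ (s + r + 1) ≤ (2 * Δ) ^ (3 * k) :=
            pow_le_pow_right₀ hΔ1 (by omega)
          gcongr
      _ = _ := by rw [← Real.exp_add, two_mul (k : ℝ)]
  calc _ ≤ ((∑ s ∈ range (k + 1), ∑ S ∈ powersetCard s (univ : Finset V),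
        ∑ M ∈ powersetCard (s + r + 1) S.sym2, (regularContaining Δ M).card : ℕ) : ℝ) := by
        refine Nat.cast_le.2 ((card_le_card hcover).trans ?_)
        refine card_biUnion_le.trans (sum_le_sum fun s _ => ?_)
        exact card_biUnion_le.trans (sum_le_sum fun S _ => card_biUnion_le)
    _ ≤ ∑ s ∈ range (k + 1), Real.exp (2 * k) * (2 * Δ) ^ (3 * k) * (k / n) ^ (r + 1) * N := by
        push_cast
        exact sum_le_sum hs
    _ = _ := by
        rw [sum_const, card_range, nsmul_eq_mul]
        push_cast
        ring

end Sparsity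

/-! ### Exponential lower bound for almost all regular graphs -/

section Slow

open Finset

/-- Regular graphs without small dense sets mix slowly. -/
lemma le_glauberMixingTime_of_sparse {V : Type u} [Fintype V] [Nonempty V] [DecidableEq V]
    (G : SimpleGraph V) [DecidableRel G.Adj] {q : ℕ} {lam : ℝ} (hlam : 1 ≤ lam) (hq : 2 ≤ q)
    {Δ : ℕ} (hΔ : 3 ≤ Δ) (hdeg : ∀ v, G.degree v = Δ) {η δ : ℝ} (hη : 0 < η) (hδ : 0 < δ)
    (hδ1 : δ ≤ 1)
    (hqlt : (q : ℝ) ≤ (δ / (2 * Δ * Real.exp 2)) ^ 2 *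
      lam ^ ((Δ : ℝ) - 1 - 1 / ((Δ : ℝ) - 1) - η))
    {k r : ℕ} (hk : 2 * k < Fintype.card V) (hkδ : δ * Fintype.card V ≤ k)
    (hr : 4 * (r : ℝ) ≤ η * k)
    (hexp : ∀ S : Finset V, S.card ≤ k → (inner G S).card ≤ S.card + r) {ε : ℝ}
    (hε : ε < 1 / 2) :
    ENNReal.ofReal ((1 / 2 - ε) * Real.exp k) ≤ (glauberMixingTime G lam q ε : ℝ≥0∞) := by
  have hlam0 : 0 < lam := zero_lt_one.trans_le hlam
  set n := Fintype.card V with hn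
  have hΔ3 : (3 : ℝ) ≤ Δ := by exact_mod_cast hΔ
  have hΔcast : ((Δ - 1 : ℕ) : ℝ) = (Δ : ℝ) - 1 := by
    rw [Nat.cast_sub (by omega), Nat.cast_one]
  -- Normalised so that `(e / δ) * Δ * (2 * e0) = 1 / e`: the number of choices of the `k` vertices
  -- and the factor `Δ` are beaten with `exp (-k)` to spare.
  set e0 := δ / (2 * Δ * Real.exp 2) with he0
  have he0pos : 0 < e0 := by positivity
  have he01 : e0 ≤ 1 := by
    rw [he0, div_le_one (by positivity)]
    have h1 : 1 ≤ Real.exp 2 := Real.one_le_exp (by norm_num)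
    nlinarith
  set p := (Δ : ℝ) - 1 - 1 / ((Δ : ℝ) - 1) - η with hp
  -- Only the sign of this term matters. The factor `q` needs `p + η / 2 ≤ Δ - 1`; the factor `lam *
  -- √q` needs `1 + p / 2 + η / 2 ≤ Δ - 1`, which is where `Δ ≥ 3` enters.
  have hfrac : 0 ≤ 1 / ((Δ : ℝ) - 1) := div_nonneg zero_le_one (by linarith)
  have hsqrt : √(q : ℝ) ≤ e0 * lam ^ (p / 2) := by
    rw [Real.sqrt_le_left (by positivity), mul_pow, ← Real.rpow_natCast (lam ^ (p / 2)),
      ← Real.rpow_mul hlam0.le]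
    norm_num
    exact hqlt
  have hbase : lam ^ (η / 2) * (lam * √(q : ℝ) + q) ≤ 2 * e0 * lam ^ (Δ - 1) := by
    have h1 : lam ^ (η / 2) * (lam * √(q : ℝ)) ≤ e0 * lam ^ (Δ - 1) := by
      calc lam ^ (η / 2) * (lam * √(q : ℝ)) ≤ lam ^ (η / 2) * (lam * (e0 * lam ^ (p / 2))) := by
            gcongr
        _ = e0 * lam ^ (η / 2 + 1 + p / 2) := by
            rw [Real.rpow_add hlam0, Real.rpow_add hlam0, Real.rpow_one]; ring
        _ ≤ e0 * lam ^ ((Δ - 1 : ℕ) : ℝ) := by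
            refine mul_le_mul_of_nonneg_left ?_ he0pos.le
            refine Real.rpow_le_rpow_of_exponent_le hlam ?_
            rw [hΔcast, hp]
            linarith
        _ = _ := by rw [Real.rpow_natCast]
    have h2 : lam ^ (η / 2) * (q : ℝ) ≤ e0 * lam ^ (Δ - 1) := by
      calc lam ^ (η / 2) * (q : ℝ) ≤ lam ^ (η / 2) * (e0 ^ 2 * lam ^ p) := by gcongr
        _ = e0 ^ 2 * lam ^ (η / 2 + p) := by rw [Real.rpow_add hlam0]; ring
        _ ≤ e0 * lam ^ ((Δ - 1 : ℕ) : ℝ) := by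
            refine mul_le_mul (pow_le_of_le_one he0pos.le he01 two_ne_zero) ?_ (by positivity)
              he0pos.le
            refine Real.rpow_le_rpow_of_exponent_le hlam ?_
            rw [hΔcast, hp]
            linarith
        _ = _ := by rw [Real.rpow_natCast]
    linarith
  have hlam2r : lam ^ (2 * r) ≤ (lam ^ (η / 2)) ^ k := by
    rw [← Real.rpow_natCast, ← Real.rpow_natCast (lam ^ (η / 2)), ← Real.rpow_mul hlam0.le]
    refine Real.rpow_le_rpow_of_exponent_le hlam ?_
    push_cast
    linarith
  have hchoose : (n.choose k : ℝ) ≤ (Real.exp 1 / δ) ^ k := by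
    have h1 := choose_mul_pow_le_exp n k hδ.le
    rw [div_pow, le_div_iff₀ (pow_pos hδ _), ← Real.exp_nat_mul, mul_one]
    exact h1.trans (Real.exp_le_exp.2 (by linarith))
  have hbd : ∑ σ ∈ univ.filter (fun σ : V → Fin q =>
      (offColour (⟨0, by omega⟩ : Fin q) σ).card = k), lam ^ monoEdges G σ ≤
      Real.exp (-k) * lam ^ G.edgeFinset.card := by
    have h1 := boundary_weight_le G hlam (by omega) hdeg hexp (⟨0, by omega⟩ : Fin q)
    refine le_of_mul_le_mul_right (h1.trans ?_) (pow_pos hlam0 ((Δ - 1) * k))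
    rw [← hn, pow_add]
    have h2 : lam ^ (2 * r) * ((n.choose k : ℝ) * (Δ * (lam * √q + q)) ^ k) ≤
        Real.exp (-k) * lam ^ ((Δ - 1) * k) := by
      calc lam ^ (2 * r) * ((n.choose k : ℝ) * (Δ * (lam * √q + q)) ^ k)
          ≤ (lam ^ (η / 2)) ^ k * ((Real.exp 1 / δ) ^ k * (Δ * (lam * √q + q)) ^ k) := by
            gcongr
        _ = (Real.exp 1 / δ * Δ * (lam ^ (η / 2) * (lam * √q + q))) ^ k := by
            rw [← mul_pow, ← mul_pow]; ring
        _ ≤ (Real.exp 1 / δ * Δ * (2 * e0 * lam ^ (Δ - 1))) ^ k := by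
            gcongr
        _ = (Real.exp (-1) * lam ^ (Δ - 1)) ^ k := by
            congr 1
            have h3 : Real.exp 2 = Real.exp 1 * Real.exp 1 := by rw [← Real.exp_add]; norm_num
            rw [he0, h3, Real.exp_neg]
            have := Real.exp_pos 1
            field_simp
        _ = _ := by
            rw [mul_pow, ← Real.exp_nat_mul, ← pow_mul]
            congr 2
            ring
    calc lam ^ G.edgeFinset.card * lam ^ (2 * r) *
          ((n.choose k : ℝ) * (Δ * (lam * √q + q)) ^ k)
        = lam ^ G.edgeFinset.card * (lam ^ (2 * r) *
          ((n.choose k : ℝ) * (Δ * (lam * √q + q)) ^ k)) := by ring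
      _ ≤ lam ^ G.edgeFinset.card * (Real.exp (-k) * lam ^ ((Δ - 1) * k)) :=
          mul_le_mul_of_nonneg_left h2 (by positivity)
      _ = _ := by ring
  have hcd : (⟨0, by omega⟩ : Fin q) ≠ ⟨1, by omega⟩ := by simp
  have h := le_glauberMixingTime G hlam0 hcd hk (Real.exp_pos (-k)) hbd hε
  rwa [Real.exp_neg, div_inv_eq_mul] at h

open Filter

open Classical in
/-- A property of all regular graphs without small dense sets holds for almost all regular
graphs. -/
lemma almostAllRegular_of_sparse {Δ : ℕ} (hΔ : 1 ≤ Δ) {η δ : ℝ} (hη4 : η ≤ 4)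
    (hδ : 0 < δ) (hδ16 : 2 * δ ≤ 1 / 16)
    (hδA : Real.exp 2 * (2 * Δ) ^ 3 * (2 * δ) ^ (η / 4) ≤ 1 / 2)
    (A : (n : ℕ) → SimpleGraph (Fin n) → Prop)
    (hA : ∀ᶠ n : ℕ in atTop, ∀ G : SimpleGraph (Fin n),
      (∀ v, (univ.filter fun w => G.Adj v w).card = Δ) →
      ¬ HasDenseSet ⌈δ * n⌉₊ ⌊η * ⌈δ * n⌉₊ / 4⌋₊ G → A n G) :
    AlmostAllRegular Δ A := by
  have hlim : Tendsto (fun n : ℕ => ⌈δ * n⌉₊) atTop atTop :=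
    tendsto_nat_ceil_atTop.comp ((tendsto_natCast_atTop_atTop).const_mul_atTop hδ)
  have hf : Tendsto (fun k : ℕ => 1 - ((k : ℝ) + 1) * (1 / 2) ^ k) atTop (𝓝 1) := by
    have h1 := tendsto_self_mul_const_pow_of_lt_one (r := (1 / 2 : ℝ)) (by norm_num) (by norm_num)
    have h2 := tendsto_pow_atTop_nhds_zero_of_lt_one (r := (1 / 2 : ℝ)) (by norm_num)
      (by norm_num)
    have h3 := (h1.add h2).const_sub 1
    rw [add_zero, sub_zero] at h3
    refine h3.congr fun k => ?_
    ring
  have hlarge : ∀ᶠ n : ℕ in atTop, 1 ≤ δ * n ∧ (4 + 4 * ((Δ + 1) * Δ) : ℝ) ≤ n / 2 ∧ Δ < n := by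
    have h1 : Tendsto (fun n : ℕ => δ * (n : ℝ)) atTop atTop :=
      (tendsto_natCast_atTop_atTop).const_mul_atTop hδ
    have h2 : Tendsto (fun n : ℕ => (n : ℝ) / 2) atTop atTop :=
      (tendsto_natCast_atTop_atTop).atTop_div_const (by norm_num)
    exact (h1.eventually_ge_atTop 1).and ((h2.eventually_ge_atTop _).and (eventually_gt_atTop Δ))
  refine tendsto_of_tendsto_of_tendsto_of_le_of_le' ((hf.comp hlim).mono_left inf_le_left)
    tendsto_const_nhds ?_ ?_
  · rw [eventually_inf_principal]
    filter_upwards [hA, hlarge] with n hAn ⟨hn1, hn2, hn3⟩ heven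
    set k := ⌈δ * n⌉₊ with hk
    set r := ⌊η * k / 4⌋₊ with hr
    set R := regularContaining Δ (∅ : Finset (Sym2 (Fin n))) with hR
    have hn0 : (0 : ℝ) < n := by
      have : 0 < n := by omega
      exact_mod_cast this
    have hkle : (k : ℝ) ≤ 2 * δ * n := by
      have := (Nat.ceil_lt_add_one (show 0 ≤ δ * (n : ℝ) by positivity)).le
      linarith
    have hk1 : 0 < k := Nat.ceil_pos.2 (by linarith)
    have hrk : r ≤ k := by
      refine Nat.floor_le_of_le ?_
      have : (0 : ℝ) ≤ k := Nat.cast_nonneg k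
      nlinarith
    have hreg : ∀ G : SimpleGraph (Fin n), G ∈ R ↔
        ∀ v, (univ.filter fun w => G.Adj v w).card = Δ := by
      intro G
      rw [hR, mem_regularContaining]
      simp only [notMem_empty, false_imp_iff, implies_true, and_true]
    have hRpos : (0 : ℝ) < R.card := by
      exact_mod_cast card_pos.2 (regularContaining_nonempty hn3 heven)
    have hkn : 2 * (2 * (2 * k + 1) + 2 * ((Δ + 1) * Δ)) ≤ Fintype.card (Fin n) * Δ := by
      rw [Fintype.card_fin]
      have hΔ1 : (1 : ℝ) ≤ Δ := by exact_mod_cast hΔ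
      have h1 : (2 * (2 * (2 * k + 1) + 2 * ((Δ + 1) * Δ)) : ℝ) ≤ n * Δ := by nlinarith
      exact_mod_cast h1
    have hdense := card_hasDenseSet_le (V := Fin n) (r := r) (by omega : 0 < Δ) hk1 hrk hkn
      (by rw [Fintype.card_fin]; omega)
    rw [Fintype.card_fin] at hdense
    have hfactor : Real.exp (2 * k) * (2 * Δ) ^ (3 * k) * (k / n : ℝ) ^ (r + 1) ≤
        (1 / 2) ^ k := by
      have h1 : (k / n : ℝ) ^ (r + 1) ≤ ((2 * δ) ^ (η / 4)) ^ k := by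
        calc (k / n : ℝ) ^ (r + 1) ≤ (2 * δ) ^ (r + 1) := by
              refine pow_le_pow_left₀ (by positivity) ?_ _
              rw [div_le_iff₀ hn0]
              exact hkle
          _ = (2 * δ) ^ ((r + 1 : ℕ) : ℝ) := (Real.rpow_natCast _ _).symm
          -- The base is below one, and the `+ 1` in `r + 1` makes up for the rounding in `r`.
          _ ≤ (2 * δ) ^ (η / 4 * k) := by
              refine Real.rpow_le_rpow_of_exponent_ge (by positivity) (by linarith) ?_
              have := (Nat.lt_floor_add_one (η * k / 4)).le
              push_cast
              linarith
          _ = _ := by rw [Real.rpow_mul (by positivity), Real.rpow_natCast]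
      calc _ ≤ Real.exp (2 * k) * (2 * Δ) ^ (3 * k) * ((2 * δ) ^ (η / 4)) ^ k :=
            mul_le_mul_of_nonneg_left h1 (by positivity)
        _ = (Real.exp 2 * (2 * Δ) ^ 3 * (2 * δ) ^ (η / 4)) ^ k := by
            rw [mul_pow _ _ k, mul_pow _ _ k, ← pow_mul (2 * (Δ : ℝ)), ← Real.exp_nat_mul,
              mul_comm (2 : ℝ) (k : ℝ)]
        _ ≤ _ := pow_le_pow_left₀ (by positivity) hδA k
    have hbad : ((R.filter (HasDenseSet k r)).card : ℝ) ≤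
        ((k : ℝ) + 1) * (1 / 2) ^ k * R.card := by
      refine hdense.trans ?_
      gcongr
    have hsplit : ((R.filter fun G => ¬ HasDenseSet k r G).card : ℝ) =
        R.card - (R.filter (HasDenseSet k r)).card := by
      rw [← card_filter_add_card_filter_not (s := R) (HasDenseSet k r)]
      push_cast
      ring
    have hden : {G : SimpleGraph (Fin n) | G.IsRegularOfDegree Δ}.ncard = R.card := by
      rw [← Set.ncard_coe_finset]
      congr 1
      ext G
      rw [mem_coe, hreg, Set.mem_ofPred_eq, isRegularOfDegree_iff_card]
    have hnum : (R.filter fun G => ¬ HasDenseSet k r G).card ≤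
        {G : SimpleGraph (Fin n) | G.IsRegularOfDegree Δ ∧ A n G}.ncard := by
      rw [← Set.ncard_coe_finset]
      refine Set.ncard_le_ncard ?_ (Set.toFinite _)
      intro G hG
      obtain ⟨h1, h2⟩ := mem_filter.1 hG
      have h3 := (hreg G).1 h1
      refine ⟨?_, hAn G h3 h2⟩
      rwa [isRegularOfDegree_iff_card]
    have hnum' : ((R.filter fun G => ¬ HasDenseSet k r G).card : ℝ) ≤
        ({G : SimpleGraph (Fin n) | G.IsRegularOfDegree Δ ∧ A n G}.ncard : ℝ) := by
      exact_mod_cast hnum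
    rw [Function.comp_apply, hden, le_div_iff₀ hRpos]
    linarith
  · refine Eventually.of_forall fun n => div_le_one_of_le₀ ?_ (Nat.cast_nonneg _)
    refine Nat.cast_le.2 (Set.ncard_le_ncard (fun G hG => hG.1) (Set.toFinite _))

/-- Slow mixing for few colours on almost all regular graphs. -/
theorem mixesSlowlyAlmostAllRegular_of_lt {Δ : ℕ} (hΔ : 3 ≤ Δ) {η δ : ℝ} (hη : 0 < η)
    (hη4 : η ≤ 4) (hδ : 0 < δ) (hδ16 : 2 * δ ≤ 1 / 16)
    (hδA : Real.exp 2 * (2 * Δ) ^ 3 * (2 * δ) ^ (η / 4) ≤ 1 / 2) {q : ℕ} {lam : ℝ} (hq : 2 ≤ q)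
    (hlam : 1 ≤ lam) (hqlt : (q : ℝ) ≤ (δ / (2 * Δ * Real.exp 2)) ^ 2 *
      lam ^ ((Δ : ℝ) - 1 - 1 / ((Δ : ℝ) - 1) - η)) :
    MixesSlowlyAlmostAllRegular lam q Δ := by
  classical
  -- Half of the available exponent `δ * n` is given up to absorb the prefactor `1 / 2 - ε`, so that
  -- the rate does not depend on `ε`.
  refine ⟨δ / 2, by positivity, fun ε _ hε => ?_⟩
  refine almostAllRegular_of_sparse (by omega) hη4 hδ hδ16 hδA _ ?_
  have h1 : Tendsto (fun n : ℕ => δ * (n : ℝ)) atTop atTop :=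
    (tendsto_natCast_atTop_atTop).const_mul_atTop hδ
  have h2 : Tendsto (fun n : ℕ => Real.exp (δ / 2 * n)) atTop atTop :=
    Real.tendsto_exp_atTop.comp ((tendsto_natCast_atTop_atTop).const_mul_atTop (by positivity))
  filter_upwards [h1.eventually_ge_atTop 1, h2.eventually_ge_atTop (1 / (1 / 2 - ε)),
    eventually_gt_atTop 0] with n hn1 hn2 hn0 G hG hdense
  have hn0' : (0 : ℝ) < n := by exact_mod_cast hn0
  have : Nonempty (Fin n) := ⟨⟨0, hn0⟩⟩
  have hkle : (⌈δ * n⌉₊ : ℝ) ≤ 2 * δ * n := by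
    have := (Nat.ceil_lt_add_one (show 0 ≤ δ * (n : ℝ) by positivity)).le
    linarith
  have hkge : δ * n ≤ (⌈δ * n⌉₊ : ℝ) := Nat.le_ceil _
  have h := le_glauberMixingTime_of_sparse G hlam hq hΔ
    (fun v => ((isRegularOfDegree_iff_card G Δ).2 (fun v => by convert hG v)) v) hη hδ
    (by linarith) hqlt
    (k := ⌈δ * n⌉₊) (r := ⌊η * ⌈δ * n⌉₊ / 4⌋₊)
    (by
      rw [Fintype.card_fin]
      have : (2 * ⌈δ * n⌉₊ : ℝ) < n := by nlinarith
      exact_mod_cast this)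
    (by rw [Fintype.card_fin]; exact hkge)
    (by
      have := Nat.floor_le (show 0 ≤ η * (⌈δ * n⌉₊ : ℝ) / 4 by positivity)
      linarith)
    (fun S hS => card_inner_le_of_not_hasDenseSet hdense S hS) hε
  refine le_trans (ENNReal.ofReal_le_ofReal ?_) (by convert h)
  have hε' : 0 < 1 / 2 - ε := by linarith
  rw [div_le_iff₀ hε'] at hn2
  calc Real.exp (δ / 2 * n) ≤ Real.exp (δ / 2 * n) * (Real.exp (δ / 2 * n) * (1 / 2 - ε)) :=
        le_mul_of_one_le_right (Real.exp_pos _).le hn2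
    _ = (1 / 2 - ε) * Real.exp (δ * n) := by
        rw [← mul_assoc, ← Real.exp_add, mul_comm]
        congr 2
        ring
    _ ≤ _ := mul_le_mul_of_nonneg_left (Real.exp_le_exp.2 hkge) hε'.le

end Slow

end Potts

/-! ### Choice of the constants -/

theorem theorem2 (Δ : ℕ) (hΔ : 2 ≤ Δ) (η : ℝ) (hη0 : 0 < η) (hη1 : η < 1) :
    ∃ c₁ c₂ : ℝ, 0 < c₁ ∧ 0 < c₂ ∧
      ∀ (q : ℕ) (lam : ℝ), 2 ≤ q → 1 < lam →
        (c₁ * lam ^ ((Δ : ℝ) - 1 + η) < (q : ℝ) →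
          Potts.MixesRapidlyOn.{u} lam q (Potts.ConnectedMaxDegree Δ)) ∧
        (3 ≤ Δ → (q : ℝ) < c₂ * lam ^ ((Δ : ℝ) - 1 - 1 / ((Δ : ℝ) - 1) - η) →
          Potts.MixesSlowlyAlmostAllRegular lam q Δ) := by
  have hΔ2 : (2 : ℝ) ≤ Δ := by exact_mod_cast hΔ
  set m := ⌈1 / η⌉₊ with hm
  have hm1 : 1 ≤ m := Nat.ceil_pos.2 (by positivity)
  have hm0 : (0 : ℝ) < m := by exact_mod_cast hm1
  have hmη : 1 ≤ η * m := by
    have := Nat.le_ceil (1 / η)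
    rw [div_le_iff₀ hη0] at this
    linarith
  set A : ℝ := Real.exp 2 * (2 * Δ) ^ 3 with hA
  have hA16 : 16 ≤ 2 * A := by
    have h1 : 1 ≤ Real.exp 2 := Real.one_le_exp (by norm_num)
    have h2 : (4 : ℝ) ^ 3 ≤ (2 * Δ) ^ 3 := pow_le_pow_left₀ (by norm_num) (by linarith) 3
    nlinarith
  -- Solves `A * (2 * δ) ^ (η / 4) = 1 / 2`, so that the first moment bound for dense sets decays
  -- like `(1 / 2) ^ k` up to a factor `k + 1`.
  set δ : ℝ := 1 / 2 * (1 / (2 * A)) ^ (4 / η) with hδ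
  have hδ0 : 0 < δ := by positivity
  have h2δ : 2 * δ = (1 / (2 * A)) ^ (4 / η) := by rw [hδ]; ring
  have hδA : A * (2 * δ) ^ (η / 4) ≤ 1 / 2 := by
    rw [h2δ, ← Real.rpow_mul (by positivity)]
    have : 4 / η * (η / 4) = 1 := by field_simp
    rw [this, Real.rpow_one]
    have : 0 < A := by positivity
    apply le_of_eq
    field_simp
  have hδ16 : 2 * δ ≤ 1 / 16 := by
    rw [h2δ]
    have h1 : 1 / (2 * A) ≤ 1 / 16 := one_div_le_one_div_of_le (by norm_num) hA16
    have h2 : (1 / (2 * A)) ^ (4 / η) ≤ (1 / (2 * A)) ^ (1 : ℝ) := by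
      refine Real.rpow_le_rpow_of_exponent_ge (by positivity) (by linarith) ?_
      rw [le_div_iff₀ hη0]
      linarith
    rw [Real.rpow_one] at h2
    exact h2.trans h1
  refine ⟨8 * 2 ^ m * Δ * m, (δ / (2 * Δ * Real.exp 2)) ^ 2, by positivity, by positivity,
    fun q lam hq hlam => ⟨fun h => ?_, fun hΔ3 h => ?_⟩⟩
  · exact Potts.mixesRapidlyOn_of_lt (by omega) hm1 hη0.le hmη hlam.le h
  · exact Potts.mixesSlowlyAlmostAllRegular_of_lt hΔ3 hη0 (by linarith) hδ0 hδ16 hδA hq hlam.le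
      h.le
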